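/- Let $\mathbb{K}$ be a field of characteristic $0$, and let $n,N,N'$ be non-negative integers. Let $\mathrm{U}(n)=\mathbb{K}[\tilde h_1,\dots,\tilde h_n]$, put $\tilde h_{ij}=\tilde h_i-\tilde h_j$, and let $\bar{\mathrm U}(n)$ be the localization of $\mathrm U(n)$ at the multiplicative set generated by the elements $\tilde h_{ij}+k$ with $i\neq j$ and $k\in\mathbb{Z}$. Let $\hat{\mathrm R}^{ij}_{kl}\in\bar{\mathrm U}(n)$ be the array whose only non-zero components are $$\hat{\mathrm R}^{ij}_{ij}=\frac{1}{\tilde h_{ij}}\ (i\ne j),\qquad \hat{\mathrm R}^{ij}_{ji}=\frac{\tilde h_{ij}^2-1}{\tilde h_{ij}^2}\ (i<j),\qquad \hat{\mathrm R}^{ij}_{ji}=1\ (i\ge j).$$ For a family $\sigma=(\sigma_{i\alpha\beta})$ of elements of $\bar{\mathrm U}(n)$, where $1\le i\le n$, $1\le\alpha\le N'$, $1\le\beta\le N$, let $\mathcal L(\sigma)$ be the ring generated over $\bar{\mathrm U}(n)$ by $x^{i\alpha}$ ($1\le i\le n$, $1\le\alpha\le N'$) and $\bar\partial_{j\beta}$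 ($1\le j\le n$, $1\le\beta\le N$) with the defining relations $$\tilde h_i x^{j\alpha}=x^{j\alpha}(\tilde h_i+\delta_i^j),\qquad \tilde h_i\bar\partial_{j\beta}=\bar\partial_{j\beta}(\tilde h_i-\delta_i^j),$$ $$x^{i\alpha}x^{j\beta}=\sum_{k,l}\hat{\mathrm R}^{ij}_{kl}\,x^{k\beta}x^{l\alpha},\qquad \bar\partial_{l\alpha}\bar\partial_{k\beta}=\sum_{i,j}\bar\partial_{j\beta}\bar\partial_{i\alpha}\,\hat{\mathrm R}^{ij}_{kl},$$ $$x^{i\alpha}\bar\partial_{j\beta}=\sum_{k,l}\bar\partial_{k\beta}\,\hat{\mathrm R}^{ki}_{lj}\,x^{l\alpha}-\delta^i_j\,\sigma_{i\alpha\beta}.$$ The ring $\mathcal L(\sigma)$ is said to have the PBW property if the ordered monomials in its generators, taken in the order $\bar\partial_{n1},\dots,\bar\partial_{nN},\dots,\bar\partial_{11},\dots,\bar\partial_{1N},x^{11},\dots,x^{1N'},\dots,x^{n1},\dots,x^{nN'}$, form a basis of $\mathcal L(\sigma)$ as a left $\bar{\mathrm U}(n)$-module. Denote by $\mathrm{V}(n)$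 the ring $\mathcal L$ with $N'=1$, $N=0$, by $\mathrm{V}^*(n)$ the ring $\mathcal L$ with $N'=0$, $N=1$, by $\mathrm{Diff}_{\mathbf h}(n,N)$ the ring $\mathcal L(\sigma)$ with $N'=N$ and $\sigma_{i\alpha\beta}=\delta_{\alpha\beta}$, and put $\mathrm{Diff}_{\mathbf h}(n)=\mathrm{Diff}_{\mathbf h}(n,1)$. Assume that $N>1$ or $N'>1$. Then: (1) $\mathcal L(\sigma)$ has the PBW property if and only if there are constants $\sigma^\alpha_\beta\in\mathbb{K}$ such that $\sigma_{i\alpha\beta}=\sigma^\alpha_\beta$ for all $i,\alpha,\beta$. (2) If $\mathcal L(\sigma)$ has the PBW property, then there are an integer $0\le r\le\min(N,N')$, matrices $A\in GL(N',\mathbb{K})$ and $B\in GL(N,\mathbb{K})$, and an isomorphism from $\mathcal L(\sigma)$ to the ring $\mathcal L_r$ with zero-order terms given by the matrix $\mathrm{diag}(1,\dots,1,0,\dots,0)$ with $r$ ones; the isomorphism is the identity on $\bar{\mathrm U}(n)$ and sends $x^{i\alpha}\mapsto\sum_{\alpha'}A^\alpha_{\alpha'}x^{i\alpha'}$, $\bar\partial_{i\beta}\mapsto\sum_{\beta'}B_\beta^{\beta'}\bar\partial_{i\beta'}$.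 The ring $\mathcal L_r$ is formed by $r$ copies of $\mathrm{Diff}_{\mathbf h}(n)$, $N'-r$ copies of $\mathrm V(n)$ and $N-r$ copies of $\mathrm V^*(n)$: over $\bar{\mathrm U}(n)$, there are injective homomorphisms $\mathrm{Diff}_{\mathbf h}(n)\to\mathcal L_r$, $x^i\mapsto x^{i\alpha}$, $\bar\partial_i\mapsto\bar\partial_{i\alpha}$, for each $\alpha\le r$; $\mathrm V(n)\to\mathcal L_r$, $x^i\mapsto x^{i\alpha}$, for each $r<\alpha\le N'$; and $\mathrm V^*(n)\to\mathcal L_r$, $\bar\partial_i\mapsto\bar\partial_{i\beta}$, for each $r<\beta\le N$. (3) The ring $\mathrm{Diff}_{\mathbf h}(n,M)$, $M>1$, is essentially unique: if $N=N'=M$, the ring $\mathcal L(\tau)$ has the PBW property, and for every $i$ the matrix $(\tau_{i\alpha\beta})_{\alpha,\beta}$ has non-zero determinant, then $\mathcal L(\tau)$ is isomorphic to $\mathrm{Diff}_{\mathbf h}(n,M)$ by an isomorphism that is the identity on $\bar{\mathrm U}(n)$ and acts on the generators by a linear redefinition as in (2). -/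

import Mathlib

noncomputable section

namespace HDeformed

/-- The multiplicative set of denominators in `U(n) = K[h₁, …, hₙ]`, generated by the elements
`hᵢ - hⱼ + k` with `i ≠ j` and `k` an integer. -/
def denominators (K : Type*) [Field K] (n : ℕ) : Submonoid (MvPolynomial (Fin n) K) :=
  Submonoid.closure {p | ∃ i j : Fin n, i ≠ j ∧ ∃ k : ℤ,
    p = MvPolynomial.X i - MvPolynomial.X j + MvPolynomial.C (k : K)}

/-- The coefficient ring `Ū(n)`, the localization of `U(n)` at `denominators K n`. -/
abbrev Ubar (K : Type*) [Field K] (n : ℕ) : Type _ := Localization (denominators K n)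

/-- The generator `hᵢ` of `Ū(n)`. -/
def hgen (K : Type*) [Field K] {n : ℕ} (i : Fin n) : Ubar K n :=
  algebraMap (MvPolynomial (Fin n) K) (Ubar K n) (MvPolynomial.X i)

/-- The difference `hᵢⱼ = hᵢ - hⱼ`. -/
def hdiff (K : Type*) [Field K] {n : ℕ} (i j : Fin n) : Ubar K n := hgen K i - hgen K j

theorem isUnit_hdiff (K : Type*) [Field K] {n : ℕ} {i j : Fin n} (hij : i ≠ j) :
    IsUnit (hdiff K i j) := by
  have hmem : (MvPolynomial.X i - MvPolynomial.X j : MvPolynomial (Fin n) K) ∈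
      denominators K n :=
    Submonoid.subset_closure ⟨i, j, hij, 0, by simp⟩
  have h := IsLocalization.map_units (Ubar K n)
    (⟨MvPolynomial.X i - MvPolynomial.X j, hmem⟩ : denominators K n)
  simpa [hdiff, hgen] using h

/-- The entry `R^{ij}_{kl}` of the standard dynamical R-matrix of type A. The non-zero entries are
`R^{ij}_{ij} = 1 / hᵢⱼ` for `i ≠ j`, `R^{ij}_{ji} = (hᵢⱼ² - 1) / hᵢⱼ²` for `i < j`, and
`R^{ij}_{ji} = 1` for `i ≥ j`. The elements that are inverted are units by `isUnit_hdiff`. -/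
def Rhat (K : Type*) [Field K] {n : ℕ} (i j k l : Fin n) : Ubar K n :=
  if k = j ∧ l = i then
    if i < j then (hdiff K i j ^ 2 - 1) * Ring.inverse (hdiff K i j ^ 2) else 1
  else if k = i ∧ l = j then Ring.inverse (hdiff K i j)
  else 0

/-- Generators of the ring that pairs `N'` copies of `V(n)` with `N` copies of `V*(n)`:
the elements of `Ū(n)`, the coordinates `x^{iα}` and the derivatives `∂_{jβ}`. -/
inductive Gen (K : Type*) [Field K] (n N' N : ℕ) : Type _
  | coeff (a : Ubar K n) : Gen K n N' N
  | x (i : Fin n) (α : Fin N') : Gen K n N' N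
  | d (j : Fin n) (β : Fin N) : Gen K n N' N

section Ring

variable {K : Type*} [Field K] {n N' N : ℕ}

/-- The defining relations, with zero-order terms `σ_{iαβ}`. -/
inductive Rel (σ : Fin n → Fin N' → Fin N → Ubar K n) :
    FreeAlgebra K (Gen K n N' N) → FreeAlgebra K (Gen K n N' N) → Prop
  -- the elements of `Ū(n)` are multiplied and added as in `Ū(n)`
  | coeff_add (a b : Ubar K n) : Rel σ (FreeAlgebra.ι K (.coeff (a + b)))
      (FreeAlgebra.ι K (.coeff a) + FreeAlgebra.ι K (.coeff b))
  | coeff_mul (a b : Ubar K n) : Rel σ (FreeAlgebra.ι K (.coeff (a * b)))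
      (FreeAlgebra.ι K (.coeff a) * FreeAlgebra.ι K (.coeff b))
  | coeff_algebraMap (c : K) : Rel σ (FreeAlgebra.ι K (.coeff (algebraMap K (Ubar K n) c)))
      (algebraMap K (FreeAlgebra K (Gen K n N' N)) c)
  -- `hᵢ x^{jα} = x^{jα} (hᵢ + δᵢⱼ)`
  | weight_x (i j : Fin n) (α : Fin N') : Rel σ
      (FreeAlgebra.ι K (.coeff (hgen K i)) * FreeAlgebra.ι K (.x j α))
      (FreeAlgebra.ι K (.x j α) *
        FreeAlgebra.ι K (.coeff (hgen K i + if i = j then 1 else 0)))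
  -- `hᵢ ∂_{jβ} = ∂_{jβ} (hᵢ - δᵢⱼ)`
  | weight_d (i j : Fin n) (β : Fin N) : Rel σ
      (FreeAlgebra.ι K (.coeff (hgen K i)) * FreeAlgebra.ι K (.d j β))
      (FreeAlgebra.ι K (.d j β) *
        FreeAlgebra.ι K (.coeff (hgen K i - if i = j then 1 else 0)))
  -- `x^{iα} x^{jβ} = ∑ R^{ij}_{kl} x^{kβ} x^{lα}`
  | x_x (i j : Fin n) (α β : Fin N') : Rel σ
      (FreeAlgebra.ι K (.x i α) * FreeAlgebra.ι K (.x j β))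
      (∑ k, ∑ l, FreeAlgebra.ι K (.coeff (Rhat K i j k l)) *
        FreeAlgebra.ι K (.x k β) * FreeAlgebra.ι K (.x l α))
  -- `∂_{lα} ∂_{kβ} = ∑ ∂_{jβ} ∂_{iα} R^{ij}_{kl}`
  | d_d (l k : Fin n) (α β : Fin N) : Rel σ
      (FreeAlgebra.ι K (.d l α) * FreeAlgebra.ι K (.d k β))
      (∑ i, ∑ j, FreeAlgebra.ι K (.d j β) * FreeAlgebra.ι K (.d i α) *
        FreeAlgebra.ι K (.coeff (Rhat K i j k l)))
  -- `x^{iα} ∂_{jβ} = ∑ ∂_{kβ} R^{ki}_{lj} x^{lα} - δᵢⱼ σ_{iαβ}`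
  | x_d (i j : Fin n) (α : Fin N') (β : Fin N) : Rel σ
      (FreeAlgebra.ι K (.x i α) * FreeAlgebra.ι K (.d j β))
      ((∑ k, ∑ l, FreeAlgebra.ι K (.d k β) *
        FreeAlgebra.ι K (.coeff (Rhat K k i l j)) * FreeAlgebra.ι K (.x l α)) -
        if i = j then FreeAlgebra.ι K (.coeff (σ i α β)) else 0)

/-- The ring pairing `N'` copies of `V(n)` with `N` copies of `V*(n)`, with zero-order terms `σ`. -/
def PairingRing (σ : Fin n → Fin N' → Fin N → Ubar K n) : Type _ := RingQuot (Rel σ)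

instance (σ : Fin n → Fin N' → Fin N → Ubar K n) : Ring (PairingRing σ) :=
  inferInstanceAs (Ring (RingQuot (Rel σ)))

instance (σ : Fin n → Fin N' → Fin N → Ubar K n) : Algebra K (PairingRing σ) :=
  inferInstanceAs (Algebra K (RingQuot (Rel σ)))

/-- The quotient map from the free algebra. -/
def mk (σ : Fin n → Fin N' → Fin N → Ubar K n) :
    FreeAlgebra K (Gen K n N' N) →ₐ[K] PairingRing σ :=
  RingQuot.mkAlgHom K (Rel σ)

theorem mk_rel (σ : Fin n → Fin N' → Fin N → Ubar K n) {a b : FreeAlgebra K (Gen K n N' N)}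
    (h : Rel σ a b) : mk σ a = mk σ b :=
  RingQuot.mkAlgHom_rel K h

/-- The structure map from `Ū(n)`. Its image is not central. -/
def coeff (σ : Fin n → Fin N' → Fin N → Ubar K n) : Ubar K n →ₐ[K] PairingRing σ :=
  AlgHom.ofLinearMap
    { toFun := fun a => mk σ (FreeAlgebra.ι K (.coeff a))
      map_add' := fun a b => by rw [mk_rel σ (.coeff_add a b), map_add]
      map_smul' := fun c a => by
        rw [Algebra.smul_def, mk_rel σ (.coeff_mul _ a), map_mul,
          mk_rel σ (.coeff_algebraMap c), AlgHom.commutes, RingHom.id_apply, Algebra.smul_def] }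
    (by
      have h := mk_rel σ (.coeff_algebraMap 1)
      simpa using h)
    (fun a b => by
      have h := mk_rel σ (.coeff_mul a b)
      simpa using h)

/-- The generator `x^{iα}`. -/
def xgen (σ : Fin n → Fin N' → Fin N → Ubar K n) (i : Fin n) (α : Fin N') : PairingRing σ :=
  mk σ (FreeAlgebra.ι K (.x i α))

/-- The generator `∂_{jβ}`. -/
def dgen (σ : Fin n → Fin N' → Fin N → Ubar K n) (j : Fin n) (β : Fin N) : PairingRing σ :=
  mk σ (FreeAlgebra.ι K (.d j β))

/-- The left `Ū(n)`-module structure. -/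
instance (σ : Fin n → Fin N' → Fin N → Ubar K n) : Module (Ubar K n) (PairingRing σ) :=
  Module.compHom (PairingRing σ) (coeff σ).toRingHom

end Ring

/-- The PBW property of `R` over `U` with respect to a finite family `r` of elements, listed in the
order `l`: the ordered monomials `r₁^{k₁} ⋯ r_m^{k_m}` form a basis of the left `U`-module `R`. -/
def HasPBW (U : Type*) {R ι : Type*} [CommRing U] [Ring R] [Module U R] (l : List ι)
    (r : ι → R) : Prop :=
  LinearIndependent U (fun e : ι → ℕ => (l.map fun k => r k ^ e k).prod) ∧
    Submodule.span U (Set.range fun e : ι → ℕ => (l.map fun k => r k ^ e k).prod) = ⊤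

/-- The order `∂_{n·}, …, ∂_{1·}, x^{1·}, …, x^{n·}` of the generators; a pair `(j, β)` on the left
stands for `∂_{jβ}` and a pair `(i, α)` on the right for `x^{iα}`. -/
def genOrder (n N' N : ℕ) : List (Fin n × Fin N ⊕ Fin n × Fin N') :=
  ((List.finRange n).reverse.flatMap fun j => (List.finRange N).map fun β => Sum.inl (j, β)) ++
    ((List.finRange n).flatMap fun i => (List.finRange N').map fun α => Sum.inr (i, α))

section Main

variable {K : Type*} [Field K] {n N' N : ℕ}

/-- The PBW property of the pairing ring over `Ū(n)` with respect to the generators `∂_{jβ}`,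
`x^{iα}`. -/
def PairingPBW (σ : Fin n → Fin N' → Fin N → Ubar K n) : Prop :=
  HasPBW (Ubar K n) (genOrder n N' N)
    (Sum.elim (fun p => dgen σ p.1 p.2) (fun p => xgen σ p.1 p.2))

/-- `Φ` is the identity on `Ū(n)` and the redefinition `x^{iα} ↦ ∑ A_{αα'} x^{iα'}`,
`∂_{iβ} ↦ ∑ B_{ββ'} ∂_{iβ'}` of the generators. -/
def IsLinearRedefinition {σ τ : Fin n → Fin N' → Fin N → Ubar K n}
    (Φ : PairingRing σ ≃ₐ[K] PairingRing τ) (A : GL (Fin N') K) (B : GL (Fin N) K) : Prop :=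
  (∀ a, Φ (coeff σ a) = coeff τ a) ∧
    (∀ i α, Φ (xgen σ i α) = ∑ α', A.val α α' • xgen τ i α') ∧
    (∀ i β, Φ (dgen σ i β) = ∑ β', B.val β β' • dgen τ i β')

/-- The pairing ring with zero-order terms `σ` embeds in the one with zero-order terms `τ` over
`Ū(n)`, by `x^{iα} ↦ x^{i,a(α)}`, `∂_{iβ} ↦ ∂_{i,b(β)}`. -/
def EmbedsAlong {M' M : ℕ} (σ : Fin n → Fin M' → Fin M → Ubar K n)
    (τ : Fin n → Fin N' → Fin N → Ubar K n) (a : Fin M' → Fin N') (b : Fin M → Fin N) : Prop :=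
  ∃ f : PairingRing σ →ₐ[K] PairingRing τ, Function.Injective f ∧
    (∀ u, f (coeff σ u) = coeff τ u) ∧
    (∀ i α, f (xgen σ i α) = xgen τ i (a α)) ∧
    (∀ i β, f (dgen σ i β) = dgen τ i (b β))

end Main

/-- The zero-order terms given by the diagonal `N' × N` matrix `diag(1, …, 1, 0, …, 0)` with `r`
ones. -/
def diagSigma (K : Type*) [Field K] (n N' N r : ℕ) : Fin n → Fin N' → Fin N → Ubar K n :=
  fun _ α β => if (α : ℕ) = β ∧ (α : ℕ) < r then 1 else 0

/-- The zero-order terms `δ_{αβ}` of `Diff_h(n, N)`. The ring `Diff_h(n)` is the case `N = 1`. -/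
def diffSigma (K : Type*) [Field K] (n N : ℕ) : Fin n → Fin N → Fin N → Ubar K n :=
  fun _ α β => if α = β then 1 else 0

/-- The (empty) zero-order terms of `V(n)`: one copy of the coordinates and no derivatives. -/
def vSigma (K : Type*) [Field K] (n : ℕ) : Fin n → Fin 1 → Fin 0 → Ubar K n :=
  fun _ _ β => β.elim0

/-- The (empty) zero-order terms of `V*(n)`: one copy of the derivatives and no coordinates. -/
def vStarSigma (K : Type*) [Field K] (n : ℕ) : Fin n → Fin 0 → Fin 1 → Ubar K n :=
  fun _ α _ => α.elim0

end HDeformed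

end

/-! Two facts have to be proved: constant `σ` gives a basis of ordered monomials, and nothing else
does when some kind of generator has at least two copies. The rest is linear algebra on `σ`.

Spanning holds for every `σ`: the relations rewrite any product of two generators in the wrong order
by smaller words, and induction on the shortlex order finishes (`word_mem_span`,
`span_pbwMonomial`).

Independence for constant `σ` comes from a representation. The ring `Diff_h(n, M)` acts on
polynomials over a field of rational functions in the `h i` (`fockModel`). The coordinate `x^{iα}`
is an ordered product of Lax matrices `1 + w⁻¹ y D` over the sites below `i`, contracted with an
oscillator at site `i` and followed by a scalar, after the automorphism `h i ↦ h i - 1` has acted;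
derivatives use the sites above `i`. The Yang relation for the Lax matrices gives all exchange
relations, and the diagonal relation between `x` and `∂` reduces to a partial fraction expansion
(`mono_partialFraction`) and Lagrange interpolation identities. Constant matrices acting on the copy
index preserve the relations and change `σ` to `A σ Bᵀ` (`IsModel.linearCombination`), so any
constant matrix is reached inside `Diff_h(n, N + N')`. There all coordinates kill the vacuum, and
triangularity of coordinate monomials on derivative words (`IsModel.xMonomial_wordVec`) separates
the ordered monomials.

For necessity, the overlaps `x x ∂` and `x ∂ ∂` are reduced to ordered form in two ways. The cubic
parts stay in the span of ordered cubic monomials, so independence forces the linear remainders to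
agree. With two different copies this says that `σ_{iαβ}` is invariant under all shifts and does not
depend on `i`; a shift-invariant element of `Ū(n)` is a constant (`exists_const_of_wt_invariant`).

A constant matrix is brought to `diag(1, …, 1, 0, …, 0)` by adapted bases (`exists_diagMatrix`). The
copies of `Diff_h(n)`, `V(n)` and `V*(n)` embed because their ordered monomials go to distinct
ordered monomials (`embedsAlong`). -/

namespace HDeformed

noncomputable section

open Finset

set_option linter.unusedSectionVars false

/-! ### Lax matrices over commuting Weyl algebras and the Yang exchange relation. -/

section Yang

variable {F A κ : Type*} [Field F] [Ring A] [Algebra F A] [Fintype κ] [DecidableEq κ]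

/-- Commuting copies, indexed by `ℕ`, of the Weyl algebra in the variables `κ`. -/
structure IsWeyl (y D : ℕ → κ → A) : Prop where
  yy : ∀ k l α β, Commute (y k α) (y l β)
  DD : ∀ k l α β, Commute (D k α) (D l β)
  Dy : ∀ k β α, D k β * y k α = y k α * D k β + if β = α then 1 else 0
  Dy_ne : ∀ k l, k ≠ l → ∀ β α, Commute (D k β) (y l α)

/-- The relation `(w + P) S'₂ S₁ = S₁ S'₂ (w + P)` with the Yang R-matrix `w + P`. -/
def YangRel (S S' : Matrix κ κ A) (w : F) : Prop :=
  ∀ α β γ δ, w • (S' γ δ * S α β) + S' α δ * S γ β = w • (S α β * S' γ δ) + S α δ * S' γ β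

theorem YangRel.one (w : F) : YangRel (1 : Matrix κ κ A) 1 w := by
  intro α β γ δ
  simp only [Matrix.one_apply]
  split_ifs <;> simp

/-- The coproduct property: entries of the different factors commute, so `w + P` passes first
through `S`, `S'` and then through `T`, `T'`. -/
theorem YangRel.mul {S S' T T' : Matrix κ κ A} {w : F} (hS : YangRel S S' w)
    (hT : YangRel T T' w) (h : ∀ α β γ δ, Commute (S α β) (T' γ δ))
    (h' : ∀ α β γ δ, Commute (S' α β) (T γ δ)) : YangRel (S * T) (S' * T') w := by
  intro α β γ δ
  have e1 : ∀ α β γ δ, (S' * T') γ δ * (S * T) α β =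
      ∑ ρ, ∑ σ, (S' γ ρ * S α σ) * (T' ρ δ * T σ β) := by
    intro α β γ δ
    rw [Matrix.mul_apply, Matrix.mul_apply, sum_mul_sum]
    refine sum_congr rfl fun ρ _ => sum_congr rfl fun σ _ => ?_
    rw [mul_assoc, ← mul_assoc (T' ρ δ), ← (h α σ ρ δ).eq]; simp only [mul_assoc]
  have e2 : ∀ α β γ δ, (S * T) α β * (S' * T') γ δ =
      ∑ ρ, ∑ σ, (S α σ * S' γ ρ) * (T σ β * T' ρ δ) := by
    intro α β γ δ
    rw [Matrix.mul_apply, Matrix.mul_apply, sum_mul_sum, sum_comm]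
    refine sum_congr rfl fun ρ _ => sum_congr rfl fun σ _ => ?_
    rw [mul_assoc, ← mul_assoc (T σ β), ← (h' γ ρ σ β).eq]; simp only [mul_assoc]
  calc _ = ∑ ρ, ∑ σ, (w • (S' γ ρ * S α σ) + S' α ρ * S γ σ) * (T' ρ δ * T σ β) := by
        rw [e1, e1]; simp only [add_mul, sum_add_distrib, smul_sum, smul_mul_assoc]
    _ = ∑ ρ, ∑ σ, (S α σ * S' γ ρ) * (w • (T' ρ δ * T σ β) + T' σ δ * T ρ β) := by
        simp only [hS _ _ _ _, add_mul, mul_add, sum_add_distrib, smul_mul_assoc, mul_smul_comm]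
        rw [sum_comm (f := fun ρ σ => S α ρ * S' γ σ * (T' ρ δ * T σ β))]
    _ = _ := by
        rw [e2, e2]
        simp only [hT _ _ _ _, mul_add, sum_add_distrib, smul_sum, mul_smul_comm]

/-- The elementary Lax matrix `1 + w⁻¹ (y^α D_β)`. -/
def lax (y D : ℕ → κ → A) (k : ℕ) (w : F) : Matrix κ κ A :=
  fun α β => (if α = β then (1 : F) else 0) • (1 : A) + w⁻¹ • (y k α * D k β)

theorem IsWeyl.Dy' {y D : ℕ → κ → A} (H : IsWeyl y D) (k : ℕ) (β α : κ) :
    D k β * y k α = y k α * D k β + (if β = α then (1 : F) else 0) • (1 : A) := by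
  rw [H.Dy]; split_ifs <;> simp

/-- After normal ordering the terms `y y D D` agree on both sides, and the contractions match
because `(u - v) / (u v) = 1 / v - 1 / u`. -/
theorem IsWeyl.yang_lax {y D : ℕ → κ → A} (H : IsWeyl y D) (k : ℕ) {u v : F} (hu : u ≠ 0)
    (hv : v ≠ 0) : YangRel (lax y D k u) (lax y D k v) (u - v) := by
  intro α β γ δ
  have key : ∀ α β γ δ : κ, (y k α * D k β) * (y k γ * D k δ) =
      y k α * y k γ * (D k β * D k δ) + (if β = γ then (1 : F) else 0) • (y k α * D k δ) := by
    intro α β γ δ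
    rw [mul_assoc, ← mul_assoc (D k β), H.Dy' (F := F)]
    simp only [add_mul, mul_add, mul_assoc, smul_mul_assoc, one_mul, mul_smul_comm]
  have c1 : y k γ * y k α = y k α * y k γ := (H.yy _ _ _ _).eq
  have c2 : D k δ * D k β = D k β * D k δ := (H.DD _ _ _ _).eq
  simp only [lax, add_mul, mul_add, smul_mul_assoc, mul_smul_comm, one_mul, mul_one, key, c1, c2]
  simp only [eq_comm (a := δ) (b := α), eq_comm (a := β) (b := γ), eq_comm (a := δ) (b := γ)]
  match_scalars <;> field_simp <;> ring

/-- The ordered product of Lax matrices over the indices `a, …, b - 1`. -/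
def mono (y D : ℕ → κ → A) (h : ℕ → F) (a b : ℕ) (u : F) : Matrix κ κ A :=
  ((List.range' a (b - a)).map fun k => lax y D k (u - h k)).prod

variable {y D : ℕ → κ → A} {h : ℕ → F}

theorem mono_self (a : ℕ) (u : F) : mono y D h a a u = 1 := by simp [mono]

theorem mono_mul {a b c : ℕ} (hab : a ≤ b) (hbc : b ≤ c) (u : F) :
    mono y D h a b u * mono y D h b c u = mono y D h a c u := by
  simp only [mono]
  rw [← List.prod_append, ← List.map_append]
  congr 2
  obtain ⟨p, rfl⟩ := Nat.exists_eq_add_of_le hab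
  obtain ⟨q, rfl⟩ := Nat.exists_eq_add_of_le hbc
  rw [show a + p - a = p by omega, show a + p + q - (a + p) = q by omega,
    show a + p + q - a = p + q by omega, List.range'_append_1]

theorem mono_succ (a : ℕ) (u : F) : mono y D h a (a + 1) u = lax y D a (u - h a) := by
  simp [mono]

theorem mono_split {a k b : ℕ} (hak : a ≤ k) (hkb : k < b) (u : F) :
    mono y D h a b u = mono y D h a k u * lax y D k (u - h k) * mono y D h (k + 1) b u := by
  rw [← mono_succ (h := h), mono_mul hak (Nat.le_succ k), mono_mul (by omega) hkb]

theorem mono_succ_right {a b : ℕ} (hab : a ≤ b) (u : F) :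
    mono y D h a (b + 1) u = mono y D h a b u * lax y D b (u - h b) := by
  rw [← mono_succ (h := h), mono_mul hab (Nat.le_succ b)]

theorem commute_lax {z : A} {k : ℕ} (hy : ∀ α, Commute z (y k α))
    (hD : ∀ α, Commute z (D k α)) (w : F) (α β : κ) : Commute z (lax y D k w α β) := by
  refine Commute.add_right ?_ ?_
  · exact (Commute.one_right z).smul_right _
  · exact ((hy α).mul_right (hD β)).smul_right _

theorem commute_mono {z : A} {a b : ℕ} (hz : ∀ k, a ≤ k → k < b →
    (∀ α, Commute z (y k α)) ∧ (∀ α, Commute z (D k α))) (u : F) (α β : κ) :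
    Commute z (mono y D h a b u α β) := by
  rcases le_total b a with hba | hab
  · rw [mono, Nat.sub_eq_zero_of_le hba]
    simp only [List.range'_zero, List.map_nil, List.prod_nil, Matrix.one_apply]
    split_ifs <;> simp
  induction b, hab using Nat.le_induction generalizing α β with
  | base => rw [mono_self, Matrix.one_apply]; split_ifs <;> simp
  | succ b hab ih =>
    rw [mono_split hab (Nat.lt_succ_self b), mono_self, mul_one, Matrix.mul_apply]
    refine Commute.sum_right _ _ _ fun γ _ => (ih (fun k h1 h2 => hz k h1 (by omega)) _ _).mul_right ?_
    exact commute_lax (hz b hab (by omega)).1 (hz b hab (by omega)).2 _ _ _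

theorem IsWeyl.commute_y_mono (H : IsWeyl y D) {i a b : ℕ} (hi : i < a ∨ b ≤ i) (u : F)
    (γ α β : κ) : Commute (y i γ) (mono y D h a b u α β) :=
  commute_mono (fun k _ _ => ⟨fun _ => H.yy _ _ _ _,
    fun _ => (H.Dy_ne k i (by omega) _ _).symm⟩) u α β

theorem IsWeyl.commute_D_mono (H : IsWeyl y D) {i a b : ℕ} (hi : i < a ∨ b ≤ i) (u : F)
    (γ α β : κ) : Commute (D i γ) (mono y D h a b u α β) :=
  commute_mono (fun k _ _ => ⟨fun _ => H.Dy_ne i k (by omega) _ _,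
    fun _ => H.DD _ _ _ _⟩) u α β

theorem IsWeyl.commute_mono_mono (H : IsWeyl y D) {a b c d : ℕ} (hd : b ≤ c) (u v : F)
    (α β γ δ : κ) : Commute (mono y D h a b u α β) (mono y D h c d v γ δ) :=
  commute_mono (fun _ _ _ => ⟨fun _ => (H.commute_y_mono (by omega) u _ _ _).symm,
    fun _ => (H.commute_D_mono (by omega) u _ _ _).symm⟩) v γ δ

theorem IsWeyl.commute_lax_mono (H : IsWeyl y D) {i a b : ℕ} (hi : i < a ∨ b ≤ i) (w u : F)
    (γ δ α β : κ) : Commute (lax y D i w γ δ) (mono y D h a b u α β) :=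
  (commute_lax (fun _ => (H.commute_y_mono hi u _ _ _).symm)
    (fun _ => (H.commute_D_mono hi u _ _ _).symm) w γ δ).symm

/-- The difference of the spectral parameters is `u - v` at every site, so `YangRel.mul` adds one
site at a time. -/
theorem IsWeyl.yang_mono (H : IsWeyl y D) {a b : ℕ} {u v : F}
    (hu : ∀ k, a ≤ k → k < b → u ≠ h k) (hv : ∀ k, a ≤ k → k < b → v ≠ h k) :
    YangRel (mono y D h a b u) (mono y D h a b v) (u - v) := by
  rcases le_total b a with hba | hab
  · simpa [mono, Nat.sub_eq_zero_of_le hba] using YangRel.one (A := A) (κ := κ) (u - v)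
  induction b, hab using Nat.le_induction with
  | base => simpa [mono_self] using YangRel.one (A := A) (κ := κ) (u - v)
  | succ b hab ih =>
    rw [← mono_mul hab (Nat.le_succ b), ← mono_mul hab (Nat.le_succ b)]
    refine (ih (fun k h1 h2 => hu k h1 (by omega)) (fun k h1 h2 => hv k h1 (by omega))).mul ?_
      (fun _ _ _ _ => H.commute_mono_mono le_rfl _ _ _ _ _ _)
      (fun _ _ _ _ => H.commute_mono_mono le_rfl _ _ _ _ _ _)
    rw [mono_succ, mono_succ]
    convert H.yang_lax b (sub_ne_zero.2 (hu b hab (by omega)))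
      (sub_ne_zero.2 (hv b hab (by omega))) using 1
    ring

/-- The form in which the Yang relation is used: contracted with a tensor `Y`, onto which the
permutation is moved by renaming summation indices. -/
theorem YangRel.sum_right {S S' : Matrix κ κ A} {w : F} (H : YangRel S S' w) (Y : κ → κ → A)
    (α γ : κ) : ∑ β, ∑ δ, S α β * S' γ δ * (w • Y β δ + Y δ β) =
      ∑ β, ∑ δ, (w • (S' γ δ * S α β) + S' α δ * S γ β) * Y β δ := by
  simp only [H _ _ _ _, mul_add, add_mul, sum_add_distrib, mul_smul_comm, smul_mul_assoc]
  rw [sum_comm (f := fun β δ => S α δ * S' γ β * Y β δ)]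

theorem YangRel.sum_left {S S' : Matrix κ κ A} {w : F} (H : YangRel S S' w) (Y : κ → κ → A)
    (β δ : κ) : ∑ α, ∑ γ, (w • Y α γ + Y γ α) * (S' γ δ * S α β) =
      ∑ α, ∑ γ, Y α γ * (w • (S α β * S' γ δ) + S α δ * S' γ β) := by
  simp only [← H _ _ _ _, mul_add, add_mul, sum_add_distrib, mul_smul_comm, smul_mul_assoc]
  rw [sum_comm (f := fun α γ => Y γ α * (S' γ δ * S α β))]

end Yang
end
end HDeformed


namespace HDeformed

noncomputable section

open Finset

set_option linter.unusedSectionVars false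

/-! ### Exchange relations among coordinates and among derivatives, before shifts and normalization.
-/

section Exchange

variable {F A κ : Type*} [Field F] [Ring A] [Algebra F A] [Fintype κ] [DecidableEq κ]
variable {y D : ℕ → κ → A} {h : ℕ → F}

/-- Raising the spectral parameter by one absorbs the difference between `w⁻¹` and its value after
contraction. The same increase of `h j - h i` is later produced by the automorphism `h i ↦ h i - 1`.
-/
theorem IsWeyl.lax_mul_y (H : IsWeyl y D) (i : ℕ) {w : F} (hw : w ≠ 0) (hw' : w + 1 ≠ 0)
    (γ ε μ : κ) : w • (lax y D i w γ ε * y i μ) =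
      w • (y i μ * lax y D i (w + 1) γ ε) + y i γ * lax y D i (w + 1) μ ε := by
  have e : y i γ * D i ε * y i μ =
      y i γ * (y i μ * D i ε) + (if ε = μ then (1 : F) else 0) • y i γ := by
    rw [mul_assoc, H.Dy' (F := F)]; simp [mul_add]
  have c : y i μ * (y i γ * D i ε) = y i γ * (y i μ * D i ε) := by
    rw [← mul_assoc, (H.yy i i μ γ).eq, mul_assoc]
  simp only [lax, add_mul, mul_add, smul_mul_assoc, mul_smul_comm, one_mul, mul_one, e, c]
  simp only [eq_comm (a := ε) (b := μ)]
  match_scalars <;> field_simp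

theorem IsWeyl.D_mul_lax (H : IsWeyl y D) (i : ℕ) {w : F} (hw : w ≠ 0) (hw' : w + 1 ≠ 0)
    (ν ε μ : κ) : w • (D i μ * lax y D i w ν ε) =
      w • (lax y D i (w + 1) ν ε * D i μ) + lax y D i (w + 1) ν μ * D i ε := by
  have e : D i μ * (y i ν * D i ε) =
      y i ν * D i μ * D i ε + (if μ = ν then (1 : F) else 0) • D i ε := by
    rw [← mul_assoc, H.Dy' (F := F)]; simp [add_mul]
  have c : y i ν * D i ε * D i μ = y i ν * D i μ * D i ε := by
    rw [mul_assoc, (H.DD i i ε μ).eq, mul_assoc]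
  simp only [lax, add_mul, mul_add, smul_mul_assoc, mul_smul_comm, one_mul, mul_one, e, c]
  simp only [eq_comm (a := μ) (b := ν)]
  match_scalars <;> field_simp

/-- The operator part of the coordinate `x^{jα}`, with the `i`-th Lax matrix, `i < j`,
evaluated at `w`. -/
def upAt (y D : ℕ → κ → A) (h : ℕ → F) (i j : ℕ) (w : F) (α : κ) : A :=
  ∑ γ, ∑ ε, mono y D h 0 i (h j) α γ *
    (lax y D i w γ ε * ∑ ζ, mono y D h (i + 1) j (h j) ε ζ * y j ζ)

/-- The operator part of the coordinate `x^{jα}`. -/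
def up (y D : ℕ → κ → A) (h : ℕ → F) (j : ℕ) (u : F) (α : κ) : A :=
  ∑ γ, mono y D h 0 j u α γ * y j γ

/-- The operator part of the derivative `∂_{iβ}`, with the `j`-th Lax matrix, `i < j`,
evaluated at `w`. -/
def downAt (y D : ℕ → κ → A) (h : ℕ → F) (n i j : ℕ) (w : F) (β : κ) : A :=
  ∑ ν, ∑ ε, ((∑ μ, D i μ * mono y D h (i + 1) j (h i) μ ν) * lax y D j w ν ε) *
    mono y D h (j + 1) n (h i) ε β

/-- The operator part of the derivative `∂_{iβ}`. -/
def down (y D : ℕ → κ → A) (h : ℕ → F) (n i : ℕ) (u : F) (β : κ) : A :=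
  ∑ μ, D i μ * mono y D h (i + 1) n u μ β

theorem up_eq_upAt {i j : ℕ} (hij : i < j) (α : κ) :
    up y D h j (h j) α = upAt y D h i j (h j - h i) α := by
  simp only [up, upAt, mono_split (Nat.zero_le i) hij, Matrix.mul_apply, sum_mul, mul_sum]
  rw [sum_comm]
  rw [sum_congr rfl fun _ _ => sum_comm, sum_comm]
  refine sum_congr rfl fun _ _ => ?_
  refine sum_congr rfl fun _ _ => sum_congr rfl fun _ _ => ?_
  simp only [mul_assoc]

theorem down_eq_downAt {n i j : ℕ} (hij : i < j) (hj : j < n) (β : κ) :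
    down y D h n i (h i) β = downAt y D h n i j (h i - h j) β := by
  simp only [down, downAt, mono_split (Nat.succ_le_of_lt hij) hj, Matrix.mul_apply, sum_mul,
    mul_sum]
  rw [sum_comm, sum_congr rfl fun _ _ => sum_comm, sum_comm]
  refine sum_congr rfl fun _ _ => sum_congr rfl fun _ _ => sum_congr rfl fun _ _ => ?_
  simp only [mul_assoc]

/-- Exchange of coordinates with different indices. -/
theorem IsWeyl.up_up (H : IsWeyl y D) {i j : ℕ} (hij : i < j)
    (hk : ∀ k l, k ≠ l → h k ≠ h l) (hw' : h j - h i + 1 ≠ 0) (α β : κ) :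
    (h j - h i) • (up y D h j (h j) α * up y D h i (h i) β) =
      (h j - h i) • (up y D h i (h i) β * upAt y D h i j (h j - h i + 1) α) +
        up y D h i (h i) α * upAt y D h i j (h j - h i + 1) β := by
  have hw : h j - h i ≠ 0 := sub_ne_zero.2 (hk _ _ hij.ne')
  rw [up_eq_upAt hij]
  set w := h j - h i with hwdef
  -- `Z` collects the sites above `i`; it commutes with everything at the sites up to `i`.
  set Z : κ → A := fun ε => ∑ ζ, mono y D h (i + 1) j (h j) ε ζ * y j ζ with hZ
  have cZ : ∀ z : A, (∀ k, i < k → (∀ α, Commute z (y k α)) ∧ (∀ α, Commute z (D k α))) →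
      ∀ ε, Commute z (Z ε) := fun z hz ε => Commute.sum_right _ _ _ fun ζ _ =>
    (commute_mono (fun k h1 _ => hz k h1) _ _ _).mul_right ((hz j hij).1 ζ)
  have cZT : ∀ u γ δ ε, Commute (mono y D h 0 i u γ δ) (Z ε) := fun u γ δ ε =>
    cZ _ (fun k hk => ⟨fun _ => (H.commute_y_mono (by omega) u _ _ _).symm,
      fun _ => (H.commute_D_mono (by omega) u _ _ _).symm⟩) ε
  have cZy : ∀ γ ε, Commute (y i γ) (Z ε) := fun γ ε =>
    cZ _ (fun k hk => ⟨fun _ => H.yy _ _ _ _, fun _ => (H.Dy_ne k i (by omega) _ _).symm⟩) ε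
  have cTl : ∀ u γ δ w μ ε, Commute (mono y D h 0 i u γ δ) (lax y D i w μ ε) :=
    fun u γ δ w μ ε => (H.commute_lax_mono (by omega) w u _ _ _ _).symm
  have cTy : ∀ u γ δ μ, Commute (mono y D h 0 i u γ δ) (y i μ) :=
    fun u γ δ μ => (H.commute_y_mono (by omega) u _ _ _).symm
  -- `Y` is what remains to the right of the two monodromy matrices over the sites below `i`, with
  -- the Lax matrix already shifted.
  set Y : κ → κ → A := fun γ μ => ∑ ε, y i μ * lax y D i (w + 1) γ ε * Z ε with hY
  have R : YangRel (mono y D h 0 i (h j)) (mono y D h 0 i (h i)) w :=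
    H.yang_mono (fun k _ hk' => hk _ _ (by omega)) (fun k _ hk' => hk _ _ (by omega))
  have eu : ∀ w α, upAt y D h i j w α =
      ∑ γ, ∑ ε, mono y D h 0 i (h j) α γ * (lax y D i w γ ε * Z ε) := fun _ _ => rfl
  have e2 : ∀ α β, up y D h i (h i) β * upAt y D h i j (w + 1) α =
      ∑ γ, ∑ μ, mono y D h 0 i (h i) β μ * mono y D h 0 i (h j) α γ * Y γ μ := by
    intro α β
    simp only [up, eu, hY]
    rw [sum_mul_sum, sum_comm]
    refine sum_congr rfl fun γ _ => sum_congr rfl fun μ _ => ?_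
    simp only [mul_sum]
    refine sum_congr rfl fun ε _ => ?_
    rw [mul_assoc, ← mul_assoc (y i μ), ← (cTy _ _ _ _).eq]
    simp only [mul_assoc]
  have e1 : w • (upAt y D h i j w α * up y D h i (h i) β) =
      ∑ γ, ∑ μ, mono y D h 0 i (h j) α γ * mono y D h 0 i (h i) β μ * (w • Y γ μ + Y μ γ) := by
    -- Site `i` produces exactly the operator `w + P` on `Y`, which `R.sum_right` can carry through
    -- the monodromy matrices.
    have : ∀ γ μ, w • Y γ μ + Y μ γ = ∑ ε, w • (lax y D i w γ ε * y i μ) * Z ε := by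
      intro γ μ
      simp only [hY, H.lax_mul_y i hw hw', smul_sum, ← sum_add_distrib, add_mul, smul_mul_assoc]
    simp only [this, up, upAt]
    rw [sum_mul_sum, smul_sum]
    refine sum_congr rfl fun γ _ => ?_
    rw [smul_sum]
    refine sum_congr rfl fun μ _ => ?_
    rw [mul_sum, sum_mul, smul_sum]
    refine sum_congr rfl fun ε _ => ?_
    change w • (mono y D h 0 i (h j) α γ * (lax y D i w γ ε * Z ε) *
      (mono y D h 0 i (h i) β μ * y i μ)) = _
    rw [smul_mul_assoc, mul_smul_comm]
    congr 1
    calc _ = mono y D h 0 i (h j) α γ * lax y D i w γ ε * (Z ε * mono y D h 0 i (h i) β μ) *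
          y i μ := by simp only [mul_assoc]
      _ = mono y D h 0 i (h j) α γ * (lax y D i w γ ε * mono y D h 0 i (h i) β μ) *
          (Z ε * y i μ) := by rw [← (cZT _ _ _ _).eq]; simp only [mul_assoc]
      _ = _ := by rw [← (cTl _ _ _ _ _ _).eq, ← (cZy _ _).eq]; simp only [mul_assoc]
  rw [e1, R.sum_right Y α β, e2, e2]
  simp only [add_mul, smul_mul_assoc, sum_add_distrib, smul_sum]

/-- Coordinates with equal indices. -/
theorem IsWeyl.up_up_self (H : IsWeyl y D) [CharZero F] {i : ℕ} (hk : ∀ k l, k ≠ l → h k ≠ h l)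
    (hk1 : ∀ k l, k ≠ l → h k - 1 ≠ h l) (α β : κ) :
    up y D h i (h i) α * up y D h i (h i - 1) β = up y D h i (h i) β * up y D h i (h i - 1) α := by
  have R : YangRel (mono y D h 0 i (h i)) (mono y D h 0 i (h i - 1)) (1 : F) := by
    simpa using H.yang_mono (a := 0) (b := i) (u := h i) (v := h i - 1)
      (fun k _ hk' => hk _ _ (by omega)) (fun k _ hk' => hk1 _ _ (by omega))
  have e : ∀ α β, up y D h i (h i) α * up y D h i (h i - 1) β = ∑ γ, ∑ μ,
      mono y D h 0 i (h i) α γ * mono y D h 0 i (h i - 1) β μ * (y i γ * y i μ) := by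
    intro α β
    simp only [up]
    rw [sum_mul_sum]
    refine sum_congr rfl fun γ _ => sum_congr rfl fun μ _ => ?_
    rw [mul_assoc, ← mul_assoc (y i γ), (H.commute_y_mono (by omega) _ _ _ _).eq]
    simp only [mul_assoc]
  -- At spectral difference one the operator is `1 + P`, which acts as `2` on the symmetric tensor
  -- `y i γ * y i μ`; the doubled product is then visibly symmetric in `α` and `β`.
  have e2 : ∀ α β, (2 : F) • (up y D h i (h i) α * up y D h i (h i - 1) β) = ∑ γ, ∑ μ,
      (mono y D h 0 i (h i - 1) β μ * mono y D h 0 i (h i) α γ +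
        mono y D h 0 i (h i - 1) α μ * mono y D h 0 i (h i) β γ) * (y i γ * y i μ) := by
    intro α β
    have := R.sum_right (fun γ μ => y i γ * y i μ) α β
    simp only [one_smul] at this
    rw [← this, e, smul_sum]
    refine sum_congr rfl fun γ _ => ?_
    rw [smul_sum]
    refine sum_congr rfl fun μ _ => ?_
    rw [(H.yy i i μ γ).eq, two_smul, mul_add]
  have h2 : (2 : F) ≠ 0 := two_ne_zero
  refine (smul_right_injective A h2) ?_
  simp only [e2]
  simp only [add_comm]

/-- Exchange of derivatives with different indices. -/
theorem IsWeyl.down_down (H : IsWeyl y D) {n i j : ℕ} (hij : i < j) (hj : j < n)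
    (hk : ∀ k l, k ≠ l → h k ≠ h l) (hw' : h i - h j + 1 ≠ 0) (α β : κ) :
    (h i - h j) • (down y D h n j (h j) β * down y D h n i (h i) α) =
      (h i - h j) • (downAt y D h n i j (h i - h j + 1) α * down y D h n j (h j) β) +
        downAt y D h n i j (h i - h j + 1) β * down y D h n j (h j) α := by
  have hw : h i - h j ≠ 0 := sub_ne_zero.2 (hk _ _ hij.ne)
  rw [down_eq_downAt hij hj]
  set w := h i - h j with hwdef
  set Z : κ → A := fun ν => ∑ μ, D i μ * mono y D h (i + 1) j (h i) μ ν with hZ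
  have cZ : ∀ z : A, (∀ k, k < j → (∀ α, Commute z (y k α)) ∧ (∀ α, Commute z (D k α))) →
      ∀ ε, Commute z (Z ε) := fun z hz ε => Commute.sum_right _ _ _ fun ζ _ =>
    ((hz i hij).2 ζ).mul_right (commute_mono (fun k _ h1 => hz k h1) _ _ _)
  have cZT : ∀ u γ δ ε, Commute (mono y D h (j + 1) n u γ δ) (Z ε) := fun u γ δ ε =>
    cZ _ (fun k hk => ⟨fun _ => (H.commute_y_mono (by omega) u _ _ _).symm,
      fun _ => (H.commute_D_mono (by omega) u _ _ _).symm⟩) ε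
  have cZD : ∀ γ ε, Commute (D j γ) (Z ε) := fun γ ε =>
    cZ _ (fun k hk => ⟨fun _ => H.Dy_ne _ _ (by omega) _ _, fun _ => H.DD _ _ _ _⟩) ε
  have cTl : ∀ u γ δ w μ ε, Commute (mono y D h (j + 1) n u γ δ) (lax y D j w μ ε) :=
    fun u γ δ w μ ε => (H.commute_lax_mono (by omega) w u _ _ _ _).symm
  have cTD : ∀ u γ δ μ, Commute (mono y D h (j + 1) n u γ δ) (D j μ) :=
    fun u γ δ μ => (H.commute_D_mono (by omega) u _ _ _).symm
  set Y : κ → κ → A := fun ε μ => ∑ ν, Z ν * (lax y D j (w + 1) ν ε * D j μ) with hY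
  have R : YangRel (mono y D h (j + 1) n (h i)) (mono y D h (j + 1) n (h j)) w :=
    H.yang_mono (fun k hk' _ => hk _ _ (by omega)) (fun k hk' _ => hk _ _ (by omega))
  have e2 : ∀ α β, downAt y D h n i j (w + 1) α * down y D h n j (h j) β =
      ∑ ε, ∑ μ, Y ε μ * (mono y D h (j + 1) n (h i) ε α * mono y D h (j + 1) n (h j) μ β) := by
    intro α β
    simp only [down, downAt]
    rw [sum_comm, sum_mul_sum]
    refine sum_congr rfl fun ε _ => sum_congr rfl fun μ _ => ?_
    rw [sum_mul, hY, sum_mul]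
    refine sum_congr rfl fun ν _ => ?_
    change Z ν * lax y D j (w + 1) ν ε * _ * _ = _
    rw [mul_assoc, ← mul_assoc (mono y D h (j + 1) n (h i) ε α), (cTD _ _ _ _).eq]
    simp only [mul_assoc]
  have e1 : w • (down y D h n j (h j) β * downAt y D h n i j w α) =
      ∑ ε, ∑ μ, (w • Y ε μ + Y μ ε) *
        (mono y D h (j + 1) n (h j) μ β * mono y D h (j + 1) n (h i) ε α) := by
    have : ∀ ε μ, w • Y ε μ + Y μ ε = ∑ ν, w • (Z ν * (D j μ * lax y D j w ν ε)) := by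
      intro γ μ
      simp only [hY, ← mul_smul_comm, H.D_mul_lax j hw hw', smul_sum, ← sum_add_distrib, mul_add]
    simp only [this, down, downAt]
    rw [sum_comm (f := fun ν ε => (∑ μ, D i μ * mono y D h (i + 1) j (h i) μ ν) *
      lax y D j w ν ε * mono y D h (j + 1) n (h i) ε α), sum_mul_sum, sum_comm, smul_sum]
    refine sum_congr rfl fun ε _ => ?_
    rw [smul_sum]
    refine sum_congr rfl fun μ _ => ?_
    rw [mul_sum, sum_mul, smul_sum]
    refine sum_congr rfl fun ν _ => ?_
    change w • (D j μ * mono y D h (j + 1) n (h j) μ β *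
      (Z ν * lax y D j w ν ε * mono y D h (j + 1) n (h i) ε α)) = _
    rw [smul_mul_assoc]
    congr 1
    calc _ = D j μ * (mono y D h (j + 1) n (h j) μ β * Z ν) * (lax y D j w ν ε *
          mono y D h (j + 1) n (h i) ε α) := by simp only [mul_assoc]
      _ = (D j μ * Z ν) * (mono y D h (j + 1) n (h j) μ β * lax y D j w ν ε) *
          mono y D h (j + 1) n (h i) ε α := by rw [(cZT _ _ _ _).eq]; simp only [mul_assoc]
      _ = _ := by rw [(cTl _ _ _ _ _ _).eq, (cZD _ _).eq]; simp only [mul_assoc]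
  rw [e1, R.sum_left Y α β, e2, e2]
  simp only [mul_add, mul_smul_comm, sum_add_distrib, smul_sum]

/-- Derivatives with equal indices. -/
theorem IsWeyl.down_down_self (H : IsWeyl y D) [CharZero F] {n i : ℕ}
    (hk : ∀ k l, k ≠ l → h k ≠ h l) (hk1 : ∀ k l, k ≠ l → h k - 1 ≠ h l) (α β : κ) :
    down y D h n i (h i - 1) α * down y D h n i (h i) β =
      down y D h n i (h i - 1) β * down y D h n i (h i) α := by
  have R : YangRel (mono y D h (i + 1) n (h i)) (mono y D h (i + 1) n (h i - 1)) (1 : F) := by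
    simpa using H.yang_mono (a := i + 1) (b := n) (u := h i) (v := h i - 1)
      (fun k hk' _ => hk _ _ (by omega)) (fun k hk' _ => hk1 _ _ (by omega))
  have e : ∀ α β, down y D h n i (h i - 1) α * down y D h n i (h i) β = ∑ γ, ∑ μ,
      (D i γ * D i μ) * (mono y D h (i + 1) n (h i - 1) μ α * mono y D h (i + 1) n (h i) γ β) := by
    intro α β
    simp only [down]
    rw [sum_mul_sum, sum_comm]
    refine sum_congr rfl fun γ _ => sum_congr rfl fun μ _ => ?_
    rw [mul_assoc, ← mul_assoc (mono y D h _ n _ μ α), ← (H.commute_D_mono (by omega) _ _ _ _).eq,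
      (H.DD i i γ μ).eq]
    simp only [mul_assoc]
  -- Again `1 + P` equals `2`, now on the symmetric tensor `D i γ * D i μ`.
  have e2 : ∀ α β, (2 : F) • (down y D h n i (h i - 1) α * down y D h n i (h i) β) =
      ∑ γ, ∑ μ, (D i γ * D i μ) *
        (mono y D h (i + 1) n (h i) γ β * mono y D h (i + 1) n (h i - 1) μ α +
          mono y D h (i + 1) n (h i) γ α * mono y D h (i + 1) n (h i - 1) μ β) := by
    intro α β
    have := R.sum_left (fun γ μ => D i γ * D i μ) β α
    simp only [one_smul] at this
    rw [← this, e, smul_sum]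
    refine sum_congr rfl fun γ _ => ?_
    rw [smul_sum]
    refine sum_congr rfl fun μ _ => ?_
    rw [(H.DD i i μ γ).eq, two_smul, add_mul]
  have h2 : (2 : F) ≠ 0 := two_ne_zero
  refine (smul_right_injective A h2) ?_
  simp only [e2]
  simp only [add_comm]

end Exchange
end
end HDeformed


namespace HDeformed

noncomputable section

open Finset

set_option linter.unusedSectionVars false

/-! ### Exchange of coordinates with derivatives, and partial fractions of the full monodromy
matrix. -/

section Mixed

variable {F A κ : Type*} [Field F] [Ring A] [Algebra F A] [Fintype κ] [DecidableEq κ]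
variable {y D : ℕ → κ → A} {h : ℕ → F}

theorem commute_up {z : A} {i : ℕ} (hz : ∀ k, k ≤ i →
    (∀ α, Commute z (y k α)) ∧ (∀ α, Commute z (D k α))) (u : F) (α : κ) :
    Commute z (up y D h i u α) :=
  Commute.sum_right _ _ _ fun γ _ =>
    (commute_mono (fun k _ h1 => hz k (by omega)) _ _ _).mul_right ((hz i le_rfl).1 γ)

/-- The supports are disjoint: the first operator lives on the sites up to `i`, the second on the
sites from `j` on. -/
theorem IsWeyl.up_down_of_lt (H : IsWeyl y D) {n i j : ℕ} (hij : i < j) (u v : F) (α β : κ) :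
    Commute (up y D h i u α) (down y D h n j v β) :=
  Commute.sum_right _ _ _ fun μ _ => Commute.mul_right
    (commute_up (fun k hk => ⟨fun _ => H.Dy_ne _ _ (by omega) _ _, fun _ => H.DD _ _ _ _⟩)
      _ _).symm
    (commute_up (fun k hk => ⟨fun _ => (H.commute_y_mono (by omega) v _ _ _).symm,
      fun _ => (H.commute_D_mono (by omega) v _ _ _).symm⟩) _ _).symm

/-- The Yang relation moves `w + P` from the left until it meets `w - P`, and `(w + P) (w - P) = w²
- 1`. This is the origin of the numerator `h² - 1` in the R-matrix. -/
theorem YangRel.sandwich {S S' : Matrix κ κ A} {w : F} (H : YangRel S S' w) (X V : κ → κ → A) :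
    ∑ ε, ∑ μ, ∑ ν, ∑ ζ, (w • X ε μ + X μ ε) * (S' μ ν * S ε ζ) * (w • V ν ζ - V ζ ν) =
      (w ^ 2 - 1) • ∑ ε, ∑ μ, ∑ ν, ∑ ζ, X ε μ * (S ε ζ * S' μ ν) * V ν ζ := by
  have e1 : ∑ ε, ∑ μ, ∑ ν, ∑ ζ, (w • X ε μ + X μ ε) * (S' μ ν * S ε ζ) * (w • V ν ζ - V ζ ν) =
      ∑ ν, ∑ ζ, (∑ ε, ∑ μ, (w • X ε μ + X μ ε) * (S' μ ν * S ε ζ)) * (w • V ν ζ - V ζ ν) := by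
    simp only [sum_mul]
    rw [sum_congr rfl fun _ _ => sum_comm, sum_comm]
    refine sum_congr rfl fun _ _ => ?_
    rw [sum_congr rfl fun _ _ => sum_comm, sum_comm]
  have e2 : ∑ ε, ∑ μ, ∑ ν, ∑ ζ, X ε μ * (S ε ζ * S' μ ν) * V ν ζ =
      ∑ ν, ∑ ζ, (∑ ε, ∑ μ, X ε μ * (S ε ζ * S' μ ν)) * V ν ζ := by
    simp only [sum_mul]
    rw [sum_congr rfl fun _ _ => sum_comm, sum_comm]
    refine sum_congr rfl fun _ _ => ?_
    rw [sum_congr rfl fun _ _ => sum_comm, sum_comm]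
  set Q : κ → κ → A := fun ν ζ => ∑ ε, ∑ μ, X ε μ * (S ε ζ * S' μ ν) with hQ
  have e3 : ∀ ν ζ, ∑ ε, ∑ μ, (w • X ε μ + X μ ε) * (S' μ ν * S ε ζ) = w • Q ν ζ + Q ζ ν := by
    intro ν ζ
    rw [H.sum_left X ζ ν]
    simp only [hQ, mul_add, sum_add_distrib, smul_sum, mul_smul_comm]
  have e4 : ∑ ε, ∑ μ, ∑ ν, ∑ ζ, X ε μ * (S ε ζ * S' μ ν) * V ν ζ = ∑ ν, ∑ ζ, Q ν ζ * V ν ζ := e2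
  rw [e1, e4]
  simp only [e3]
  clear_value Q
  simp only [add_mul, mul_sub, smul_mul_assoc, mul_smul_comm, smul_add,
    sum_add_distrib, sum_sub_distrib, sub_smul, one_smul, pow_two, mul_smul, smul_sum]
  rw [sum_comm (f := fun ν ζ => w • (Q ν ζ * V ζ ν)), sum_comm (f := fun ν ζ => Q ζ ν * V ζ ν)]
  abel

theorem sum_reorder (f : κ → κ → κ → κ → κ → κ → A) :
    ∑ μ, ∑ ν, ∑ κ', ∑ γ, ∑ ε, ∑ ζ, f μ ν κ' γ ε ζ =
      ∑ γ, ∑ κ', ∑ ε, ∑ μ, ∑ ν, ∑ ζ, f μ ν κ' γ ε ζ := by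
  refine (sum_congr rfl fun μ _ => sum_congr rfl fun ν _ => sum_comm).trans ?_
  refine (sum_congr rfl fun μ _ => sum_comm).trans ?_
  refine sum_comm.trans (sum_congr rfl fun γ _ => ?_)
  refine (sum_congr rfl fun μ _ => sum_comm).trans ?_
  refine sum_comm.trans (sum_congr rfl fun κ' _ => ?_)
  refine (sum_congr rfl fun μ _ => sum_comm).trans ?_
  exact sum_comm

/-- Bookkeeping for `IsWeyl.down_up`. The factors `T`, `k`, `M`, `z` of the coordinate sit below
`i`, at `i`, between `i` and `j`, and at `j`; the factors `d`, `M'`, `l`, `T'` of the derivative sit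
at `i`, between, at `j`, and above `j`. -/
theorem product_rearrange {T T' d z : κ → A} {k l M M' : κ → κ → A}
    (h1 : ∀ γ μ, Commute (T γ) (d μ)) (h2 : ∀ γ μ ν, Commute (T γ) (M' μ ν))
    (h3 : ∀ γ ν κ', Commute (T γ) (l ν κ')) (h4 : ∀ γ κ', Commute (T γ) (T' κ'))
    (h5 : ∀ γ ε μ ν, Commute (k γ ε) (M' μ ν)) (h6 : ∀ γ ε ν κ', Commute (k γ ε) (l ν κ'))
    (h7 : ∀ γ ε κ', Commute (k γ ε) (T' κ')) (h8 : ∀ ε ζ ν κ', Commute (M ε ζ) (l ν κ'))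
    (h9 : ∀ ε ζ κ', Commute (M ε ζ) (T' κ')) (h10 : ∀ ζ κ', Commute (z ζ) (T' κ')) :
    (∑ μ, ∑ ν, ∑ κ', d μ * M' μ ν * l ν κ' * T' κ') *
        (∑ γ, ∑ ε, ∑ ζ, T γ * k γ ε * M ε ζ * z ζ) =
      ∑ γ, ∑ κ', T γ * (∑ ε, ∑ μ, ∑ ν, ∑ ζ,
        (d μ * k γ ε) * (M' μ ν * M ε ζ) * (l ν κ' * z ζ)) * T' κ' := by
  simp only [sum_mul]
  simp only [mul_sum]
  rw [sum_reorder]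
  simp only [sum_mul]
  refine sum_congr rfl fun γ _ => sum_congr rfl fun κ' _ => sum_congr rfl fun ε _ =>
    sum_congr rfl fun μ _ => sum_congr rfl fun ν _ => sum_congr rfl fun ζ _ => ?_
  calc _ = d μ * M' μ ν * l ν κ' * (T' κ' * (T γ * k γ ε * M ε ζ * z ζ)) := by
        simp only [mul_assoc]
    _ = d μ * M' μ ν * (l ν κ' * (T γ * k γ ε * M ε ζ)) * z ζ * T' κ' := by
        rw [← ((((h4 γ κ').mul_left (h7 γ ε κ')).mul_left (h9 ε ζ κ')).mul_left (h10 ζ κ')).eq]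
        simp only [mul_assoc]
    _ = d μ * (M' μ ν * (T γ * k γ ε)) * M ε ζ * l ν κ' * z ζ * T' κ' := by
        rw [← (((h3 γ ν κ').mul_left (h6 γ ε ν κ')).mul_left (h8 ε ζ ν κ')).eq]
        simp only [mul_assoc]
    _ = d μ * T γ * k γ ε * M' μ ν * M ε ζ * l ν κ' * z ζ * T' κ' := by
        rw [← ((h2 γ μ ν).mul_left (h5 γ ε μ ν)).eq]
        simp only [mul_assoc]
    _ = _ := by
        rw [← (h1 γ μ).eq]
        simp only [mul_assoc]

theorem product_rearrange' {T T' d z : κ → A} {k l M M' : κ → κ → A}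
    (h1 : ∀ ε ζ μ, Commute (M ε ζ) (d μ)) (h2 : ∀ ζ μ, Commute (z ζ) (d μ))
    (h3 : ∀ ζ μ ν, Commute (z ζ) (M' μ ν)) :
    (∑ γ, ∑ ε, ∑ ζ, T γ * k γ ε * M ε ζ * z ζ) *
        (∑ μ, ∑ ν, ∑ κ', d μ * M' μ ν * l ν κ' * T' κ') =
      ∑ γ, ∑ κ', T γ * (∑ ε, ∑ μ, ∑ ν, ∑ ζ,
        (k γ ε * d μ) * (M ε ζ * M' μ ν) * (z ζ * l ν κ')) * T' κ' := by
  simp only [mul_sum]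
  simp only [sum_mul]
  rw [sum_reorder]
  refine sum_congr rfl fun γ _ => sum_congr rfl fun κ' _ => sum_congr rfl fun ε _ =>
    sum_congr rfl fun μ _ => sum_congr rfl fun ν _ => sum_congr rfl fun ζ _ => ?_
  calc _ = T γ * k γ ε * ((M ε ζ * z ζ) * d μ) * M' μ ν * l ν κ' * T' κ' := by
        simp only [mul_assoc]
    _ = T γ * k γ ε * d μ * M ε ζ * (z ζ * M' μ ν) * l ν κ' * T' κ' := by
        rw [((h1 ε ζ μ).mul_left (h2 ζ μ)).eq]
        simp only [mul_assoc]
    _ = _ := by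
        rw [(h3 ζ μ ν).eq]
        simp only [mul_assoc]

/-- Exchange of a coordinate and a derivative with a smaller index. -/
theorem IsWeyl.down_up (H : IsWeyl y D) {n i j : ℕ} (hij : i < j) (hj : j < n)
    (hk : ∀ k l, k ≠ l → h k ≠ h l) (hw1 : h j - h i + 1 ≠ 0) (hw2 : h i - h j + 1 ≠ 0)
    (α β : κ) :
    (h j - h i) ^ 2 • (down y D h n i (h i) β * up y D h j (h j) α) =
      ((h j - h i) ^ 2 - 1) • (upAt y D h i j (h j - h i + 1) α *
        downAt y D h n i j (h i - h j + 1) β) := by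
  have hw : h j - h i ≠ 0 := sub_ne_zero.2 (hk _ _ hij.ne')
  have hw' : h i - h j ≠ 0 := sub_ne_zero.2 (hk _ _ hij.ne)
  rw [up_eq_upAt hij, down_eq_downAt hij hj]
  have hneg : h i - h j = -(h j - h i) := by ring
  rw [hneg] at hw' hw2 ⊢
  have R : YangRel (mono y D h (i + 1) j (h j)) (mono y D h (i + 1) j (h i)) (h j - h i) :=
    H.yang_mono (fun k _ hk' => hk _ _ (by omega)) (fun k _ hk' => hk _ _ (by omega))
  have cly : ∀ (w : F) γ ε α, Commute (lax y D i w γ ε) (y j α) := fun w γ ε α =>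
    (commute_lax (fun _ => H.yy _ _ _ _) (fun _ => (H.Dy_ne i j (by omega) _ _).symm) _ _ _).symm
  have clD : ∀ (w : F) γ ε α, Commute (lax y D i w γ ε) (D j α) := fun w γ ε α =>
    (commute_lax (fun _ => H.Dy_ne j i (by omega) _ _) (fun _ => H.DD _ _ _ _) _ _ _).symm
  have cll : ∀ (w w' : F) γ ε ν κ', Commute (lax y D i w γ ε) (lax y D j w' ν κ') :=
    fun w w' γ ε ν κ' => commute_lax (cly w γ ε) (clD w γ ε) _ _ _
  have eu : ∀ w, upAt y D h i j w α = ∑ γ, ∑ ε, ∑ ζ, mono y D h 0 i (h j) α γ *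
      lax y D i w γ ε * mono y D h (i + 1) j (h j) ε ζ * y j ζ := by
    intro w
    simp only [upAt, mul_sum, mul_assoc]
  have ed : ∀ w, downAt y D h n i j w β = ∑ μ, ∑ ν, ∑ κ', D i μ *
      mono y D h (i + 1) j (h i) μ ν * lax y D j w ν κ' * mono y D h (j + 1) n (h i) κ' β := by
    intro w
    simp only [downAt, sum_mul]
    rw [sum_congr rfl fun _ _ => sum_comm, sum_comm]
  rw [eu, ed, eu, ed, product_rearrange (fun γ μ => (H.commute_D_mono (by omega) _ _ _ _).symm)
      (fun γ μ ν => H.commute_mono_mono (by omega) _ _ _ _ _ _)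
      (fun γ ν κ' => (H.commute_lax_mono (by omega) _ _ _ _ _ _).symm)
      (fun γ κ' => H.commute_mono_mono (by omega) _ _ _ _ _ _)
      (fun γ ε μ ν => H.commute_lax_mono (by omega) _ _ _ _ _ _)
      (fun γ ε ν κ' => cll _ _ _ _ _ _)
      (fun γ ε κ' => H.commute_lax_mono (by omega) _ _ _ _ _ _)
      (fun ε ζ ν κ' => (H.commute_lax_mono (by omega) _ _ _ _ _ _).symm)
      (fun ε ζ κ' => H.commute_mono_mono (by omega) _ _ _ _ _ _)
      (fun ζ κ' => H.commute_y_mono (by omega) _ _ _ _),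
    product_rearrange' (T := fun γ => mono y D h 0 i (h j) α γ)
      (T' := fun κ' => mono y D h (j + 1) n (h i) κ' β) (d := D i) (z := y j)
      (k := fun γ ε => lax y D i (h j - h i + 1) γ ε)
      (l := fun ν κ' => lax y D j (-(h j - h i) + 1) ν κ')
      (M := fun ε ζ => mono y D h (i + 1) j (h j) ε ζ)
      (M' := fun μ ν => mono y D h (i + 1) j (h i) μ ν) (fun ε ζ μ => (H.commute_D_mono (by omega) _ _ _ _).symm)
      (fun ζ μ => (H.Dy_ne i j (by omega) _ _).symm)
      (fun ζ μ ν => H.commute_y_mono (by omega) _ _ _ _)]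
  simp only [smul_sum]
  refine sum_congr rfl fun γ _ => sum_congr rfl fun κ' _ => ?_
  rw [← smul_mul_assoc, ← smul_mul_assoc ((h j - h i) ^ 2 - 1), ← mul_smul_comm,
    ← mul_smul_comm ((h j - h i) ^ 2 - 1)]
  congr 2
  rw [← R.sandwich (fun ε μ => lax y D i (h j - h i + 1) γ ε * D i μ)
    (fun ν ζ => y j ζ * lax y D j (-(h j - h i) + 1) ν κ'), smul_sum]
  refine sum_congr rfl fun ε _ => ?_
  rw [smul_sum]
  refine sum_congr rfl fun μ _ => ?_
  rw [smul_sum]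
  refine sum_congr rfl fun ν _ => ?_
  rw [smul_sum]
  refine sum_congr rfl fun ζ _ => ?_
  -- At site `j` the spectral parameter is `-(h j - h i)`; the sign turns `w + P` into the `w - P`
  -- needed for the sandwich.
  have l2 := H.lax_mul_y j hw' hw2 ν κ' ζ
  rw [neg_smul, neg_smul, neg_eq_iff_eq_neg, neg_add, neg_neg, ← sub_eq_add_neg] at l2
  rw [← H.D_mul_lax i hw hw1, ← l2, pow_two, mul_smul]
  simp only [smul_mul_assoc, mul_smul_comm]

/-- Partial fraction expansion of the ordered product of all Lax matrices. -/
theorem mono_partialFraction (hk : ∀ k l, k ≠ l → h k ≠ h l) (n : ℕ)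
    {u : F} (hu : ∀ k, k < n → u ≠ h k) (α β : κ) :
    mono y D h 0 n u α β = (if α = β then (1 : F) else 0) • (1 : A) +
      ∑ m ∈ range n, (u - h m)⁻¹ • (up y D h m (h m) α * down y D h n m (h m) β) := by
  induction n generalizing u α β with
  | zero => rw [mono_self, Matrix.one_apply]; split_ifs <;> simp
  | succ n ih =>
    have hun := sub_ne_zero.2 (hu n (Nat.lt_succ_self n))
    -- `G m` is the old residue at `h m` multiplied by the oscillator part of the Lax matrix added
    -- at site `n`.
    set G : ℕ → A := fun m => ∑ ν, up y D h m (h m) α * down y D h n m (h m) ν *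
      (y n ν * D n β) with hG
    have e0 : ∀ u : F, (∀ k, k < n → u ≠ h k) → ∑ ν, mono y D h 0 n u α ν * (y n ν * D n β) =
        y n α * D n β + ∑ m ∈ range n, (u - h m)⁻¹ • G m := by
      intro u hu
      simp only [ih hu, add_mul, sum_add_distrib, sum_mul, hG, smul_sum]
      rw [sum_comm]
      congr 1
      · simp [ite_smul]
      · simp only [smul_mul_assoc]
    have e1 : mono y D h 0 (n + 1) u α β = mono y D h 0 n u α β +
        (u - h n)⁻¹ • ∑ ν, mono y D h 0 n u α ν * (y n ν * D n β) := by
      rw [mono_succ_right (Nat.zero_le n), Matrix.mul_apply]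
      simp only [lax, mul_add, sum_add_distrib, smul_sum, mul_smul_comm, mul_one]
      congr 1
      simp [ite_smul]
    have e2 : ∀ m, m < n → up y D h m (h m) α * down y D h (n + 1) m (h m) β =
        up y D h m (h m) α * down y D h n m (h m) β + (h m - h n)⁻¹ • G m := by
      intro m hm
      have : down y D h (n + 1) m (h m) β = down y D h n m (h m) β +
          (h m - h n)⁻¹ • ∑ ν, down y D h n m (h m) ν * (y n ν * D n β) := by
        simp only [down, mono_succ_right (Nat.succ_le_of_lt hm), Matrix.mul_apply]
        simp only [lax, mul_add, sum_add_distrib, smul_sum, mul_smul_comm, mul_one, sum_mul,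
          mul_sum]
        congr 1
        · simp [ite_smul]
        · rw [sum_comm]
          simp only [mul_assoc]
      rw [this, mul_add, mul_smul_comm, hG, mul_sum]
      simp only [mul_assoc]
    have e3 : up y D h n (h n) α * down y D h (n + 1) n (h n) β =
        y n α * D n β + ∑ m ∈ range n, (h n - h m)⁻¹ • G m := by
      rw [← e0 _ (fun k hk' => hk _ _ (by omega))]
      simp only [up, down, mono_self, sum_mul, mul_assoc]
      refine sum_congr rfl fun ν _ => ?_
      congr 2
      simp [Matrix.one_apply]
    have e4 : ∑ m ∈ range n, (u - h m)⁻¹ • (up y D h m (h m) α * down y D h (n + 1) m (h m) β) =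
        ∑ m ∈ range n, (u - h m)⁻¹ • (up y D h m (h m) α * down y D h n m (h m) β +
          (h m - h n)⁻¹ • G m) := sum_congr rfl fun m hm => by rw [e2 m (mem_range.1 hm)]
    rw [e1, e0 u (fun k hk' => hu k (by omega)), ih (fun k hk' => hu k (by omega)),
      sum_range_succ, e3, e4]
    simp only [smul_add, sum_add_distrib, smul_sum]
    -- Of the two pieces, the first corrects the residue at `h m` and the second contributes to the
    -- residue at the new pole `h n`.
    have : ∀ m ∈ range n, (u - h n)⁻¹ • (u - h m)⁻¹ • G m =
        (u - h m)⁻¹ • (h m - h n)⁻¹ • G m + (u - h n)⁻¹ • (h n - h m)⁻¹ • G m := by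
      intro m hm
      have h1 := sub_ne_zero.2 (hu m (by have := mem_range.1 hm; omega))
      have h2 := sub_ne_zero.2 (hk m n (by have := mem_range.1 hm; omega))
      have h3 := sub_ne_zero.2 (hk n m (by have := mem_range.1 hm; omega))
      match_scalars
      field_simp
      ring
    rw [sum_congr rfl this, sum_add_distrib]
    abel

/-- At this value of the spectral parameter the `k`-th Lax matrix is `1 + y D = D y`, so the full
monodromy matrix factors at site `k`. -/
theorem IsWeyl.down_mul_up (H : IsWeyl y D) {n k : ℕ} (hkn : k < n) (α β : κ) :
    down y D h n k (h k + 1) β * up y D h k (h k + 1) α = mono y D h 0 n (h k + 1) α β := by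
  rw [mono_split (Nat.zero_le k) hkn]
  simp only [up, down, Matrix.mul_apply]
  rw [sum_mul_sum]
  refine sum_congr rfl fun μ _ => ?_
  rw [sum_mul]
  refine sum_congr rfl fun γ _ => ?_
  have : lax y D k (h k + 1 - h k) γ μ = D k μ * y k γ := by
    rw [H.Dy' (F := F), lax, add_sub_cancel_left, inv_one, one_smul, add_comm]
    simp only [eq_comm]
  rw [this]
  calc _ = D k μ * (mono y D h (k + 1) n (h k + 1) μ β * mono y D h 0 k (h k + 1) α γ) * y k γ := by
        simp only [mul_assoc]
    _ = (D k μ * mono y D h 0 k (h k + 1) α γ) * (mono y D h (k + 1) n (h k + 1) μ β * y k γ) := by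
        rw [← (H.commute_mono_mono (by omega) _ _ _ _ _ _).eq]; simp only [mul_assoc]
    _ = _ := by
        rw [(H.commute_D_mono (by omega) _ _ _ _).eq, ← (H.commute_y_mono (by omega) _ _ _ _).eq]
        simp only [mul_assoc]

end Mixed
end
end HDeformed


namespace HDeformed

noncomputable section

open Finset

/-! ### Interpolation identities for the diagonal relation. -/

section Residues

variable {F ι : Type*} [Field F] [DecidableEq ι] {s : Finset ι} {v : ι → F}

theorem prod_shift_eq_eval_nodal (k : ι) (hk : k ∈ s) :
    ∏ m ∈ s.erase k, (v k - v m + 1) =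
      (Lagrange.nodal s fun m => v m - 1).eval (v k) := by
  rw [Lagrange.eval_nodal, ← mul_prod_erase s _ hk]
  simp [sub_sub_eq_add_sub, add_sub_right_comm]

/-- The sum is the coefficient of `X ^ (#s - 1)` in the Lagrange interpolation at the nodes `v k` of
the monic polynomial `∏_{m ≠ i} (X - v m + 1)`. -/
theorem residue_sum_one (hv : ∀ i j, i ≠ j → v i - v j ≠ 0)
    (hv1 : ∀ i j, v i - v j + 1 ≠ 0) {i : ι} (hi : i ∈ s) :
    ∑ k ∈ s, (∏ m ∈ s.erase k, (v k - v m + 1) / (v k - v m)) * (v k - v i + 1)⁻¹ = 1 := by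
  have hinj : Set.InjOn v s := fun a _ b _ hab => by
    by_contra hne; exact hv a b hne (sub_eq_zero.2 hab)
  have hcard : 0 < #s := card_pos.2 ⟨i, hi⟩
  have hdeg : (Lagrange.nodal (s.erase i) fun m => v m - 1).degree < #s := by
    rw [Lagrange.degree_nodal, card_erase_of_mem hi]
    exact_mod_cast Nat.sub_lt hcard one_pos
  have hlead := Lagrange.coeff_eq_sum hinj hdeg
  have h1 : (Lagrange.nodal (s.erase i) fun m => v m - 1).coeff (#s - 1) = 1 := by
    have := (Lagrange.nodal_monic (s := s.erase i) (v := fun m => v m - 1)).coeff_natDegree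
    rwa [Lagrange.natDegree_nodal, card_erase_of_mem hi] at this
  rw [h1] at hlead
  refine Eq.trans ?_ hlead.symm
  refine sum_congr rfl fun k hk => ?_
  rw [prod_div_distrib, prod_shift_eq_eval_nodal k hk, Lagrange.nodal_eq_mul_nodal_erase hi]
  have h2 := hv1 k i
  have h3 : v k - (v i - 1) = v k - v i + 1 := by ring
  simp only [Polynomial.eval_mul, Polynomial.eval_sub, Polynomial.eval_X, Polynomial.eval_C, h3]
  rw [mul_div_assoc, mul_comm (v k - v i + 1), mul_assoc, mul_inv_cancel₀ h2, mul_one]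

/-- The same coefficient, with the root belonging to `j` removed as well: the degree drops to `#s -
2` and the coefficient vanishes. -/
theorem residue_sum_ne (hv : ∀ i j, i ≠ j → v i - v j ≠ 0)
    (hv1 : ∀ i j, v i - v j + 1 ≠ 0) {i j : ι} (hi : i ∈ s) (hj : j ∈ s) (hij : i ≠ j) :
    ∑ k ∈ s, (∏ m ∈ s.erase k, (v k - v m + 1) / (v k - v m)) * (v k - v i + 1)⁻¹ *
      (v k - v j + 1)⁻¹ = 0 := by
  have hinj : Set.InjOn v s := fun a _ b _ hab => by
    by_contra hne; exact hv a b hne (sub_eq_zero.2 hab)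
  have hj' : j ∈ s.erase i := mem_erase.2 ⟨hij.symm, hj⟩
  have hcard : 0 < #(s.erase i) := card_pos.2 ⟨j, hj'⟩
  have hc := card_erase_of_mem hi
  have hnat : (Lagrange.nodal ((s.erase i).erase j) fun m => v m - 1).natDegree < #s - 1 := by
    rw [Lagrange.natDegree_nodal, card_erase_of_mem hj']
    omega
  have hdeg : (Lagrange.nodal ((s.erase i).erase j) fun m => v m - 1).degree < #s := by
    rw [Lagrange.degree_nodal, card_erase_of_mem hj']
    exact_mod_cast by omega
  have hlead := Lagrange.coeff_eq_sum hinj hdeg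
  rw [Polynomial.coeff_eq_zero_of_natDegree_lt hnat] at hlead
  rw [hlead]
  refine sum_congr rfl fun k hk => ?_
  rw [prod_div_distrib, prod_shift_eq_eval_nodal k hk, Lagrange.nodal_eq_mul_nodal_erase hi,
    Lagrange.nodal_eq_mul_nodal_erase hj']
  have h2 := hv1 k i
  have h2' := hv1 k j
  have h3 : ∀ i, v k - (v i - 1) = v k - v i + 1 := fun i => by ring
  simp only [Polynomial.eval_mul, Polynomial.eval_sub, Polynomial.eval_X, Polynomial.eval_C, h3]
  have h4 : ∏ m ∈ s.erase k, (v k - v m) ≠ 0 :=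
    prod_ne_zero_iff.2 fun m hm => hv _ _ (mem_erase.1 hm).1.symm
  field_simp

/-- The second factor `(v k - v i + 1)⁻¹` is the kernel of interpolation evaluated at `v i - 1`,
which is not a node. -/
theorem residue_sum_self (hv : ∀ i j, i ≠ j → v i - v j ≠ 0)
    (hv1 : ∀ i j, v i - v j + 1 ≠ 0) {i : ι} (hi : i ∈ s) :
    ∑ k ∈ s, (∏ m ∈ s.erase k, (v k - v m + 1) / (v k - v m)) * (v k - v i + 1)⁻¹ *
      (v k - v i + 1)⁻¹ = ∏ m ∈ s.erase i, (v i - v m) / (v i - v m - 1) := by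
  have hinj : Set.InjOn v s := fun a _ b _ hab => by
    by_contra hne; exact hv a b hne (sub_eq_zero.2 hab)
  have hcard : 0 < #s := card_pos.2 ⟨i, hi⟩
  set Q := Lagrange.nodal (s.erase i) fun m => v m - 1 with hQ
  have hdeg : Q.degree < #s := by
    rw [Lagrange.degree_nodal, card_erase_of_mem hi]
    exact_mod_cast Nat.sub_lt hcard one_pos
  have hx : ∀ k ∈ s, v i - 1 ≠ v k := fun k _ h0 => hv1 k i (by rw [← h0]; ring)
  have hint := Lagrange.eval_interpolate_not_at_node (fun k => Q.eval (v k)) hx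
  rw [← Lagrange.eq_interpolate hinj hdeg] at hint
  have e1 : Q.eval (v i - 1) = ∏ m ∈ s.erase i, (v i - v m) := by
    rw [hQ, Lagrange.eval_nodal]
    exact prod_congr rfl fun m _ => by ring
  have e2 : (Lagrange.nodal s v).eval (v i - 1) = -∏ m ∈ s.erase i, (v i - v m - 1) := by
    rw [Lagrange.eval_nodal, ← mul_prod_erase s _ hi]
    rw [show v i - 1 - v i = -1 by ring, neg_one_mul]
    congr 1
    exact prod_congr rfl fun m _ => by ring
  have hne : ∏ m ∈ s.erase i, (v i - v m - 1) ≠ 0 :=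
    prod_ne_zero_iff.2 fun m _ h0 => hv1 m i (by linear_combination -h0)
  rw [e1, e2] at hint
  rw [prod_div_distrib, eq_div_iff hne, hint, neg_mul, ← mul_neg, mul_comm, ← sum_neg_distrib]
  congr 1
  refine sum_congr rfl fun k hk => ?_
  rw [prod_div_distrib, prod_shift_eq_eval_nodal k hk, Lagrange.nodal_eq_mul_nodal_erase hi]
  have h2 := hv1 k i
  have h3 : v k - (v i - 1) = v k - v i + 1 := by ring
  have h5 : v i - 1 - v k = -(v k - v i + 1) := by ring
  have h4 : ∏ m ∈ s.erase k, (v k - v m) ≠ 0 :=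
    prod_ne_zero_iff.2 fun m hm => hv _ _ (mem_erase.1 hm).1.symm
  simp only [Polynomial.eval_mul, Polynomial.eval_sub, Polynomial.eval_X, Polynomial.eval_C, h3,
    Lagrange.nodalWeight, prod_inv_distrib, h5, inv_neg]
  field_simp
  rfl

end Residues

end
end HDeformed


namespace HDeformed

noncomputable section

open Finset

set_option linter.unusedSectionVars false

/-! ### The Fock space and conjugation of operators by automorphisms of the coefficient field. -/

section Operators

/-- Generic parameters `h₀, h₁, …` of a field and commuting automorphisms `s i : hᵢ ↦ hᵢ - 1`. -/
structure IsShiftSystem (K : Type*) {F : Type*} [Field K] [Field F] [Algebra K F] (h : ℕ → F)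
    (s : ℕ → F ≃ₐ[K] F) : Prop where
  map_self : ∀ i, s i (h i) = h i - 1
  map_ne : ∀ i j, i ≠ j → s i (h j) = h j
  comm : ∀ i j a, s i (s j a) = s j (s i a)
  generic : ∀ i j, i ≠ j → ∀ m : ℤ, h i - h j + m ≠ 0

variable {K F κ : Type*} [Field K] [Field F] [Algebra K F] [Fintype κ] [DecidableEq κ]

variable (F) in
/-- The annihilation operator `∂/∂X_{iα}`. -/
def yop (i : ℕ) (α : κ) : Module.End F (MvPolynomial (ℕ × κ) F) :=
  (MvPolynomial.pderiv (i, α)).toLinearMap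

variable (F) in
/-- The creation operator `-X_{iα}`. -/
def cop (i : ℕ) (α : κ) : Module.End F (MvPolynomial (ℕ × κ) F) :=
  -LinearMap.mulLeft F (MvPolynomial.X (R := F) (i, α))

theorem yop_apply (i : ℕ) (α : κ) (v : MvPolynomial (ℕ × κ) F) :
    yop F i α v = MvPolynomial.pderiv (i, α) v := rfl

theorem cop_apply (i : ℕ) (α : κ) (v : MvPolynomial (ℕ × κ) F) :
    cop F i α v = -(MvPolynomial.X (i, α) * v) := rfl

/-- The roles are exchanged on purpose: `y` differentiates and `D` multiplies, with the sign that
keeps the commutator equal to `1`. Coordinates then annihilate the constant polynomial. -/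
theorem isWeyl : IsWeyl (yop F (κ := κ)) (cop F) where
  yy k l α β := by
    refine LinearMap.ext fun v => ?_
    simp only [Module.End.mul_apply, yop_apply]
    induction v using MvPolynomial.induction_on with
    | C a => simp
    | add p q hp hq => simp only [map_add, hp, hq]
    | mul_X p i hp =>
      simp only [Derivation.leibniz, MvPolynomial.pderiv_X, Pi.single_apply, smul_eq_mul, map_add,
        hp]
      split_ifs <;> simp <;> ring
  DD k l α β := by
    refine LinearMap.ext fun v => ?_
    simp only [Module.End.mul_apply, cop_apply]
    ring
  Dy k β α := by
    refine LinearMap.ext fun v => ?_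
    simp only [Module.End.mul_apply, LinearMap.add_apply, yop_apply, cop_apply, map_neg,
      Derivation.leibniz, smul_eq_mul, MvPolynomial.pderiv_X]
    by_cases hβ : β = α
    · subst hβ
      simp
    · have : (k, β) ≠ (k, α) := by simpa using hβ
      simp [hβ, this]
  Dy_ne k l hkl β α := by
    refine LinearMap.ext fun v => ?_
    have : (k, β) ≠ (l, α) := by simp [hkl]
    simp [Module.End.mul_apply, yop_apply, cop_apply, MvPolynomial.pderiv_X, this]

/-- The automorphism of polynomials that applies `e` to the coefficients. -/
def coeffMap (e : F ≃ₐ[K] F) : MvPolynomial (ℕ × κ) F ≃ₐ[K] MvPolynomial (ℕ × κ) F :=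
  MvPolynomial.mapAlgEquiv _ e

theorem coeffMap_smul (e : F ≃ₐ[K] F) (a : F) (v : MvPolynomial (ℕ × κ) F) :
    coeffMap e (a • v) = e a • coeffMap e v := by
  simp [coeffMap, MvPolynomial.smul_eq_C_mul]

/-- Conjugation by `coeffMap e` takes `a` to `b`. -/
def Intertwines (e : F ≃ₐ[K] F) (a b : Module.End F (MvPolynomial (ℕ × κ) F)) : Prop :=
  ∀ v, coeffMap e (a v) = b (coeffMap e v)

namespace Intertwines

variable {e : F ≃ₐ[K] F} {a b a' b' : Module.End F (MvPolynomial (ℕ × κ) F)}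

theorem one : Intertwines e (1 : Module.End F (MvPolynomial (ℕ × κ) F)) 1 := fun _ => rfl

theorem mul (h : Intertwines e a b) (h' : Intertwines e a' b') :
    Intertwines e (a * a') (b * b') := fun v => by
  simp only [Module.End.mul_apply]; rw [h, h']

theorem add (h : Intertwines e a b) (h' : Intertwines e a' b') :
    Intertwines e (a + a') (b + b') := fun v => by
  simp only [LinearMap.add_apply, map_add]; rw [h, h']

theorem smul (h : Intertwines e a b) {c c' : F} (hc : e c = c') :
    Intertwines e (c • a) (c' • b) := fun v => by
  simp only [LinearMap.smul_apply, coeffMap_smul, hc]; rw [h]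

theorem sum {ι : Type*} {t : Finset ι} {a b : ι → Module.End F (MvPolynomial (ℕ × κ) F)}
    (h : ∀ i, Intertwines e (a i) (b i)) : Intertwines e (∑ i ∈ t, a i) (∑ i ∈ t, b i) :=
  fun v => by
  simp only [LinearMap.sum_apply, map_sum]
  exact sum_congr rfl fun i _ => h i v

theorem yop (i : ℕ) (α : κ) : Intertwines e (yop F i α) (HDeformed.yop F i α) := fun v => by
  simp [coeffMap, yop_apply, MvPolynomial.pderiv_map]

theorem cop (i : ℕ) (α : κ) : Intertwines e (cop F i α) (HDeformed.cop F i α) := fun v => by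
  simp [coeffMap, cop_apply]

theorem lax {w w' : F} (hw : e w = w') (k : ℕ) (α β : κ) :
    Intertwines e (lax (HDeformed.yop F) (HDeformed.cop F) k w α β)
      (HDeformed.lax (HDeformed.yop F) (HDeformed.cop F) k w' α β) :=
  (one.smul (by split_ifs <;> simp)).add (((yop k α).mul (cop k β)).smul (by rw [map_inv₀, hw]))

theorem mono {h : ℕ → F} {p q : ℕ} {u u' : F}
    (hu : ∀ k, p ≤ k → k < q → e (u - h k) = u' - h k) (α β : κ) :
    Intertwines e (mono (HDeformed.yop F) (HDeformed.cop F) h p q u α β)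
      (HDeformed.mono (HDeformed.yop F) (HDeformed.cop F) h p q u' α β) := by
  rcases le_total q p with hba | hab
  · simp only [HDeformed.mono, Nat.sub_eq_zero_of_le hba, List.range'_zero, List.map_nil,
      List.prod_nil, Matrix.one_apply]
    split_ifs
    · exact one
    · intro v; simp
  induction q, hab using Nat.le_induction generalizing α β with
  | base =>
    simp only [mono_self, Matrix.one_apply]
    split_ifs
    · exact one
    · intro v; simp
  | succ q hab ih =>
    rw [mono_succ_right hab, mono_succ_right hab, Matrix.mul_apply, Matrix.mul_apply]
    exact sum fun γ => (ih (fun k h1 h2 => hu k h1 (by omega)) _ _).mul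
      (lax (hu q hab (Nat.lt_succ_self q)) _ _ _)

end Intertwines

/-! ### Shifted and normalized operators satisfy the relations of `Diff_h(n, M)`. -/

section Relations

variable {h : ℕ → F} {s : ℕ → F ≃ₐ[K] F}

namespace IsShiftSystem

variable (H : IsShiftSystem K h s)
include H

theorem sub_ne {i j : ℕ} (hij : i ≠ j) : h i - h j ≠ 0 := by
  simpa using H.generic i j hij 0

theorem ne {i j : ℕ} (hij : i ≠ j) : h i ≠ h j := sub_ne_zero.1 (H.sub_ne hij)

theorem sub_add_one_ne {i j : ℕ} (hij : i ≠ j) : h i - h j + 1 ≠ 0 := by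
  simpa using H.generic i j hij 1

theorem sub_sub_one_ne {i j : ℕ} (hij : i ≠ j) : h i - h j - 1 ≠ 0 := by
  simpa [sub_eq_add_neg] using H.generic i j hij (-1)

theorem sub_one_ne {i j : ℕ} (hij : i ≠ j) : h i - 1 ≠ h j := fun h0 =>
  H.sub_sub_one_ne hij (by linear_combination h0)

theorem up_of_lt {i j : ℕ} (hij : i < j) (α : κ) :
    Intertwines (s j) (up (yop F) (cop F) h i (h i) α) (up (yop F) (cop F) h i (h i) α) :=
  .sum fun _ => .mul (.mono (fun k _ hk => by
    rw [map_sub, H.map_ne j i (by omega), H.map_ne j k (by omega)]) _ _) (.yop _ _)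

theorem up_self (i : ℕ) (α : κ) :
    Intertwines (s i) (up (yop F) (cop F) h i (h i) α) (up (yop F) (cop F) h i (h i - 1) α) :=
  .sum fun _ => .mul (.mono (fun k _ hk => by
    rw [map_sub, H.map_self, H.map_ne i k (by omega)]) _ _) (.yop _ _)

/-- Only the `i`-th Lax factor involves `h i`, and there `h j - h i` rises by one; this is the
shifted operator on the right of `IsWeyl.up_up`. -/
theorem up_of_gt {i j : ℕ} (hij : i < j) (α : κ) :
    Intertwines (s i) (up (yop F) (cop F) h j (h j) α)
      (upAt (yop F) (cop F) h i j (h j - h i + 1) α) := by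
  rw [up_eq_upAt hij]
  refine .sum fun _ => .sum fun _ => .mul (.mono (fun k _ hk => ?_) _ _)
    (.mul (.lax ?_ _ _ _) (.sum fun _ => .mul (.mono (fun k _ hk => ?_) _ _) (.yop _ _)))
  · rw [map_sub, H.map_ne i j (by omega), H.map_ne i k (by omega)]
  · rw [map_sub, H.map_ne i j (by omega), H.map_self]; ring
  · rw [map_sub, H.map_ne i j (by omega), H.map_ne i k (by omega)]

theorem down_of_gt {n i j : ℕ} (hij : i < j) (α : κ) :
    Intertwines (s i) (down (yop F) (cop F) h n j (h j) α)
      (down (yop F) (cop F) h n j (h j) α) :=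
  .sum fun _ => .mul (.cop _ _) (.mono (fun k hk _ => by
    rw [map_sub, H.map_ne i j (by omega), H.map_ne i k (by omega)]) _ _)

theorem down_self (n i : ℕ) (α : κ) :
    Intertwines (s i) (down (yop F) (cop F) h n i (h i) α)
      (down (yop F) (cop F) h n i (h i - 1) α) :=
  .sum fun _ => .mul (.cop _ _) (.mono (fun k hk _ => by
    rw [map_sub, H.map_self, H.map_ne i k (by omega)]) _ _)

theorem down_of_lt {n i j : ℕ} (hij : i < j) (hj : j < n) (α : κ) :
    Intertwines (s j) (down (yop F) (cop F) h n i (h i) α)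
      (downAt (yop F) (cop F) h n i j (h i - h j + 1) α) := by
  rw [down_eq_downAt hij hj]
  refine .sum fun _ => .sum fun _ => .mul (.mul (.sum fun _ => .mul (.cop _ _)
    (.mono (fun k _ hk => ?_) _ _)) (.lax ?_ _ _ _)) (.mono (fun k hk _ => ?_) _ _)
  · rw [map_sub, H.map_ne j i (by omega), H.map_ne j k (by omega)]
  · rw [map_sub, H.map_ne j i (by omega), H.map_self]; ring
  · rw [map_sub, H.map_ne j i (by omega), H.map_ne j k (by omega)]

theorem down_up_self (n k : ℕ) (α β : κ) :
    Intertwines (s k) (down (yop F) (cop F) h n k (h k + 1) β * up (yop F) (cop F) h k (h k + 1) α)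
      (down (yop F) (cop F) h n k (h k) β * up (yop F) (cop F) h k (h k) α) :=
  .mul (.sum fun _ => .mul (.cop _ _) (.mono (fun m hm _ => by
      rw [map_sub, map_add, H.map_self, H.map_ne k m (by omega), map_one]; ring) _ _))
    (.sum fun _ => .mul (.mono (fun m _ hm => by
      rw [map_sub, map_add, H.map_self, H.map_ne k m (by omega), map_one]; ring) _ _) (.yop _ _))

end IsShiftSystem

/-- Normalization of the coordinates. -/
def upFactor (h : ℕ → F) (i : ℕ) : F := ∏ k ∈ range i, (h i - h k) / (h i - h k - 1)

/-- Normalization of the derivatives. -/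
def downFactor (h : ℕ → F) (n i : ℕ) : F :=
  ∏ k ∈ Ico (i + 1) n, (h i - h k) / (h i - h k - 1)

variable (h s) in
/-- The operator that represents the coordinate `x^{iα}`. -/
def xop (i : ℕ) (α : κ) : Module.End K (MvPolynomial (ℕ × κ) F) :=
  (upFactor h i • up (yop F) (cop F) h i (h i) α).restrictScalars K ∘ₗ (coeffMap (s i)).toLinearMap

variable (h s) in
/-- The operator that represents the derivative `∂_{iβ}`. -/
def dop (n i : ℕ) (β : κ) : Module.End K (MvPolynomial (ℕ × κ) F) :=
  (coeffMap (s i)).symm.toLinearMap ∘ₗ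
    (downFactor h n i • down (yop F) (cop F) h n i (h i) β).restrictScalars K

theorem xop_apply (i : ℕ) (α : κ) (v : MvPolynomial (ℕ × κ) F) : xop h s i α v =
    upFactor h i • up (yop F) (cop F) h i (h i) α (coeffMap (s i) v) := rfl

theorem coeffMap_dop (n i : ℕ) (β : κ) (v : MvPolynomial (ℕ × κ) F) :
    coeffMap (s i) (dop h s n i β v) = downFactor h n i • down (yop F) (cop F) h n i (h i) β v :=
  (coeffMap (s i)).apply_symm_apply _

theorem xop_smul (i : ℕ) (α : κ) (a : F) (v : MvPolynomial (ℕ × κ) F) :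
    xop h s i α (a • v) = s i a • xop h s i α v := by
  simp only [xop_apply, coeffMap_smul, map_smul]
  rw [smul_comm]

theorem dop_smul (n i : ℕ) (β : κ) (a : F) (v : MvPolynomial (ℕ × κ) F) :
    dop h s n i β (a • v) = (s i).symm a • dop h s n i β v := by
  apply (coeffMap (s i)).injective
  rw [coeffMap_smul, coeffMap_dop, coeffMap_dop, map_smul, smul_comm, AlgEquiv.apply_symm_apply]

namespace IsShiftSystem

variable (H : IsShiftSystem K h s)
include H

theorem coeffMap_comm (i j : ℕ) (v : MvPolynomial (ℕ × κ) F) :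
    coeffMap (s i) (coeffMap (s j) v) = coeffMap (s j) (coeffMap (s i) v) := by
  have : ((coeffMap (κ := κ) (s i)).toAlgHom.comp (coeffMap (s j)).toAlgHom).toRingHom =
      ((coeffMap (s j)).toAlgHom.comp (coeffMap (s i)).toAlgHom).toRingHom := by
    refine MvPolynomial.ringHom_ext (fun a => ?_) fun i => ?_
    · simp [coeffMap, H.comm i j a]
    · simp [coeffMap]
  exact DFunLike.congr_fun this v

theorem upFactor_of_lt {i j : ℕ} (hij : i < j) : s j (upFactor h i) = upFactor h i := by
  rw [upFactor, map_prod]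
  refine prod_congr rfl fun k hk => ?_
  have := mem_range.1 hk
  rw [map_div₀, map_sub, map_sub, map_one, map_sub, H.map_ne j i (by omega), H.map_ne j k (by omega)]

/-- `G` collects the factors without `h i`. With `w = h j - h i` the quotient of the two values is
`w² / (w² - 1)`, the asymmetric coefficient in `xop_xop_of_lt`. -/
theorem upFactor_of_gt {i j : ℕ} (hij : i < j) : ∃ G : F,
    upFactor h j = (h j - h i) / (h j - h i - 1) * G ∧
      s i (upFactor h j) = (h j - h i + 1) / (h j - h i) * G := by
  refine ⟨∏ k ∈ (range j).erase i, (h j - h k) / (h j - h k - 1), ?_, ?_⟩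
  · rw [upFactor, mul_prod_erase _ (fun k => (h j - h k) / (h j - h k - 1)) (mem_range.2 hij)]
  · rw [upFactor, ← mul_prod_erase _ _ (mem_range.2 hij), map_mul, map_prod]
    congr 1
    · rw [map_div₀, map_sub, map_sub, map_one, map_sub, H.map_ne i j (by omega), H.map_self]
      congr 1 <;> ring
    · refine prod_congr rfl fun k hk => ?_
      have := (mem_erase.1 hk).1
      rw [map_div₀, map_sub, map_sub, map_one, map_sub, H.map_ne i j (by omega),
        H.map_ne i k (by omega)]

theorem downFactor_of_gt (n : ℕ) {i j : ℕ} (hij : i < j) :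
    s i (downFactor h n j) = downFactor h n j := by
  rw [downFactor, map_prod]
  refine prod_congr rfl fun k hk => ?_
  have := (mem_Ico.1 hk).1
  rw [map_div₀, map_sub, map_sub, map_one, map_sub, H.map_ne i j (by omega), H.map_ne i k (by omega)]

theorem downFactor_of_lt {n i j : ℕ} (hij : i < j) (hj : j < n) : ∃ G : F,
    downFactor h n i = (h i - h j) / (h i - h j - 1) * G ∧
      s j (downFactor h n i) = (h i - h j + 1) / (h i - h j) * G := by
  have hm : j ∈ Ico (i + 1) n := mem_Ico.2 ⟨by omega, hj⟩
  refine ⟨∏ k ∈ (Ico (i + 1) n).erase j, (h i - h k) / (h i - h k - 1), ?_, ?_⟩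
  · rw [downFactor, mul_prod_erase _ (fun k => (h i - h k) / (h i - h k - 1)) hm]
  · rw [downFactor, ← mul_prod_erase _ _ hm, map_mul, map_prod]
    congr 1
    · rw [map_div₀, map_sub, map_sub, map_one, map_sub, H.map_ne j i (by omega), H.map_self]
      congr 1 <;> ring
    · refine prod_congr rfl fun k hk => ?_
      have := (mem_erase.1 hk).1
      rw [map_div₀, map_sub, map_sub, map_one, map_sub, H.map_ne j i (by omega),
        H.map_ne j k (by omega)]

theorem xop_xop_of_lt {i j : ℕ} (hij : i < j) (α β : κ) (v : MvPolynomial (ℕ × κ) F) :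
    xop h s j β (xop h s i α v) = ((h j - h i) ^ 2 / ((h j - h i) ^ 2 - 1)) •
      (xop h s i α (xop h s j β v) + (h j - h i)⁻¹ • xop h s i β (xop h s j α v)) := by
  obtain ⟨G, hG, hG'⟩ := H.upFactor_of_gt hij
  simp only [xop_apply, coeffMap_smul, map_smul, H.up_of_lt hij _ _, H.up_of_gt hij _ _,
    H.upFactor_of_lt hij, hG', H.coeffMap_comm i j]
  rw [hG]
  have h1 := H.sub_ne hij.ne'
  have h2 := H.sub_add_one_ne hij.ne'
  have h3 := H.sub_sub_one_ne hij.ne'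
  have h4 : (h j - h i) ^ 2 - 1 ≠ 0 := by
    rw [show (h j - h i) ^ 2 - 1 = (h j - h i + 1) * (h j - h i - 1) by ring]
    exact mul_ne_zero h2 h3
  have key := congrArg (fun a => a (coeffMap (s j) (coeffMap (s i) v)))
    (isWeyl.up_up (F := F) (h := h) hij (fun _ _ => H.ne) h2 β α)
  simp only [LinearMap.smul_apply, Module.End.mul_apply, LinearMap.add_apply] at key
  have key' := (eq_inv_smul_iff₀ h1).2 key
  rw [key']
  match_scalars <;> field_simp <;> ring

theorem xop_xop_self [CharZero F] (i : ℕ) (α β : κ) (v : MvPolynomial (ℕ × κ) F) :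
    xop h s i α (xop h s i β v) = xop h s i β (xop h s i α v) := by
  have key := congrArg (fun a => a (coeffMap (s i) (coeffMap (s i) v)))
    (isWeyl.up_up_self (F := F) (h := h) (i := i) (fun _ _ => H.ne) (fun _ _ => H.sub_one_ne) α β)
  simp only [Module.End.mul_apply] at key
  simp only [xop_apply, coeffMap_smul, map_smul, H.up_self i _ _, key]

theorem coeffMap_injective {i j : ℕ} {v w : MvPolynomial (ℕ × κ) F}
    (hvw : coeffMap (s i) (coeffMap (s j) v) = coeffMap (s i) (coeffMap (s j) w)) : v = w :=
  (coeffMap (s j)).injective ((coeffMap (s i)).injective hvw)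

theorem dop_dop_of_lt {n i j : ℕ} (hij : i < j) (hj : j < n) (α β : κ)
    (v : MvPolynomial (ℕ × κ) F) :
    dop h s n j β (dop h s n i α v) =
      dop h s n i α (dop h s n j β (((h i - h j) ^ 2 / ((h i - h j) ^ 2 - 1)) • v)) +
      dop h s n i β (dop h s n j α (((h i - h j) / ((h i - h j) ^ 2 - 1)) • v)) := by
  obtain ⟨G, hG, hG'⟩ := H.downFactor_of_lt hij hj
  -- Applying both automorphisms removes the inverse shifts built into `dop`.
  apply H.coeffMap_injective (i := i) (j := j)
  rw [map_add, map_add, ← H.coeffMap_comm j i (dop h s n i α _),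
    ← H.coeffMap_comm j i (dop h s n i β _)]
  simp only [coeffMap_dop, coeffMap_smul, map_smul, H.down_of_gt hij _ _,
    H.down_of_lt hij hj _ _, H.downFactor_of_gt n hij, hG']
  rw [hG]
  have h1 := H.sub_ne hij.ne
  have h2 := H.sub_add_one_ne hij.ne
  have h3 := H.sub_sub_one_ne hij.ne
  have h4 : (h i - h j) ^ 2 - 1 ≠ 0 := by
    rw [show (h i - h j) ^ 2 - 1 = (h i - h j + 1) * (h i - h j - 1) by ring]
    exact mul_ne_zero h2 h3
  have key := congrArg (fun a => a v)
    (isWeyl.down_down (F := F) (h := h) hij hj (fun _ _ => H.ne) h2 α β)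
  simp only [LinearMap.smul_apply, Module.End.mul_apply, LinearMap.add_apply] at key
  have key' := (eq_inv_smul_iff₀ h1).2 key
  rw [key']
  match_scalars <;> field_simp <;> ring

theorem dop_dop_self [CharZero F] (n i : ℕ) (α β : κ) (v : MvPolynomial (ℕ × κ) F) :
    dop h s n i α (dop h s n i β v) = dop h s n i β (dop h s n i α v) := by
  apply H.coeffMap_injective (i := i) (j := i)
  have key := congrArg (fun a => a v)
    (isWeyl.down_down_self (F := F) (h := h) (n := n) (i := i) (fun _ _ => H.ne)
      (fun _ _ => H.sub_one_ne) α β)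
  simp only [Module.End.mul_apply] at key
  simp only [coeffMap_dop, coeffMap_smul, map_smul, H.down_self n i _ _, key]

theorem xop_dop_of_lt {n i j : ℕ} (hij : i < j) (α β : κ) (v : MvPolynomial (ℕ × κ) F) :
    xop h s i α (dop h s n j β v) = dop h s n j β (xop h s i α v) := by
  apply (coeffMap (s j)).injective
  have key := congrArg (fun a => a (coeffMap (s i) v))
    (isWeyl.up_down_of_lt (F := F) (h := h) (n := n) hij (h i) (h j) α β).eq
  simp only [Module.End.mul_apply] at key
  simp only [xop_apply, coeffMap_dop, coeffMap_smul, map_smul, H.up_of_lt hij _ _,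
    H.upFactor_of_lt hij, H.coeffMap_comm j i, H.down_of_gt hij _ _, H.downFactor_of_gt n hij, key]
  rw [smul_comm]

theorem xop_dop_of_gt {n i j : ℕ} (hij : i < j) (hj : j < n) (α β : κ)
    (v : MvPolynomial (ℕ × κ) F) :
    xop h s j α (dop h s n i β v) =
      dop h s n i β ((((h j - h i) ^ 2 - 1) / (h j - h i) ^ 2) • xop h s j α v) := by
  obtain ⟨G, hG, hG'⟩ := H.upFactor_of_gt hij
  obtain ⟨E, hE, hE'⟩ := H.downFactor_of_lt hij hj
  apply (coeffMap (s i)).injective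
  have h1 := H.sub_ne hij.ne'
  have h2 := H.sub_add_one_ne hij.ne'
  have h3 := H.sub_sub_one_ne hij.ne'
  have h2' := H.sub_add_one_ne hij.ne
  have key := congrArg (fun a => a (coeffMap (s j) v))
    (isWeyl.down_up (F := F) (h := h) hij hj (fun _ _ => H.ne) h2 h2' α β)
  simp only [LinearMap.smul_apply, Module.End.mul_apply] at key
  have key' := (eq_inv_smul_iff₀ (pow_ne_zero 2 h1)).2 key
  simp only [xop_apply, coeffMap_dop, coeffMap_smul, map_smul, H.up_of_gt hij _ _,
    H.coeffMap_comm i j, H.down_of_lt hij hj _ _, hG', hE', key', smul_smul]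
  rw [hG, hE]
  congr 1
  rw [show h i - h j = -(h j - h i) by ring]
  generalize h j - h i = w at h1 h2 h3 ⊢
  rw [show -w - 1 = -(w + 1) by ring, show -w + 1 = -(w - 1) by ring]
  field_simp
  ring

/-- Up to shift and normalization, each product of `dop` and `xop` at index `k` is the full
monodromy matrix at `h k + 1`. Its partial fractions involve the vectors `U m`. Summed over `k`, the
three residue identities give `1` on the identity part, `0` on `U m` for `m ≠ i`, and precisely the
left side on `U i`. -/
theorem xop_dop_self {n i : ℕ} (hi : i < n) (α β : κ) (v : MvPolynomial (ℕ × κ) F) :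
    xop h s i α (dop h s n i β v) =
      ∑ k ∈ range n, dop h s n k β ((if k = i then 1 else (h k - h i)⁻¹) • xop h s k α v) -
        (if α = β then (1 : F) else 0) • v := by
  have hv1 : ∀ k l, h k - h l + 1 ≠ 0 := by
    intro k l
    rcases eq_or_ne k l with rfl | hkl
    · simp
    · exact H.sub_add_one_ne hkl
  -- `q k` is the product of the two normalizations before the shift `s k`, written in the form used
  -- by the residue identities.
  set q : ℕ → F := fun k => ∏ m ∈ (range n).erase k, (h k - h m + 1) / (h k - h m) with hq
  have hfac : ∀ k, k < n → upFactor h k * downFactor h n k =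
      ∏ m ∈ (range n).erase k, (h k - h m) / (h k - h m - 1) := by
    intro k hk
    rw [upFactor, downFactor, ← prod_union]
    · refine prod_congr ?_ fun _ _ => rfl
      ext m
      simp only [mem_union, mem_range, mem_Ico, mem_erase]
      omega
    · refine disjoint_left.2 fun m hm hm' => ?_
      have := mem_range.1 hm
      have := (mem_Ico.1 hm').1
      omega
  have hqs : ∀ k, k < n → s k (q k) = upFactor h k * downFactor h n k := by
    intro k hk
    rw [hfac k hk, hq, map_prod]
    refine prod_congr rfl fun m hm => ?_
    have := (mem_erase.1 hm).1
    rw [map_div₀, map_add, map_sub, map_one, H.map_self, H.map_ne k m (by omega)]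
    congr 1 <;> ring
  set U : ℕ → MvPolynomial (ℕ × κ) F := fun m => up (yop F) (cop F) h m (h m) α
    (down (yop F) (cop F) h n m (h m) β v) with hU
  have hL : xop h s i α (dop h s n i β v) = (upFactor h i * downFactor h n i) • U i := by
    rw [xop_apply, coeffMap_dop, map_smul, smul_smul]
  have hterm : ∀ k ∈ range n, dop h s n k β ((if k = i then 1 else (h k - h i)⁻¹) • xop h s k α v) =
      (q k * (h k - h i + 1)⁻¹) • ((if α = β then (1 : F) else 0) • v +
        ∑ m ∈ range n, (h k - h m + 1)⁻¹ • U m) := by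
    intro k hk
    have hkn := mem_range.1 hk
    have e1 := mono_partialFraction (y := yop F (κ := κ)) (D := cop F) (fun _ _ => H.ne) n
      (u := h k + 1) (fun m _ h0 => hv1 k m (by rw [← h0]; ring)) α β
    rw [← isWeyl.down_mul_up hkn] at e1
    have e2 := congrArg (fun a => a v) e1
    simp only [LinearMap.add_apply, LinearMap.smul_apply, LinearMap.sum_apply,
      Module.End.mul_apply, Module.End.one_apply] at e2
    have e3 : ∀ m, h k + 1 - h m = h k - h m + 1 := fun m => by ring
    simp only [e3] at e2
    rw [← e2]
    apply (coeffMap (s k)).injective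
    have e4 := H.down_up_self n k α β v
    simp only [Module.End.mul_apply] at e4
    rw [coeffMap_smul, e4, coeffMap_dop, xop_apply, map_smul, map_smul, smul_smul, smul_smul,
      map_mul, hqs k hkn]
    congr 1
    -- Before the shift both branches are the single expression `(h k - h i + 1)⁻¹`.
    have e5 : s k (h k - h i + 1)⁻¹ = if k = i then 1 else (h k - h i)⁻¹ := by
      split_ifs with hki
      · subst hki; simp
      · rw [map_inv₀, map_add, map_sub, map_one, H.map_self, H.map_ne k i hki]
        congr 1; ring
    rw [e5]
    ring
  rw [hL, sum_congr rfl hterm]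
  have hi' := mem_range.2 hi
  have e1 : ∑ k ∈ range n, (q k * (h k - h i + 1)⁻¹) • (if α = β then (1 : F) else 0) • v =
      (if α = β then (1 : F) else 0) • v := by
    rw [← sum_smul, residue_sum_one (fun _ _ => H.sub_ne) hv1 hi', one_smul]
  have e2 : ∑ k ∈ range n, (q k * (h k - h i + 1)⁻¹) • ∑ m ∈ range n, (h k - h m + 1)⁻¹ • U m =
      (upFactor h i * downFactor h n i) • U i := by
    simp only [smul_sum, smul_smul]
    rw [sum_comm]
    simp only [← sum_smul]
    rw [sum_eq_single_of_mem i hi']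
    · rw [residue_sum_self (fun _ _ => H.sub_ne) hv1 hi', hfac i hi]
    · intro m hm hmi
      rw [residue_sum_ne (fun _ _ => H.sub_ne) hv1 hi' hm hmi.symm, zero_smul]
  simp only [smul_add, sum_add_distrib, e1, e2, add_sub_cancel_left]

end IsShiftSystem

end Relations

end Operators
end
end HDeformed


namespace HDeformed

noncomputable section

open Finset

/-! ### The generic parameters: rational functions in the `h i` and the inclusion of `Ū(n)`. -/

section Shift

variable {K : Type*} [Field K] {σ : Type*}

/-- The shift `Xᵢ ↦ Xᵢ + mᵢ`. -/
def shiftPoly (m : σ → ℤ) : MvPolynomial σ K →ₐ[K] MvPolynomial σ K :=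
  MvPolynomial.aeval fun i => MvPolynomial.X i + MvPolynomial.C (m i : K)

@[simp]
theorem shiftPoly_X (m : σ → ℤ) (i : σ) : shiftPoly (K := K) m (MvPolynomial.X i) =
    MvPolynomial.X i + MvPolynomial.C (m i : K) := by simp [shiftPoly]

theorem shiftPoly_comp (m m' : σ → ℤ) :
    (shiftPoly (K := K) m).comp (shiftPoly m') = shiftPoly (m + m') := by
  ext1 i
  simp [add_assoc]

theorem shiftPoly_zero : shiftPoly (K := K) (0 : σ → ℤ) = AlgHom.id K _ := by
  ext1 i
  simp

/-- The shift as an automorphism. -/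
def shiftPolyEquiv (m : σ → ℤ) : MvPolynomial σ K ≃ₐ[K] MvPolynomial σ K :=
  AlgEquiv.ofAlgHom (shiftPoly m) (shiftPoly (-m))
    (by rw [shiftPoly_comp, add_neg_cancel, shiftPoly_zero])
    (by rw [shiftPoly_comp, neg_add_cancel, shiftPoly_zero])

variable (K) in
/-- The field of rational functions in `h₀, h₁, …`. -/
abbrev RatFun : Type _ := FractionRing (MvPolynomial ℕ K)

variable (K) in
/-- The variable `hᵢ`. -/
def hvar (i : ℕ) : RatFun K := algebraMap (MvPolynomial ℕ K) _ (MvPolynomial.X i)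

variable (K) in
/-- The automorphism `hᵢ ↦ hᵢ - 1`. -/
def hshift (i : ℕ) : RatFun K ≃ₐ[K] RatFun K :=
  IsFractionRing.algEquivOfAlgEquiv (shiftPolyEquiv (Pi.single i (-1)))

theorem hshift_algebraMap (i : ℕ) (p : MvPolynomial ℕ K) :
    hshift K i (algebraMap _ _ p) = algebraMap _ _ (shiftPoly (Pi.single i (-1)) p) := by
  simp [hshift, shiftPolyEquiv]

theorem isShiftSystem [CharZero K] : IsShiftSystem K (hvar K) (hshift K) where
  map_self i := by
    simp [hvar, hshift_algebraMap, sub_eq_add_neg]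
  map_ne i j hij := by
    simp [hvar, hshift_algebraMap, hij.symm]
  comm i j a := by
    obtain ⟨p, q, -, rfl⟩ := IsFractionRing.div_surjective (MvPolynomial ℕ K) a
    have : ∀ p, shiftPoly (K := K) (Pi.single i (-1)) (shiftPoly (Pi.single j (-1)) p) =
        shiftPoly (Pi.single j (-1)) (shiftPoly (Pi.single i (-1)) p) := fun p => by
      rw [← AlgHom.comp_apply, shiftPoly_comp, add_comm, ← shiftPoly_comp, AlgHom.comp_apply]
    simp only [map_div₀, hshift_algebraMap, this]
  generic i j hij m h0 := by
    have : algebraMap (MvPolynomial ℕ K) (RatFun K)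
        (MvPolynomial.X i - MvPolynomial.X j + MvPolynomial.C (m : K)) = 0 := by
      rw [← h0]
      simp [hvar]
    rw [IsFractionRing.to_map_eq_zero_iff] at this
    -- At `h i = 1 - m`, with all other variables zero, the polynomial takes the value `1`.
    have := congrArg (MvPolynomial.eval (Pi.single i (1 - m : K))) this
    simp [hij.symm] at this

variable {n : ℕ}

theorem denominators_induction {p : MvPolynomial (Fin n) K → Prop} (h1 : p 1)
    (hmul : ∀ a b, p a → p b → p (a * b))
    (hgen : ∀ i j : Fin n, i ≠ j → ∀ k : ℤ,
      p (MvPolynomial.X i - MvPolynomial.X j + MvPolynomial.C (k : K)))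
    (a : denominators K n) : p a := by
  obtain ⟨a, ha⟩ := a
  induction ha using Submonoid.closure_induction with
  | mem x hx => obtain ⟨i, j, hij, k, rfl⟩ := hx; exact hgen i j hij k
  | one => exact h1
  | mul x y _ _ hx hy => exact hmul x y hx hy

theorem isUnit_ratFun [CharZero K] (a : denominators K n) :
    IsUnit (((Algebra.ofId (MvPolynomial ℕ K) (RatFun K)).restrictScalars K).comp
      (MvPolynomial.rename (Fin.val : Fin n → ℕ)) (a : MvPolynomial (Fin n) K)) := by
  refine denominators_induction (p := fun a => IsUnit (((Algebra.ofId (MvPolynomial ℕ K)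
    (RatFun K)).restrictScalars K).comp (MvPolynomial.rename (Fin.val : Fin n → ℕ)) a)) ?_ ?_ ?_ a
  · simp
  · intro a b ha hb; rw [map_mul]; exact ha.mul hb
  · intro i j hij k
    refine isUnit_iff_ne_zero.2 ?_
    have := (isShiftSystem (K := K)).generic i j (fun h => hij (Fin.ext h)) k
    simpa [hvar, Algebra.ofId_apply] using this

variable (K n) in
/-- The inclusion of `Ū(n)` in the field of rational functions. -/
def toRatFun [CharZero K] : Ubar K n →ₐ[K] RatFun K :=
  IsLocalization.liftAlgHom (M := denominators K n) (f := ((Algebra.ofId (MvPolynomial ℕ K)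
    (RatFun K)).restrictScalars K).comp (MvPolynomial.rename (Fin.val : Fin n → ℕ))) isUnit_ratFun

theorem toRatFun_hgen [CharZero K] (i : Fin n) : toRatFun K n (hgen K i) = hvar K i := by
  simp [toRatFun, hgen, hvar, Algebra.ofId_apply]

theorem denominators_le [CharZero K] : denominators K n ≤ nonZeroDivisors _ := by
  intro a ha
  refine mem_nonZeroDivisors_of_ne_zero ?_
  rintro rfl
  simpa using isUnit_ratFun (⟨0, ha⟩ : denominators K n)

theorem algebraMap_Ubar_injective [CharZero K] :
    Function.Injective (algebraMap (MvPolynomial (Fin n) K) (Ubar K n)) :=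
  IsLocalization.injective _ denominators_le

theorem toRatFun_injective [CharZero K] : Function.Injective (toRatFun K n) := by
  rw [toRatFun, IsLocalization.coe_liftAlgHom, IsLocalization.lift_injective_iff]
  intro x y
  rw [algebraMap_Ubar_injective.eq_iff]
  have h : Function.Injective ((((Algebra.ofId (MvPolynomial ℕ K) (RatFun K)).restrictScalars K).comp
      (MvPolynomial.rename (Fin.val : Fin n → ℕ)) : MvPolynomial (Fin n) K →ₐ[K] RatFun K)) :=
    (IsFractionRing.injective (MvPolynomial ℕ K) (RatFun K)).comp
      (MvPolynomial.rename_injective _ Fin.val_injective)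
  exact h.eq_iff.symm

end Shift

/-! ### Collapsing the sums over R-matrix entries. -/

section Rmatrix

variable (K : Type*) [Field K] {n : ℕ}

/-- The entry `R^{ij}_{ji}`. -/
def Rflip (i j : Fin n) : Ubar K n := Rhat K i j j i

theorem Rflip_of_lt {i j : Fin n} (hij : i < j) :
    Rflip K i j = (hdiff K i j ^ 2 - 1) * Ring.inverse (hdiff K i j ^ 2) := by
  simp [Rflip, Rhat, hij]

theorem Rflip_of_le {i j : Fin n} (hij : j ≤ i) : Rflip K i j = 1 := by
  simp [Rflip, Rhat, not_lt.2 hij]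

variable {K} {B : Type*} [AddCommMonoid B]

/-- For fixed upper indices at most two entries are nonzero. `φ` abstracts the monomial in which the
entry is inserted, so one lemma serves the ring and every model of it. -/
theorem sum_Rhat_lower (i j : Fin n) (φ : Fin n → Fin n → Ubar K n → B) (h0 : ∀ k l, φ k l 0 = 0) :
    ∑ k, ∑ l, φ k l (Rhat K i j k l) =
      φ j i (Rflip K i j) + if i = j then 0 else φ i j (Ring.inverse (hdiff K i j)) := by
  have h : ∀ k l, φ k l (Rhat K i j k l) = (if k = j then if l = i then φ j i (Rflip K i j) else 0
      else 0) + if k = i then if l = j then if i = j then 0 else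
        φ i j (Ring.inverse (hdiff K i j)) else 0 else 0 := by
    intro k l
    by_cases hij : i = j
    · subst hij
      by_cases hk : k = i <;> by_cases hl : l = i <;> simp [Rhat, Rflip, hk, hl, h0]
    · have hji : j ≠ i := fun h => hij h.symm
      by_cases hk : k = j
      · subst hk
        by_cases hl : l = i
        · subst hl; simp [Rflip, hji]
        · simp [Rhat, hl, hji, h0]
      · by_cases hk' : k = i
        · subst hk'
          by_cases hl : l = j
          · subst hl; simp [Rhat, hij, hji]
          · simp [Rhat, hij, hl, h0]
        · simp [Rhat, hk, hk', h0]
  simp only [h, sum_add_distrib]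
  simp

theorem sum_Rhat_upper (k l : Fin n) (φ : Fin n → Fin n → Ubar K n → B) (h0 : ∀ k l, φ k l 0 = 0) :
    ∑ i, ∑ j, φ i j (Rhat K i j k l) =
      φ l k (Rflip K l k) + if k = l then 0 else φ k l (Ring.inverse (hdiff K k l)) := by
  have h : ∀ i j, φ i j (Rhat K i j k l) = (if i = l then if j = k then φ l k (Rflip K l k) else 0
      else 0) + if i = k then if j = l then if k = l then 0 else
        φ k l (Ring.inverse (hdiff K k l)) else 0 else 0 := by
    intro i j
    by_cases hi : i = l
    · subst hi
      by_cases hj : j = k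
      · subst hj
        by_cases hij : i = j <;> simp [Rflip, hij]
      · by_cases hk : i = k
        · subst hk
          have hj' : ¬ i = j := fun h => hj h.symm
          simp [Rhat, hj, hj', h0]
        · have hk' : ¬ k = i := fun h => hk h.symm
          have hj' : ¬ k = j := fun h => hj h.symm
          simp [Rhat, hj, hj', hk, hk', h0]
    · have hi' : ¬ l = i := fun h => hi h.symm
      by_cases hk : i = k
      · subst hk
        by_cases hj : j = l
        · subst hj; simp [Rhat, hi, hi']
        · have hj' : ¬ l = j := fun h => hj h.symm
          simp [Rhat, hi, hi', hj, hj', h0]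
      · have hk' : ¬ k = i := fun h => hk h.symm
        simp [Rhat, hi, hi', hk, hk', h0]
  simp only [h, sum_add_distrib]
  simp

/-- For `i = j` an entry survives for each `k`, namely `R^{ki}_{ki}`; for `i ≠ j` the lower indices
can only be the swapped pair. -/
theorem sum_Rhat_mixed (i j : Fin n) (φ : Fin n → Fin n → Ubar K n → B) (h0 : ∀ k l, φ k l 0 = 0) :
    ∑ k, ∑ l, φ k l (Rhat K k i l j) = if i = j then
      ∑ k, φ k k (if k = i then 1 else Ring.inverse (hdiff K k i)) else φ j i (Rflip K j i) := by
  split_ifs with hij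
  · subst hij
    refine sum_congr rfl fun k _ => ?_
    rw [sum_eq_single k]
    · by_cases hk : k = i
      · subst hk; simp [Rhat]
      · have hk' : ¬ i = k := fun h => hk h.symm
        simp [Rhat, hk, hk']
    · intro l _ hl
      by_cases hk : l = i
      · subst hk
        have hl' : ¬ k = l := fun h => hl h.symm
        simp [Rhat, hl, h0]
      · simp [Rhat, hl, hk, h0]
    · simp
  · have hji : ¬ j = i := fun h => hij h.symm
    rw [sum_eq_single j, sum_eq_single i]
    · simp [Rflip]
    · intro l _ hl
      simp [Rhat, hl, hji, h0]
    · simp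
    · intro k _ hk
      have hk' : ¬ j = k := fun h => hk h.symm
      refine sum_eq_zero fun l _ => ?_
      simp [Rhat, hk', hji, h0]
    · simp

end Rmatrix
end
end HDeformed


namespace HDeformed

noncomputable section

open Finset

/-! ### The universal property of the pairing ring. -/

section Lift

variable {K : Type*} [Field K] {n N' N : ℕ} {B : Type*} [Ring B] [Algebra K B]

/-- Elements of an algebra that satisfy the defining relations of the pairing ring. -/
structure IsModel (σ : Fin n → Fin N' → Fin N → Ubar K n) (u : Ubar K n →ₐ[K] B)
    (X : Fin n → Fin N' → B) (D : Fin n → Fin N → B) : Prop where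
  weight_x : ∀ i j α, u (hgen K i) * X j α = X j α * u (hgen K i + if i = j then 1 else 0)
  weight_d : ∀ i j β, u (hgen K i) * D j β = D j β * u (hgen K i - if i = j then 1 else 0)
  x_x : ∀ i j α β, X i α * X j β = u (Rflip K i j) * X j β * X i α +
    if i = j then 0 else u (Ring.inverse (hdiff K i j)) * X i β * X j α
  d_d : ∀ l k α β, D l α * D k β = D k β * D l α * u (Rflip K l k) +
    if k = l then 0 else D l β * D k α * u (Ring.inverse (hdiff K k l))
  x_d : ∀ i j α β, i ≠ j → X i α * D j β = D j β * u (Rflip K j i) * X i α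
  x_d_self : ∀ i α β, X i α * D i β =
    ∑ k, D k β * u (if k = i then 1 else Ring.inverse (hdiff K k i)) * X k α - u (σ i α β)

theorem isModel (σ : Fin n → Fin N' → Fin N → Ubar K n) :
    IsModel σ (coeff σ) (xgen σ) (dgen σ) where
  weight_x i j α := by
    have h := mk_rel σ (.weight_x i j α)
    rw [map_mul, map_mul] at h
    exact h
  weight_d i j β := by
    have h := mk_rel σ (.weight_d i j β)
    rw [map_mul, map_mul] at h
    exact h
  x_x i j α β := by
    have h := mk_rel σ (.x_x i j α β)
    simp only [map_mul, map_sum] at h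
    exact h.trans (sum_Rhat_lower i j
      (fun k l r => coeff σ r * xgen σ k β * xgen σ l α) fun k l => by simp)
  d_d l k α β := by
    have h := mk_rel σ (.d_d l k α β)
    simp only [map_mul, map_sum] at h
    exact h.trans (sum_Rhat_upper k l
      (fun i j r => dgen σ j β * dgen σ i α * coeff σ r) fun k l => by simp)
  x_d i j α β hij := by
    have h := mk_rel σ (.x_d i j α β)
    simp only [map_mul, map_sum, if_neg hij, sub_zero] at h
    refine h.trans ((sum_Rhat_mixed i j
      (fun k l r => dgen σ k β * coeff σ r * xgen σ l α) fun k l => by simp).trans ?_)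
    rw [if_neg hij]
  x_d_self i α β := by
    have h := mk_rel σ (.x_d i i α β)
    simp only [map_mul, map_sum, map_sub, if_pos] at h
    refine h.trans ?_
    congr 1
    refine ((sum_Rhat_mixed i i
      (fun k l r => dgen σ k β * coeff σ r * xgen σ l α) fun k l => by simp).trans ?_)
    rw [if_pos rfl]

/-- The values of a homomorphism on the generators. -/
def genVal (u : Ubar K n →ₐ[K] B) (X : Fin n → Fin N' → B) (D : Fin n → Fin N → B) :
    Gen K n N' N → B
  | .coeff a => u a
  | .x i α => X i α
  | .d j β => D j β

variable {σ : Fin n → Fin N' → Fin N → Ubar K n} {u : Ubar K n →ₐ[K] B}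
  {X : Fin n → Fin N' → B} {D : Fin n → Fin N → B}

theorem IsModel.respects (H : IsModel σ u X D) ⦃a b : FreeAlgebra K (Gen K n N' N)⦄
    (h : Rel σ a b) : FreeAlgebra.lift K (genVal u X D) a = FreeAlgebra.lift K (genVal u X D) b := by
  induction h with
  | coeff_add a b => simp [genVal]
  | coeff_mul a b => simp [genVal]
  | coeff_algebraMap c => simp [genVal]
  | weight_x i j α =>
    simp only [map_mul, FreeAlgebra.lift_ι_apply, genVal]
    exact H.weight_x i j α
  | weight_d i j β =>
    simp only [map_mul, FreeAlgebra.lift_ι_apply, genVal]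
    exact H.weight_d i j β
  | x_x i j α β =>
    simp only [map_mul, map_sum, FreeAlgebra.lift_ι_apply, genVal]
    exact (H.x_x i j α β).trans (sum_Rhat_lower i j
      (fun k l r => u r * X k β * X l α) fun k l => by simp).symm
  | d_d l k α β =>
    simp only [map_mul, map_sum, FreeAlgebra.lift_ι_apply, genVal]
    exact (H.d_d l k α β).trans (sum_Rhat_upper k l
      (fun i j r => D j β * D i α * u r) fun k l => by simp).symm
  | x_d i j α β =>
    have e := sum_Rhat_mixed i j (fun k l r => D k β * u r * X l α) fun k l => by simp
    simp only [map_mul, map_sum, map_sub, FreeAlgebra.lift_ι_apply, genVal, e]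
    split_ifs with hij
    · subst hij
      simpa [genVal] using H.x_d_self i α β
    · simpa using H.x_d i j α β hij

/-- The universal property of the pairing ring. -/
def IsModel.lift (H : IsModel σ u X D) : PairingRing σ →ₐ[K] B :=
  RingQuot.liftAlgHom K ⟨FreeAlgebra.lift K (genVal u X D), H.respects⟩

theorem IsModel.lift_mk (H : IsModel σ u X D) (a : FreeAlgebra K (Gen K n N' N)) :
    H.lift (HDeformed.mk σ a) = FreeAlgebra.lift K (genVal u X D) a :=
  RingQuot.liftAlgHom_mkAlgHom_apply K _ _ _

theorem IsModel.lift_coeff (H : IsModel σ u X D) (a : Ubar K n) : H.lift (coeff σ a) = u a :=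
  (H.lift_mk _).trans (FreeAlgebra.lift_ι_apply _ _)

theorem IsModel.lift_xgen (H : IsModel σ u X D) (i : Fin n) (α : Fin N') :
    H.lift (xgen σ i α) = X i α :=
  (H.lift_mk _).trans (FreeAlgebra.lift_ι_apply _ _)

theorem IsModel.lift_dgen (H : IsModel σ u X D) (i : Fin n) (β : Fin N) :
    H.lift (dgen σ i β) = D i β :=
  (H.lift_mk _).trans (FreeAlgebra.lift_ι_apply _ _)

theorem algHom_ext {f g : PairingRing σ →ₐ[K] B} (hu : ∀ a, f (coeff σ a) = g (coeff σ a))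
    (hx : ∀ i α, f (xgen σ i α) = g (xgen σ i α)) (hd : ∀ i β, f (dgen σ i β) = g (dgen σ i β)) :
    f = g := by
  apply RingQuot.ringQuot_ext'
  ext a
  cases a with
  | coeff a => exact hu a
  | x i α => exact hx i α
  | d i β => exact hd i β

end Lift

/-! ### Linear combinations of copies. -/

section Redefinition

variable {K : Type*} [Field K] {n N' N : ℕ}

theorem sum_smul_mul_mul_sum_smul {B ι ι' : Type*} [Ring B] [Algebra K B] [Fintype ι] [Fintype ι']
    (a : ι → K) (b : ι' → K) (x : ι → B) (u : B) (y : ι' → B) :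
    (∑ i, a i • x i) * u * (∑ j, b j • y j) = ∑ i, ∑ j, (a i * b j) • (x i * u * y j) := by
  rw [sum_mul, sum_mul_sum]
  simp only [smul_mul_assoc, mul_smul_comm, smul_smul, mul_comm (a _)]

theorem sum_smul_mul_sum_smul {B ι ι' : Type*} [Ring B] [Algebra K B] [Fintype ι] [Fintype ι']
    (a : ι → K) (b : ι' → K) (x : ι → B) (y : ι' → B) :
    (∑ i, a i • x i) * (∑ j, b j • y j) = ∑ i, ∑ j, (a i * b j) • (x i * y j) := by
  simpa using sum_smul_mul_mul_sum_smul a b x 1 y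

variable {B : Type*} [Ring B] [Algebra K B] {M' M : ℕ}
  {σ : Fin n → Fin N' → Fin N → Ubar K n} {τ : Fin n → Fin M' → Fin M → Ubar K n}
  {u : Ubar K n →ₐ[K] B} {X : Fin n → Fin M' → B} {D : Fin n → Fin M → B}

/-- The R-matrix ignores the copy index and the relations are bilinear in it, so scalar matrices act
on the copies and send `τ` to `A τ Bᵀ`. The matrices may be rectangular, which lets one large model
serve rings with fewer copies. -/
theorem IsModel.linearCombination (H : IsModel τ u X D) (A : Matrix (Fin N') (Fin M') K)
    (B : Matrix (Fin N) (Fin M) K)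
    (h : ∀ i α β, σ i α β = ∑ α', ∑ β', (A α α' * B β β') • τ i α' β') :
    IsModel σ u (fun i α => ∑ α', A α α' • X i α') (fun i β => ∑ β', B β β' • D i β') where
  weight_x i j α := by
    simp only [mul_sum, sum_mul, mul_smul_comm, smul_mul_assoc, H.weight_x]
  weight_d i j α := by
    simp only [mul_sum, sum_mul, mul_smul_comm, smul_mul_assoc, H.weight_d]
  x_x i j α β := by
    have e : ∀ v (k l : Fin n), v * (∑ β', A β β' • X k β') * (∑ α', A α α' • X l α') =
        ∑ α', ∑ β', (A α α' * A β β') • (v * X k β' * X l α') := by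
      intro v k l
      rw [mul_assoc, sum_smul_mul_sum_smul, mul_sum, sum_comm]
      simp only [mul_sum, mul_smul_comm, mul_assoc, mul_comm (A α _)]
    simp only [e, sum_smul_mul_sum_smul, H.x_x i j, smul_add, sum_add_distrib]
    split_ifs <;> simp
  d_d l k α β := by
    have e : ∀ v (p q : Fin n), (∑ β', B β β' • D p β') * (∑ α', B α α' • D q α') * v =
        ∑ α', ∑ β', (B α α' * B β β') • (D p β' * D q α' * v) := by
      intro v p q
      rw [sum_smul_mul_sum_smul, sum_mul, sum_comm]
      simp only [sum_mul, smul_mul_assoc, mul_comm (B α _)]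
    rw [e, e, sum_smul_mul_sum_smul, sum_congr rfl fun _ _ => sum_congr rfl fun _ _ => by
      rw [H.d_d l k, smul_add]]
    simp only [sum_add_distrib]
    split_ifs <;> simp
  x_d i j α β hij := by
    rw [sum_smul_mul_sum_smul, sum_smul_mul_mul_sum_smul, sum_comm]
    exact sum_congr rfl fun _ _ => sum_congr rfl fun _ _ => by
      rw [H.x_d i j _ _ hij, mul_comm (A α _)]
  x_d_self i α β := by
    have e : ∑ α', ∑ β', (A α α' * B β β') • (∑ k, D k β' *
        u (if k = i then 1 else Ring.inverse (hdiff K k i)) * X k α') =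
        ∑ k, (∑ β', B β β' • D k β') *
        u (if k = i then 1 else Ring.inverse (hdiff K k i)) * (∑ α', A α α' • X k α') := by
      simp only [sum_smul_mul_mul_sum_smul, smul_sum]
      rw [sum_comm, sum_comm_cycle]
      exact sum_congr rfl fun _ _ => sum_congr rfl fun _ _ => sum_congr rfl fun _ _ => by
        rw [mul_comm (A α _)]
    rw [← e, h i, sum_smul_mul_sum_smul]
    simp only [H.x_d_self i, smul_sub, sum_sub_distrib, map_sum, map_smul]

end Redefinition
end
end HDeformed


namespace HDeformed

noncomputable section

open Finset

/-! ### Shifts of `Ū(n)` and commutation of coefficients with generators. -/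

section Shift

variable {K : Type*} [Field K] {n : ℕ}

theorem shiftPoly_mem_denominators (m : Fin n → ℤ) {p : MvPolynomial (Fin n) K}
    (hp : p ∈ denominators K n) : shiftPoly m p ∈ denominators K n := by
  induction hp using Submonoid.closure_induction with
  | mem x hx =>
    obtain ⟨i, j, hij, k, rfl⟩ := hx
    refine Submonoid.subset_closure ⟨i, j, hij, k + m i - m j, ?_⟩
    simp
    ring
  | one => rw [map_one]; exact one_mem _
  | mul x y _ _ hx hy => rw [map_mul]; exact mul_mem hx hy

/-- The shift `hᵢ ↦ hᵢ + mᵢ` of `Ū(n)`. -/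
def ubarShift (m : Fin n → ℤ) : Ubar K n →ₐ[K] Ubar K n :=
  IsLocalization.liftAlgHom (M := denominators K n)
    (f := ((Algebra.ofId (MvPolynomial (Fin n) K) (Ubar K n)).restrictScalars K).comp (shiftPoly m))
    fun y => IsLocalization.map_units (Ubar K n)
      (⟨shiftPoly m y, shiftPoly_mem_denominators m y.2⟩ : denominators K n)

theorem ubarShift_algebraMap (m : Fin n → ℤ) (p : MvPolynomial (Fin n) K) :
    ubarShift m (algebraMap _ (Ubar K n) p) = algebraMap _ _ (shiftPoly m p) :=
  IsLocalization.lift_eq _ _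

theorem ubar_algHom_ext {B : Type*} [CommRing B] [Algebra K B] {f g : Ubar K n →ₐ[K] B}
    (h : ∀ i, f (hgen K i) = g (hgen K i)) : f = g := by
  have hp : ∀ p, f (algebraMap (MvPolynomial (Fin n) K) _ p) = g (algebraMap _ _ p) := by
    intro p
    exact DFunLike.congr_fun (MvPolynomial.algHom_ext
      (f := f.comp (Algebra.algHom K (MvPolynomial (Fin n) K) (Ubar K n)))
      (g := g.comp (Algebra.algHom K (MvPolynomial (Fin n) K) (Ubar K n))) h) p
  have : (f : Ubar K n →+* B) = g :=
    IsLocalization.ringHom_ext (denominators K n) (RingHom.ext hp)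
  exact AlgHom.ext fun a => DFunLike.congr_fun this a

theorem ubarShift_hgen (m : Fin n → ℤ) (i : Fin n) :
    ubarShift m (hgen K i) = hgen K i + algebraMap K _ (m i : K) := by
  rw [hgen, ubarShift_algebraMap, shiftPoly_X, map_add, ← MvPolynomial.algebraMap_eq,
    ← IsScalarTower.algebraMap_apply]

theorem ubarShift_comp (m m' : Fin n → ℤ) :
    (ubarShift (K := K) m).comp (ubarShift m') = ubarShift (m + m') := by
  refine ubar_algHom_ext fun i => ?_
  simp [ubarShift_hgen, add_assoc]

theorem ubarShift_zero : ubarShift (K := K) (0 : Fin n → ℤ) = AlgHom.id K _ := by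
  refine ubar_algHom_ext fun i => ?_
  simp [ubarShift_hgen]

theorem ubarShift_neg_apply (m : Fin n → ℤ) (a : Ubar K n) :
    ubarShift (-m) (ubarShift m a) = a := by
  rw [← AlgHom.comp_apply, ubarShift_comp, neg_add_cancel, ubarShift_zero, AlgHom.id_apply]

theorem ubarShift_apply_neg (m : Fin n → ℤ) (a : Ubar K n) :
    ubarShift m (ubarShift (-m) a) = a := by
  rw [← AlgHom.comp_apply, ubarShift_comp, add_neg_cancel, ubarShift_zero, AlgHom.id_apply]

theorem ubarShift_injective (m : Fin n → ℤ) : Function.Injective (ubarShift (K := K) m) :=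
  Function.LeftInverse.injective (ubarShift_neg_apply m)

theorem isUnit_hdiff_add {i j : Fin n} (hij : i ≠ j) (k : ℤ) :
    IsUnit (hdiff K i j + k) := by
  have h := IsLocalization.map_units (Ubar K n) (⟨_, Submonoid.subset_closure ⟨i, j, hij, k, rfl⟩⟩ :
    denominators K n)
  have e : algebraMap (MvPolynomial (Fin n) K) (Ubar K n) (MvPolynomial.C (k : K)) = k := by
    rw [← MvPolynomial.algebraMap_eq, ← IsScalarTower.algebraMap_apply, map_intCast]
  simpa [hdiff, hgen, e] using h

theorem isUnit_hdiff_sq_sub_one {i j : Fin n} (hij : i ≠ j) : IsUnit (hdiff K i j ^ 2 - 1) := by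
  have h := (isUnit_hdiff_add (K := K) hij 1).mul (isUnit_hdiff_add (K := K) hij (-1))
  convert h using 1
  push_cast
  ring

theorem isUnit_Rflip (i j : Fin n) : IsUnit (Rflip K i j) := by
  rcases lt_or_ge i j with h | h
  · rw [Rflip_of_lt K h]
    exact (isUnit_hdiff_sq_sub_one h.ne).mul ((isUnit_hdiff K h.ne).pow 2).ringInverse
  · rw [Rflip_of_le K h]
    exact isUnit_one

/-- The unit vector in the direction of the `j`-th weight. -/
abbrev wt (j : Fin n) : Fin n → ℤ := Pi.single j 1

variable {B : Type*} [Ring B] [Algebra K B]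

/-- Polynomials follow from the generators. A fraction follows by cancelling its denominator, whose
shifted image is a unit. -/
theorem shift_commutation (u : Ubar K n →ₐ[K] B) (m : Fin n → ℤ) (y : B)
    (h : ∀ i, u (hgen K i) * y = y * u (ubarShift m (hgen K i))) (a : Ubar K n) :
    u a * y = y * u (ubarShift m a) := by
  have hp : ∀ p, u (algebraMap (MvPolynomial (Fin n) K) _ p) * y =
      y * u (ubarShift m (algebraMap _ _ p)) := by
    intro p
    induction p using MvPolynomial.induction_on with
    | C c =>
      rw [← MvPolynomial.algebraMap_eq, ← IsScalarTower.algebraMap_apply, AlgHom.commutes,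
        AlgHom.commutes, AlgHom.commutes, Algebra.commutes]
    | add p q hp hq => simp only [map_add, add_mul, mul_add, hp, hq]
    | mul_X p i hp =>
      have := h i
      simp only [hgen] at this
      simp only [map_mul]
      rw [mul_assoc, this, ← mul_assoc, hp, mul_assoc]
  obtain ⟨⟨p, q⟩, hpq⟩ := IsLocalization.surj (denominators K n) a
  have hq : IsUnit (u (ubarShift m (algebraMap _ _ (q : MvPolynomial (Fin n) K)))) :=
    ((IsLocalization.map_units (Ubar K n) q).map (ubarShift m)).map u
  rw [← hq.mul_left_inj, mul_assoc, ← hp, ← mul_assoc, ← map_mul, hpq, hp, mul_assoc, ← map_mul,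
    ← map_mul, hpq]

variable {N' N : ℕ} {σ : Fin n → Fin N' → Fin N → Ubar K n} {u : Ubar K n →ₐ[K] B}
  {X : Fin n → Fin N' → B} {D : Fin n → Fin N → B}

theorem IsModel.coeff_x (H : IsModel σ u X D) (a : Ubar K n) (j : Fin n) (α : Fin N') :
    u a * X j α = X j α * u (ubarShift (wt j) a) := by
  refine shift_commutation u _ _ (fun i => ?_) a
  rw [H.weight_x i j α, ubarShift_hgen]
  by_cases hij : i = j
  · subst hij; simp
  · simp [hij]

theorem IsModel.coeff_d (H : IsModel σ u X D) (a : Ubar K n) (j : Fin n) (β : Fin N) :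
    u a * D j β = D j β * u (ubarShift (-wt j) a) := by
  refine shift_commutation u _ _ (fun i => ?_) a
  rw [H.weight_d i j β, ubarShift_hgen]
  by_cases hij : i = j
  · subst hij; simp [sub_eq_add_neg]
  · simp [hij]

theorem IsModel.x_coeff (H : IsModel σ u X D) (a : Ubar K n) (j : Fin n) (α : Fin N') :
    X j α * u a = u (ubarShift (-wt j) a) * X j α := by
  rw [H.coeff_x, ubarShift_apply_neg]

theorem IsModel.d_coeff (H : IsModel σ u X D) (a : Ubar K n) (j : Fin n) (β : Fin N) :
    D j β * u a = u (ubarShift (wt j) a) * D j β := by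
  rw [H.coeff_d, ubarShift_neg_apply]

end Shift
end
end HDeformed


namespace HDeformed

noncomputable section

open Finset

/-! ### Coordinates acting on words of derivatives applied to a vacuum. -/

section Words

variable {K : Type*} [Field K] {n N' N M : ℕ} {V : Type*} [AddCommGroup V] [Module K V]
  {u : Ubar K n →ₐ[K] Module.End K V}

/-- The vector obtained from the multiple `u f v` of the vacuum `v` by the word `w` of creation
operators. -/
def wordVec (u : Ubar K n →ₐ[K] Module.End K V) (D : Fin n → Fin M → Module.End K V) (v : V)
    (w : List (Fin n × Fin M)) (f : Ubar K n) : V :=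
  (w.map fun p => D p.1 p.2).prod (u f v)

@[simp]
theorem wordVec_nil (D : Fin n → Fin M → Module.End K V) (v : V) (f : Ubar K n) :
    wordVec u D v [] f = u f v := rfl

@[simp]
theorem wordVec_cons (D : Fin n → Fin M → Module.End K V) (v : V) (p : Fin n × Fin M)
    (w : List (Fin n × Fin M)) (f : Ubar K n) :
    wordVec u D v (p :: w) f = D p.1 p.2 (wordVec u D v w f) := by
  simp [wordVec]

variable {τ : Fin n → Fin N' → Fin M → Ubar K n} {X' : Fin n → Fin N' → Module.End K V}
  {D : Fin n → Fin M → Module.End K V} {X : Fin n → Fin M → Module.End K V} {v : V}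

theorem IsModel.coeff_wordVec (H : IsModel τ u X' D) (w : List (Fin n × Fin M)) (g : Ubar K n) :
    ∃ m, ∀ f, u g (wordVec u D v w f) = wordVec u D v w (ubarShift m g * f) := by
  induction w generalizing g with
  | nil => exact ⟨0, fun f => by simp [ubarShift_zero]⟩
  | cons p w ih =>
    obtain ⟨m, hm⟩ := ih (ubarShift (-wt p.1) g)
    refine ⟨m + -wt p.1, fun f => ?_⟩
    rw [wordVec_cons, ← Module.End.mul_apply, H.coeff_d, Module.End.mul_apply, hm, wordVec_cons,
      ← ubarShift_comp, AlgHom.comp_apply]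

theorem IsModel.x_wordVec_of_index_ne (H : IsModel (diffSigma K n M) u X D)
    (hv : ∀ i α f, X i α (u f v) = 0) {i : Fin n} (α : Fin M) (w : List (Fin n × Fin M))
    (f : Ubar K n) (hw : ∀ p ∈ w, p.1 ≠ i) : X i α (wordVec u D v w f) = 0 := by
  induction w with
  | nil => exact hv i α f
  | cons p w ih =>
    rw [wordVec_cons, ← Module.End.mul_apply, H.x_d _ _ _ _ (hw p (by simp)).symm,
      Module.End.mul_apply, ih fun p hp => hw p (by simp [hp]), map_zero]

/-- When the other coordinates of the copy `α` kill `y`, only the term `k = i` of the diagonal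
relation remains and it becomes a Weyl relation. -/
theorem IsModel.x_d_self_apply (H : IsModel (diffSigma K n M) u X D) {i : Fin n} {α : Fin M} (y : V)
    (hy : ∀ k, k ≠ i → X k α y = 0) (β : Fin M) :
    X i α (D i β y) = D i β (X i α y) - if α = β then y else 0 := by
  have h := LinearMap.congr_fun (H.x_d_self i α β) y
  rw [Module.End.mul_apply, LinearMap.sub_apply, LinearMap.sum_apply, sum_eq_single i] at h
  · rw [h]
    simp only [diffSigma, Module.End.mul_apply]
    split_ifs <;> simp
  · intro k _ hk
    rw [Module.End.mul_apply, hy k hk, map_zero]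
  · simp

theorem IsModel.x_wordVec_replicate (H : IsModel (diffSigma K n M) u X D)
    (hv : ∀ i α f, X i α (u f v) = 0) (q : Fin n × Fin M) (a : ℕ) (f : Ubar K n) :
    X q.1 q.2 (wordVec u D v (List.replicate (a + 1) q) f) =
      wordVec u D v (List.replicate a q) (-((a + 1 : ℕ) : K) • f) := by
  have hk : ∀ a k, k ≠ q.1 → X k q.2 (wordVec u D v (List.replicate a q) f) = 0 := by
    intro a k hk
    refine H.x_wordVec_of_index_ne hv _ _ _ fun p hp => ?_
    rw [List.eq_of_mem_replicate hp]
    exact hk.symm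
  have hs : ∀ (w : List (Fin n × Fin M)) (c : K),
      wordVec u D v w (c • f) = c • wordVec u D v w f := by
    intro w c
    simp [wordVec]
  induction a with
  | zero =>
    rw [List.replicate_succ, wordVec_cons, H.x_d_self_apply _ (hk 0), if_pos rfl]
    simp [hv]
  | succ a ih =>
    rw [List.replicate_succ, wordVec_cons, H.x_d_self_apply _ (hk _), if_pos rfl, ih, hs, hs, map_smul,
      ← wordVec_cons, ← List.replicate_succ]
    push_cast
    module

variable {r : Fin n → Fin n → Prop}

/-- The order is what makes the diagonal relation usable: if a letter has the index of `q`,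
antisymmetry of `r` forces all later letters to have that index too, so `IsModel.x_d_self_apply`
applies. At other indices the coordinate just moves on. -/
theorem IsModel.x_wordVec_of_notMem (H : IsModel (diffSigma K n M) u X D)
    (hv : ∀ i α f, X i α (u f v) = 0) (hr : ∀ i j, r i j → r j i → i = j)
    (w : List (Fin n × Fin M)) (q : Fin n × Fin M)
    (hw : (w ++ [q]).Pairwise fun p p' => r p.1 p'.1) (hq : q ∉ w) (f : Ubar K n) :
    X q.1 q.2 (wordVec u D v w f) = 0 := by
  induction w with
  | nil => exact hv _ _ f
  | cons p w ih =>
    rw [List.cons_append, List.pairwise_cons] at hw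
    have ih := ih hw.2 fun h => hq (by simp [h])
    rw [wordVec_cons]
    by_cases hp : q.1 = p.1
    · have hall : ∀ p' ∈ w, p'.1 = p.1 := fun p' hp' => (hr _ _ (hw.1 p' (by simp [hp']))
        (hp ▸ (List.pairwise_append.1 hw.2).2.2 p' hp' q (by simp))).symm
      have hβ : q.2 ≠ p.2 := fun h => hq (by rw [Prod.ext hp h]; simp)
      rw [← hp, H.x_d_self_apply, ih, map_zero, if_neg hβ, sub_zero]
      exact fun k hk => H.x_wordVec_of_index_ne hv _ _ _ fun p' hp' => by
        rw [hall p' hp', ← hp]; exact hk.symm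
    · rw [← Module.End.mul_apply, H.x_d _ _ _ _ hp, Module.End.mul_apply, ih, map_zero]

/-- The coordinate reaches the final power of `q` and differentiates it. The new coefficient is
nonzero because the entries met on the way are units and `a + 1` is nonzero in characteristic zero.
-/
theorem IsModel.x_wordVec_append [CharZero K] (H : IsModel (diffSigma K n M) u X D)
    (hv : ∀ i α f, X i α (u f v) = 0) (hr : ∀ i j, r i j → r j i → i = j)
    (w : List (Fin n × Fin M)) (q : Fin n × Fin M)
    (hw : (w ++ [q]).Pairwise fun p p' => r p.1 p'.1) (hq : q ∉ w) (a : ℕ) {f : Ubar K n}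
    (hf : f ≠ 0) : ∃ f' ≠ 0, X q.1 q.2 (wordVec u D v (w ++ List.replicate (a + 1) q) f) =
      wordVec u D v (w ++ List.replicate a q) f' := by
  induction w with
  | nil => exact ⟨_, smul_ne_zero (neg_ne_zero.2 (Nat.cast_ne_zero.2 a.succ_ne_zero)) hf,
      H.x_wordVec_replicate hv q a f⟩
  | cons p w ih =>
    rw [List.cons_append, List.pairwise_cons] at hw
    obtain ⟨f', hf', ih⟩ := ih hw.2 fun h => hq (by simp [h])
    simp only [List.cons_append, wordVec_cons]
    by_cases hp : q.1 = p.1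
    · have hall : ∀ p' ∈ w, p'.1 = p.1 := fun p' hp' => (hr _ _ (hw.1 p' (by simp [hp']))
        (hp ▸ (List.pairwise_append.1 hw.2).2.2 p' hp' q (by simp))).symm
      have hβ : q.2 ≠ p.2 := fun h => hq (by rw [Prod.ext hp h]; simp)
      refine ⟨f', hf', ?_⟩
      rw [← hp, H.x_d_self_apply, ih, if_neg hβ, sub_zero]
      refine fun k hk => H.x_wordVec_of_index_ne hv _ _ _ fun p' hp' => ?_
      rcases List.mem_append.1 hp' with h | h
      · rw [hall p' h, ← hp]; exact hk.symm
      · rw [List.eq_of_mem_replicate h]; exact hk.symm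
    · obtain ⟨m, hm⟩ := H.coeff_wordVec (v := v) (w ++ List.replicate a q) (Rflip K p.1 q.1)
      refine ⟨ubarShift m (Rflip K p.1 q.1) * f', ?_, ?_⟩
      rotate_left
      · rw [← Module.End.mul_apply, H.x_d _ _ _ _ hp, Module.End.mul_apply, Module.End.mul_apply,
          ih, hm]
      · exact ((isUnit_Rflip p.1 q.1).map (ubarShift m)).mul_right_eq_zero.not.2 hf'

/-- The word `q₁^{e(q₁)} q₂^{e(q₂)} ⋯` for the list `q₁, q₂, …`. -/
def powerWord {ι : Type*} (l : List ι) (e : ι → ℕ) : List ι := l.flatMap fun q => List.replicate (e q) q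

theorem powerWord_append {ι : Type*} (l l' : List ι) (e : ι → ℕ) :
    powerWord (l ++ l') e = powerWord l e ++ powerWord l' e := by simp [powerWord]

theorem prod_map_powerWord {ι R : Type*} [Monoid R] (l : List ι) (e : ι → ℕ) (y : ι → R) :
    ((powerWord l e).map y).prod = (l.map fun q => y q ^ e q).prod := by
  induction l with
  | nil => simp [powerWord]
  | cons q l ih =>
    rw [powerWord, List.flatMap_cons, List.map_append, List.prod_append, ← powerWord, ih]
    simp

theorem mem_of_mem_powerWord {ι : Type*} {l : List ι} {e : ι → ℕ} {q : ι}
    (h : q ∈ powerWord l e) : q ∈ l := by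
  simp only [powerWord, List.mem_flatMap, List.mem_replicate] at h
  obtain ⟨p, hp, -, rfl⟩ := h
  exact hp

theorem IsModel.xpow_wordVec_append [CharZero K] (H : IsModel (diffSigma K n M) u X D)
    (hv : ∀ i α f, X i α (u f v) = 0) (hr : ∀ i j, r i j → r j i → i = j)
    (w : List (Fin n × Fin M)) (q : Fin n × Fin M)
    (hw : (w ++ [q]).Pairwise fun p p' => r p.1 p'.1) (hq : q ∉ w) (a : ℕ) {f : Ubar K n}
    (hf : f ≠ 0) : ∃ f' ≠ 0, (X q.1 q.2 ^ a) (wordVec u D v (w ++ List.replicate a q) f) =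
      wordVec u D v w f' := by
  induction a generalizing f with
  | zero => exact ⟨f, hf, by simp⟩
  | succ a ih =>
    obtain ⟨f₁, hf₁, h₁⟩ := H.x_wordVec_append hv hr w q hw hq a hf
    obtain ⟨f₂, hf₂, h₂⟩ := ih hf₁
    exact ⟨f₂, hf₂, by rw [pow_succ, Module.End.mul_apply, h₁, h₂]⟩

theorem IsModel.xpow_wordVec_append_of_lt [CharZero K] (H : IsModel (diffSigma K n M) u X D)
    (hv : ∀ i α f, X i α (u f v) = 0) (hr : ∀ i j, r i j → r j i → i = j)
    (w : List (Fin n × Fin M)) (q : Fin n × Fin M)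
    (hw : (w ++ [q]).Pairwise fun p p' => r p.1 p'.1) (hq : q ∉ w) {a b : ℕ} (hab : a < b)
    (f : Ubar K n) (hf : f ≠ 0) :
    (X q.1 q.2 ^ b) (wordVec u D v (w ++ List.replicate a q) f) = 0 := by
  obtain ⟨c, rfl⟩ := Nat.exists_eq_add_of_lt hab
  obtain ⟨f', -, h⟩ := H.xpow_wordVec_append hv hr w q hw hq a hf
  rw [show a + c + 1 = (c + 1) + a by omega, pow_add, Module.End.mul_apply, h, pow_succ,
    Module.End.mul_apply, H.x_wordVec_of_notMem hv hr w q hw hq, map_zero]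

theorem pairwise_powerWord_append {ι : Type*} {R : ι → ι → Prop} (l : List ι) (q : ι) (e : ι → ℕ)
    (hl : (l ++ [q]).Pairwise R) (hrefl : ∀ p, R p p) : (powerWord l e ++ [q]).Pairwise R := by
  induction l with
  | nil => simp [powerWord]
  | cons p l ih =>
    rw [List.cons_append, List.pairwise_cons] at hl
    rw [powerWord, List.flatMap_cons, List.append_assoc, List.pairwise_append]
    refine ⟨List.pairwise_replicate.2 (Or.inr (hrefl p)), ih hl.2, fun x hx y hy => ?_⟩
    rw [List.eq_of_mem_replicate hx]
    refine hl.1 y ?_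
    rcases List.mem_append.1 hy with h | h
    · exact List.mem_append_left _ (mem_of_mem_powerWord h)
    · exact List.mem_append_right _ h

/-- The exponents along a list, the last one first. -/
def colexKey {ι : Type*} (l : List ι) (e : ι → ℕ) : List ℕ := l.reverse.map e

/-- The last generator `q` of the list acts first and its derivative stands next to the vacuum.
Equal powers of `q` cancel to a nonzero coefficient and an excess of the coordinate gives zero, so
induction compares exponents from the last one backwards, which is the order of `colexKey`. -/
theorem IsModel.xMonomial_wordVec [CharZero K] (H : IsModel (diffSigma K n M) u X D)
    (hv : ∀ i α f, X i α (u f v) = 0) (hr : ∀ i j, r i j → r j i → i = j) (hrefl : ∀ i, r i i)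
    (l : List (Fin n × Fin M)) (hl : l.Pairwise fun p p' => r p.1 p'.1) (hnd : l.Nodup)
    (e : Fin n × Fin M → ℕ) {f : Ubar K n} (hf : f ≠ 0) :
    (∃ f' ≠ 0, (l.map fun q => X q.1 q.2 ^ e q).prod (wordVec u D v (powerWord l e) f) = u f' v) ∧
    ∀ e', colexKey l e < colexKey l e' →
      (l.map fun q => X q.1 q.2 ^ e' q).prod (wordVec u D v (powerWord l e) f) = 0 := by
  induction l using List.reverseRecOn generalizing f with
  | nil => exact ⟨⟨f, hf, by simp [powerWord]⟩, fun e' h => by simp [colexKey] at h⟩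
  | append_singleton l q ih =>
    have ih := @ih (List.pairwise_append.1 hl).1 (List.nodup_append.1 hnd).1
    have hpw : (powerWord l e ++ [q]).Pairwise fun p p' => r p.1 p'.1 :=
      pairwise_powerWord_append l q e hl fun p => hrefl _
    have hq : q ∉ powerWord l e := fun h => by
      have := (List.nodup_append.1 hnd).2.2 q (mem_of_mem_powerWord h) q (by simp)
      exact this rfl
    obtain ⟨f₁, hf₁, h₁⟩ := H.xpow_wordVec_append hv hr (powerWord l e) q hpw hq (e q) hf
    have hw : powerWord (l ++ [q]) e = powerWord l e ++ List.replicate (e q) q := by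
      rw [powerWord_append]; simp [powerWord]
    simp only [hw, List.map_append, List.prod_append, List.map_cons, List.map_nil,
      List.prod_singleton, Module.End.mul_apply]
    refine ⟨?_, fun e' h => ?_⟩
    · rw [h₁]
      exact (ih hf₁).1
    · simp only [colexKey, List.reverse_append, List.reverse_singleton,
        List.map_cons, List.singleton_append, List.cons_lt_cons_iff] at h
      rcases h with h | ⟨h, h'⟩
      · rw [H.xpow_wordVec_append_of_lt hv hr _ q hpw hq h f hf, map_zero]
      · rw [← h, h₁]
        exact (ih hf₁).2 e' h'

end Words
end
end HDeformed


namespace HDeformed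

noncomputable section

open Finset

theorem hdiff_comm {K : Type*} [Field K] {n : ℕ} (i j : Fin n) : hdiff K i j = -hdiff K j i := by
  simp [hdiff]

/-! ### Solving the exchange relations of the operators for the other order. -/

section Exchange

variable {F V : Type*} [Field F] [AddCommGroup V] [Module F V] {w : F}

/-- The operator relation determines the product in one order only; this and the next three
statements recover the defining relations for `i < j` and `i > j`. The versions with maps are for
derivatives, where the scalar stands inside the argument. -/
theorem exchange_left (hw : w ≠ 0) (hw' : w ^ 2 - 1 ≠ 0) {p q r : V}
    (h : r = (w ^ 2 / (w ^ 2 - 1)) • (p + w⁻¹ • q)) :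
    p = ((w ^ 2 - 1) * (w ^ 2)⁻¹) • r + (-w)⁻¹ • q := by
  subst h
  match_scalars <;> field_simp
  ring

theorem exchange_right (hw : w ≠ 0) (hw' : w ^ 2 - 1 ≠ 0) {p q r r' : V}
    (h : r = (w ^ 2 / (w ^ 2 - 1)) • (p + w⁻¹ • q))
    (h' : r' = (w ^ 2 / (w ^ 2 - 1)) • (q + w⁻¹ • p)) : r = p + w⁻¹ • r' := by
  subst h h'
  match_scalars <;> field_simp
  ring

theorem exchange_map_left (hw : w ≠ 0) (hw' : w ^ 2 - 1 ≠ 0) {a e g : V →+ V}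
    (h : ∀ v, a v = e ((w ^ 2 / (w ^ 2 - 1)) • v) + g ((w / (w ^ 2 - 1)) • v)) (v : V) :
    e v = a (((w ^ 2 - 1) * (w ^ 2)⁻¹) • v) + g ((-w)⁻¹ • v) := by
  rw [h, add_assoc, ← map_add g, smul_smul, smul_smul, ← add_smul,
    show w ^ 2 / (w ^ 2 - 1) * ((w ^ 2 - 1) * (w ^ 2)⁻¹) = 1 by field_simp,
    show w / (w ^ 2 - 1) * ((w ^ 2 - 1) * (w ^ 2)⁻¹) + (-w)⁻¹ = 0 by field_simp; ring]
  simp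

theorem exchange_map_right (hw : w ≠ 0) (hw' : w ^ 2 - 1 ≠ 0) {a b e g : V →+ V}
    (h : ∀ v, e v = a ((w ^ 2 / (w ^ 2 - 1)) • v) + b ((w / (w ^ 2 - 1)) • v))
    (h' : ∀ v, g v = b ((w ^ 2 / (w ^ 2 - 1)) • v) + a ((w / (w ^ 2 - 1)) • v)) (v : V) :
    e v = a v + g (w⁻¹ • v) := by
  rw [h, h', add_comm (b _), ← add_assoc, ← map_add a, smul_smul, smul_smul,
    show w ^ 2 / (w ^ 2 - 1) * w⁻¹ = w / (w ^ 2 - 1) by field_simp,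
    show v + (w / (w ^ 2 - 1) * w⁻¹) • v = (w ^ 2 / (w ^ 2 - 1)) • v by
      match_scalars; field_simp; ring]

end Exchange

/-! ### The Fock representation of `Diff_h(n, M)`. -/

section Fock

variable {K F : Type*} [Field K] [Field F] [Algebra K F] {n M : ℕ}

/-- The action of `Ū(n)` on the Fock space. -/
def coeffOp (t : Ubar K n →ₐ[K] F) (M : ℕ) :
    Ubar K n →ₐ[K] Module.End K (MvPolynomial (ℕ × Fin M) F) :=
  (Algebra.lsmul K K (MvPolynomial (ℕ × Fin M) F)).comp t

theorem coeffOp_apply (t : Ubar K n →ₐ[K] F) (a : Ubar K n) (v : MvPolynomial (ℕ × Fin M) F) :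
    coeffOp t M a v = t a • v := rfl

variable {h : ℕ → F} {s : ℕ → F ≃ₐ[K] F} {t : Ubar K n →ₐ[K] F}

/-- The vacuum is the constant `1`: every term of `up` first applies a derivative. -/
theorem xop_smul_one (i : ℕ) (α : Fin M) (a : F) :
    xop h s i α (a • (1 : MvPolynomial (ℕ × Fin M) F)) = 0 := by
  rw [xop_smul, xop_apply, map_one]
  simp [up, LinearMap.sum_apply, yop_apply, Module.End.mul_apply]

theorem map_inverse_hdiff (ht : ∀ i, t (hgen K i) = h i) {i j : Fin n} (hij : i ≠ j) :
    t (Ring.inverse (hdiff K i j)) = (h i - h j)⁻¹ := by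
  have e := congrArg t (Ring.mul_inverse_cancel _ (isUnit_hdiff K hij))
  rw [map_mul, map_one, hdiff, map_sub, ht, ht] at e
  exact eq_inv_of_mul_eq_one_right e

theorem map_Rflip_of_lt (ht : ∀ i, t (hgen K i) = h i) {i j : Fin n} (hij : i < j) :
    t (Rflip K i j) = ((h i - h j) ^ 2 - 1) * ((h i - h j) ^ 2)⁻¹ := by
  rw [Rflip_of_lt K hij, ← Ring.inverse_pow, map_mul, map_sub, map_pow, map_pow, map_one,
    map_inverse_hdiff ht hij.ne, inv_pow, hdiff, map_sub, ht, ht]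

theorem IsShiftSystem.sq_sub_one_ne (H : IsShiftSystem K h s) {i j : ℕ} (hij : i ≠ j) :
    (h i - h j) ^ 2 - 1 ≠ 0 := by
  convert mul_ne_zero (H.sub_add_one_ne hij) (H.sub_sub_one_ne hij) using 1
  ring

variable [CharZero F] (H : IsShiftSystem K h s) (ht : ∀ i : Fin n, t (hgen K i) = h i)
include H ht

theorem xop_exchange (i j : Fin n) (α β : Fin M) (v : MvPolynomial (ℕ × Fin M) (F)) :
    xop h s i α (xop h s j β v) =
      t (Rflip K i j) • xop h s j β (xop h s i α v) +
      if i = j then 0 else t (Ring.inverse (hdiff K i j)) •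
        xop h s i β (xop h s j α v) := by
  rcases lt_trichotomy i j with hij | rfl | hij
  · rw [map_Rflip_of_lt ht hij, if_neg hij.ne, map_inverse_hdiff ht hij.ne,
      ← neg_sub (h j) (h i), neg_sq]
    exact exchange_left (H.sub_ne (Fin.val_ne_of_ne hij.ne')) (H.sq_sub_one_ne (Fin.val_ne_of_ne hij.ne'))
      (H.xop_xop_of_lt hij α β v)
  · rw [Rflip_of_le K le_rfl, if_pos rfl, map_one, one_smul, add_zero, H.xop_xop_self]
  · rw [Rflip_of_le K hij.le, if_neg hij.ne', map_one, one_smul, map_inverse_hdiff ht hij.ne']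
    exact exchange_right (H.sub_ne (Fin.val_ne_of_ne hij.ne')) (H.sq_sub_one_ne (Fin.val_ne_of_ne hij.ne'))
      (H.xop_xop_of_lt hij β α v) (H.xop_xop_of_lt hij α β v)

theorem dop_exchange (l k : Fin n) (α β : Fin M) (v : MvPolynomial (ℕ × Fin M) (F)) :
    dop h s n l α (dop h s n k β v) =
      dop h s n k β (dop h s n l α
        (t (Rflip K l k) • v)) +
      if k = l then 0 else dop h s n l β (dop h s n k α
        (t (Ring.inverse (hdiff K k l)) • v)) := by
  let P := MvPolynomial (ℕ × Fin M) (F)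
  let f : Fin n → Fin M → Fin n → Fin M → P →+ P := fun l α k β =>
    (dop h s n l α ∘ₗ dop h s n k β).toAddMonoidHom
  rcases lt_trichotomy l k with hij | rfl | hij
  · rw [map_Rflip_of_lt ht hij, if_neg hij.ne', map_inverse_hdiff ht hij.ne',
      ← neg_sub (h l) (h k)]
    exact exchange_map_left (a := f k β l α) (e := f l α k β) (g := f l β k α)
      (H.sub_ne (Fin.val_ne_of_ne hij.ne)) (H.sq_sub_one_ne (Fin.val_ne_of_ne hij.ne)) (H.dop_dop_of_lt hij k.2 α β) v
  · rw [Rflip_of_le K le_rfl, if_pos rfl, map_one, one_smul, add_zero, H.dop_dop_self]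
  · rw [Rflip_of_le K hij.le, if_neg hij.ne, map_one, one_smul, map_inverse_hdiff ht hij.ne]
    exact exchange_map_right (a := f k β l α) (b := f k α l β) (e := f l α k β) (g := f l β k α)
      (H.sub_ne (Fin.val_ne_of_ne hij.ne)) (H.sq_sub_one_ne (Fin.val_ne_of_ne hij.ne)) (H.dop_dop_of_lt hij l.2 β α)
      (H.dop_dop_of_lt hij l.2 α β) v

variable (M) in
theorem fockModel : IsModel (diffSigma K n M) (coeffOp t M)
    (fun i α => xop h s i α) (fun j β => dop h s n j β) where
  weight_x i j α := by
    refine LinearMap.ext fun v => ?_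
    rw [Module.End.mul_apply, Module.End.mul_apply, coeffOp_apply, coeffOp_apply, xop_smul,
      map_add t, ht]
    congr 1
    by_cases hij : i = j
    · subst hij; simp [H.map_self]
    · simp [hij, H.map_ne j i fun h => hij (Fin.ext h).symm]
  weight_d i j β := by
    refine LinearMap.ext fun v => ?_
    rw [Module.End.mul_apply, Module.End.mul_apply, coeffOp_apply, coeffOp_apply, dop_smul,
      map_sub t, ht]
    congr 1
    rw [AlgEquiv.eq_symm_apply]
    by_cases hij : i = j
    · subst hij; simp [H.map_self]
    · simp [hij, H.map_ne j i fun h => hij (Fin.ext h).symm]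
  x_x i j α β := by
    refine LinearMap.ext fun v => ?_
    have h := xop_exchange H ht i j α β v
    split_ifs at h ⊢ <;> exact h
  d_d l k α β := by
    refine LinearMap.ext fun v => ?_
    have h := dop_exchange H ht l k α β v
    split_ifs at h ⊢ <;> exact h
  x_d i j α β hij := by
    refine LinearMap.ext fun v => ?_
    rw [Module.End.mul_apply, Module.End.mul_apply, Module.End.mul_apply, coeffOp_apply]
    rcases lt_or_gt_of_ne hij with hij | hij
    · rw [H.xop_dop_of_lt (show (i : ℕ) < j from hij), Rflip_of_le K hij.le, map_one, one_smul]
    · rw [H.xop_dop_of_gt (show (j : ℕ) < i from hij) i.2, map_Rflip_of_lt ht hij,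
        ← neg_sub (h i) (h j), neg_sq, div_eq_mul_inv]
  x_d_self i α β := by
    refine LinearMap.ext fun v => ?_
    rw [Module.End.mul_apply, LinearMap.sub_apply, LinearMap.sum_apply, H.xop_dop_self i.2,
      Finset.sum_range]
    congr 1
    · refine sum_congr rfl fun k _ => ?_
      rw [Module.End.mul_apply, Module.End.mul_apply, coeffOp_apply]
      congr 2
      by_cases hk : k = i
      · subst hk; simp
      · rw [if_neg hk, if_neg fun h => hk (Fin.ext h), map_inverse_hdiff ht hk]
    · rw [coeffOp_apply, diffSigma]
      split_ifs <;> simp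

end Fock
end
end HDeformed


namespace HDeformed

noncomputable section

open Finset

/-! ### The orders of coordinates and derivatives. -/

section Order

variable {n N' N : ℕ}

/-- The order of the coordinates. -/
def coordOrder (n N' : ℕ) : List (Fin n × Fin N') :=
  (List.finRange n).flatMap fun i => (List.finRange N').map fun α => (i, α)

/-- The order of the derivatives. -/
def derivOrder (n N : ℕ) : List (Fin n × Fin N) :=
  (List.finRange n).reverse.flatMap fun i => (List.finRange N).map fun α => (i, α)

theorem genOrder_eq : genOrder n N' N =
    (derivOrder n N).map Sum.inl ++ (coordOrder n N').map Sum.inr := by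
  simp [genOrder, coordOrder, derivOrder, List.map_flatMap, Function.comp_def]

theorem mem_coordOrder (q : Fin n × Fin N') : q ∈ coordOrder n N' := by
  simp only [coordOrder, List.mem_flatMap, List.mem_map]
  exact ⟨q.1, List.mem_finRange _, q.2, List.mem_finRange _, rfl⟩

theorem mem_derivOrder (q : Fin n × Fin N) : q ∈ derivOrder n N := by
  simp only [derivOrder, List.mem_flatMap, List.mem_map, List.mem_reverse]
  exact ⟨q.1, List.mem_finRange _, q.2, List.mem_finRange _, rfl⟩

theorem pairwise_coordOrder :
    (coordOrder n N').Pairwise fun p q => p.1 < q.1 ∨ p.1 = q.1 ∧ p.2 < q.2 := by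
  rw [coordOrder, List.pairwise_flatMap]
  refine ⟨fun i _ => ?_, (List.pairwise_lt_finRange n).imp fun h x hx y hy => ?_⟩
  · rw [List.pairwise_map]
    exact (List.pairwise_lt_finRange N').imp fun h => Or.inr ⟨rfl, h⟩
  · obtain ⟨_, -, rfl⟩ := List.mem_map.1 hx
    obtain ⟨_, -, rfl⟩ := List.mem_map.1 hy
    exact Or.inl h

theorem pairwise_derivOrder :
    (derivOrder n N).Pairwise fun p q => q.1 < p.1 ∨ p.1 = q.1 ∧ p.2 < q.2 := by
  rw [derivOrder, List.pairwise_flatMap]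
  refine ⟨fun i _ => ?_, (List.pairwise_reverse.2 (List.pairwise_lt_finRange n)).imp
    fun h x hx y hy => ?_⟩
  · rw [List.pairwise_map]
    exact (List.pairwise_lt_finRange N).imp fun h => Or.inr ⟨rfl, h⟩
  · obtain ⟨_, -, rfl⟩ := List.mem_map.1 hx
    obtain ⟨_, -, rfl⟩ := List.mem_map.1 hy
    exact Or.inl h

theorem nodup_coordOrder : (coordOrder n N').Nodup :=
  pairwise_coordOrder.imp fun h e => by subst e; simp at h

theorem nodup_derivOrder : (derivOrder n N).Nodup :=
  pairwise_derivOrder.imp fun h e => by subst e; simp at h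

theorem colexKey_injective {ι : Type*} {l : List ι} (hl : ∀ q, q ∈ l) :
    Function.Injective (colexKey l) := fun _ _ h =>
  funext fun q => List.map_inj_left.1 h q (List.mem_reverse.2 (hl q))

end Order

/-! ### Linear independence of ordered monomials from dual operators. -/

section Independence

variable {K : Type*} [Field K] {n N' N : ℕ} {V : Type*} [AddCommGroup V] [Module K V]
  {σ : Fin n → Fin N' → Fin N → Ubar K n} {u : Ubar K n →ₐ[K] Module.End K V}
  {X D₁ : Fin n → Fin N' → Module.End K V} {D X₂ : Fin n → Fin N → Module.End K V} {v : V}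

/-- The ordered monomials. -/
def pbwMonomial (σ : Fin n → Fin N' → Fin N → Ubar K n)
    (e : Fin n × Fin N ⊕ Fin n × Fin N' → ℕ) : PairingRing σ :=
  ((genOrder n N' N).map fun k =>
    (Sum.elim (fun p => dgen σ p.1 p.2) fun p => xgen σ p.1 p.2) k ^ e k).prod

theorem pbwMonomial_eq (e : Fin n × Fin N ⊕ Fin n × Fin N' → ℕ) : pbwMonomial σ e =
    ((derivOrder n N).map fun p => dgen σ p.1 p.2 ^ e (.inl p)).prod *
      ((coordOrder n N').map fun p => xgen σ p.1 p.2 ^ e (.inr p)).prod := by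
  simp [pbwMonomial, genOrder_eq, Function.comp_def]

theorem IsModel.exists_xMonomial_coeff {M' M : ℕ} {B : Type*} [Ring B] [Algebra K B]
    {τ : Fin n → Fin M' → Fin M → Ubar K n} {u : Ubar K n →ₐ[K] B} {X : Fin n → Fin M' → B}
    {D : Fin n → Fin M → B} (H : IsModel τ u X D) (l : List (Fin n × Fin M'))
    (e : Fin n × Fin M' → ℕ) : ∃ m, ∀ a, (l.map fun p => X p.1 p.2 ^ e p).prod * u a =
      u (ubarShift m a) * (l.map fun p => X p.1 p.2 ^ e p).prod := by
  rw [← prod_map_powerWord l e fun p => X p.1 p.2]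
  induction powerWord l e with
  | nil => exact ⟨0, fun a => by simp [ubarShift_zero]⟩
  | cons p w ih =>
    obtain ⟨m, hm⟩ := ih
    refine ⟨-wt p.1 + m, fun a => ?_⟩
    rw [List.map_cons, List.prod_cons, mul_assoc, hm, ← mul_assoc, H.x_coeff, mul_assoc,
      ← ubarShift_comp, AlgHom.comp_apply]

theorem smul_eq_coeff_mul (a : Ubar K n) (y : PairingRing σ) : a • y = coeff σ a * y := rfl

instance [CharZero K] : IsDomain (Ubar K n) :=
  toRatFun_injective.isDomain (toRatFun K n)

variable [CharZero K]

/-- `D₁` is dual to `X`, and `X₂` is dual to `D`. In a linear relation pick the smallest coordinate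
exponent `e₀` and apply everything to the word in `D₁` with that exponent: larger coordinate
exponents give zero, equal ones a nonzero multiple of the vacuum. Among the latter let `e₁` have the
largest derivative exponent; the corresponding monomial in `X₂` kills every other remaining term. -/
theorem IsModel.linearIndependent_pbwMonomial (H : IsModel σ u X D)
    (H₁ : IsModel (diffSigma K n N') u X D₁) (h₁ : ∀ i α f, X i α (u f v) = 0)
    (H₂ : IsModel (diffSigma K n N) u X₂ D) (h₂ : ∀ i β f, X₂ i β (u f v) = 0)
    (hu : ∀ f, u f v = 0 → f = 0) : LinearIndependent (Ubar K n) (pbwMonomial σ) := by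
  classical
  rw [linearIndependent_iff']
  intro S g hg e he
  by_contra hne
  set kx : (Fin n × Fin N ⊕ Fin n × Fin N' → ℕ) → List ℕ :=
    fun e => colexKey (coordOrder n N') (e ∘ Sum.inr) with hkx
  set kd : (Fin n × Fin N ⊕ Fin n × Fin N' → ℕ) → List ℕ :=
    fun e => colexKey (derivOrder n N) (e ∘ Sum.inl) with hkd
  have hle : ∀ i j : Fin n, i ≤ j → j ≤ i → i = j := fun _ _ => le_antisymm
  have hge : ∀ i j : Fin n, j ≤ i → i ≤ j → i = j := fun _ _ h h' => le_antisymm h' h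
  have hpx : (coordOrder n N').Pairwise fun p q => p.1 ≤ q.1 :=
    pairwise_coordOrder.imp fun h => h.elim le_of_lt fun h => h.1.le
  have hpd : (derivOrder n N).Pairwise fun p q => q.1 ≤ p.1 :=
    pairwise_derivOrder.imp fun h => h.elim le_of_lt fun h => h.1.ge
  obtain ⟨e₀, he₀, hmin⟩ := (S.filter fun e => g e ≠ 0).exists_min_image kx
    ⟨e, mem_filter.2 ⟨he, hne⟩⟩
  obtain ⟨⟨f, hf, hfX⟩, hX⟩ := H₁.xMonomial_wordVec (r := (· ≤ ·)) h₁ hle le_refl _ hpx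
    nodup_coordOrder (e₀ ∘ Sum.inr) (f := 1) one_ne_zero
  obtain ⟨e₁, he₁, hmax⟩ := ((S.filter fun e => g e ≠ 0).filter fun e => kx e = kx e₀).exists_max_image
    kd ⟨e₀, mem_filter.2 ⟨he₀, rfl⟩⟩
  obtain ⟨m, hm⟩ := H₂.exists_xMonomial_coeff (derivOrder n N) (e₁ ∘ Sum.inl)
  -- the functional that detects the coefficient of `e₁`
  let φ : Module.End K V → V := fun y =>
    ((derivOrder n N).map fun q => X₂ q.1 q.2 ^ (e₁ ∘ Sum.inl) q).prod
      (y (wordVec u D₁ v (powerWord (coordOrder n N') (e₀ ∘ Sum.inr)) 1))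
  have hφ : ∀ e ∈ S, g e ≠ 0 → e ≠ e₁ → φ (H.lift (g e • pbwMonomial σ e)) = 0 := by
    intro e he hge' hee
    have heS := (mem_filter (p := fun e => g e ≠ 0)).2 ⟨he, hge'⟩
    simp only [φ, smul_eq_coeff_mul, pbwMonomial_eq, map_mul, map_list_prod, List.map_map,
      Function.comp_def, map_pow, H.lift_coeff, H.lift_dgen, H.lift_xgen, Module.End.mul_apply]
    rcases (hmin e heS).lt_or_eq with h | h
    · have := hX _ h
      simp only [Function.comp_def] at this
      rw [this, map_zero, map_zero, map_zero]
    · have h' := hmax e (mem_filter.2 ⟨heS, h.symm⟩)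
      have hinr : e ∘ Sum.inr = e₀ ∘ Sum.inr := (colexKey_injective mem_coordOrder h).symm
      have hinr' : e₁ ∘ Sum.inr = e₀ ∘ Sum.inr :=
        colexKey_injective mem_coordOrder (mem_filter.1 he₁).2
      have hlt : kd e < kd e₁ := by
        refine lt_of_le_of_ne h' fun h'' => hee ?_
        have hinl := colexKey_injective mem_derivOrder h''
        funext k
        cases k with
        | inl p => exact congrFun hinl p
        | inr p => exact (congrFun hinr p).trans (congrFun hinr' p).symm
      have hfX' := hfX
      rw [← hinr] at hfX'
      simp only [Function.comp_def] at hfX' hm hinr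
      rw [← hinr]
      rw [hfX', ← Module.End.mul_apply, hm, Module.End.mul_apply]
      have := (H₂.xMonomial_wordVec (r := (· ≥ ·)) h₂ hge (fun _ => le_rfl) _ hpd nodup_derivOrder
        (e ∘ Sum.inl) hf).2 (e₁ ∘ Sum.inl) hlt
      rw [wordVec, prod_map_powerWord] at this
      simp only [Function.comp_def] at this
      rw [this, map_zero]
  have h0 : φ (H.lift (∑ e ∈ S, g e • pbwMonomial σ e)) = 0 := by
    rw [hg]; simp [φ]
  have hsum : φ (H.lift (∑ e ∈ S, g e • pbwMonomial σ e)) =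
      ∑ e ∈ S, φ (H.lift (g e • pbwMonomial σ e)) := by
    simp only [φ, map_sum, LinearMap.sum_apply]
  have he₁' := mem_filter.1 (mem_filter.1 he₁).1
  rw [hsum, sum_eq_single e₁ (fun e he hee => ?_) fun h => absurd he₁'.1 h] at h0
  · obtain ⟨f', hf', hfD⟩ := (H₂.xMonomial_wordVec (r := (· ≥ ·)) h₂ hge (fun _ => le_rfl) _ hpd
      nodup_derivOrder (e₁ ∘ Sum.inl) hf).1
    have hinr' : e₁ ∘ Sum.inr = e₀ ∘ Sum.inr :=
      colexKey_injective mem_coordOrder (mem_filter.1 he₁).2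
    rw [← hinr'] at hfX
    simp only [Function.comp_def] at hinr' hfX
    simp only [φ, smul_eq_coeff_mul, pbwMonomial_eq, map_mul, map_list_prod, List.map_map,
      Function.comp_def, map_pow, H.lift_coeff, H.lift_dgen, H.lift_xgen, Module.End.mul_apply] at h0
    rw [wordVec, prod_map_powerWord] at hfD
    simp only [Function.comp_def] at hm hfD
    rw [← hinr'] at h0
    rw [hfX, ← Module.End.mul_apply, hm, Module.End.mul_apply, hfD, ← Module.End.mul_apply,
      ← map_mul] at h0
    have := hu _ h0
    rcases mul_eq_zero.1 this with h | h
    · exact he₁'.2 (ubarShift_injective m (by rw [h, map_zero]))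
    · exact hf' h
  · by_cases h : g e = 0
    · simp [h, φ]
    · exact hφ e he h hee

end Independence
end
end HDeformed


namespace HDeformed

noncomputable section

open Finset

/-! ### Independence for constant zero-order terms. -/

section Constant

variable {K : Type*} [Field K] {n N' N : ℕ}

theorem sum_smul_diffSigma {M : ℕ} (a b : Fin M → K) (i : Fin n) :
    ∑ κ, ∑ κ', (a κ * b κ') • diffSigma K n M i κ κ' = algebraMap K _ (a ⬝ᵥ b) := by
  simp [diffSigma, dotProduct, Algebra.smul_def]

theorem linearIndependent_pbwMonomial [CharZero K] {σ : Fin n → Fin N' → Fin N → Ubar K n}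
    {c : Fin N' → Fin N → K} (hc : ∀ i α β, σ i α β = algebraMap K _ (c α β)) :
    LinearIndependent (Ubar K n) (pbwMonomial σ) := by
  have H := fockModel (N + N') (isShiftSystem (K := K)) (t := toRatFun K n) toRatFun_hgen
  -- In blocks, `A = (c | 1)`, `B = (1 | 0)` and `B' = (0 | 1)`, so that `A Bᵀ = c`, `A B'ᵀ = 1` and
  -- `B Bᵀ = 1`. The `N'` extra copies provide duals of the coordinates even when `c` is degenerate.
  let A : Matrix (Fin N') (Fin (N + N')) K := fun α => Fin.append (c α) (Pi.single α 1)
  let B : Matrix (Fin N) (Fin (N + N')) K := fun β => Pi.single (Fin.castAdd N' β) 1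
  let B' : Matrix (Fin N') (Fin (N + N')) K := fun α => Pi.single (Fin.natAdd N α) 1
  have hv : ∀ (i : Fin n) κ f, xop (hvar K) (hshift K) i κ
      (coeffOp (toRatFun K n) (N + N') f (1 : MvPolynomial (ℕ × Fin (N + N')) (RatFun K))) = 0 :=
    fun i κ f => xop_smul_one i κ _
  refine (H.linearCombination A B fun i α β => ?_).linearIndependent_pbwMonomial (v := 1)
    (H.linearCombination (σ := diffSigma K n N') A B' fun i α β => ?_) ?_
    (H.linearCombination (σ := diffSigma K n N) B B fun i α β => ?_) ?_ fun f hf => ?_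
  · rw [sum_smul_diffSigma, hc]
    simp [A, B]
  · rw [sum_smul_diffSigma]
    simp [A, B', diffSigma, Pi.single_apply, eq_comm]
  · intro i α f
    simp only [LinearMap.sum_apply, LinearMap.smul_apply, hv, smul_zero, sum_const_zero]
  · rw [sum_smul_diffSigma]
    simp [B, diffSigma, Pi.single_apply, eq_comm]
  · intro i α f
    simp only [LinearMap.sum_apply, LinearMap.smul_apply, hv, smul_zero, sum_const_zero]
  · rw [coeffOp_apply, smul_eq_zero] at hf
    exact toRatFun_injective (by simpa using hf)

end Constant
end
end HDeformed


namespace HDeformed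

noncomputable section

open Finset

/-! ### Straightening of words. -/

section Spanning

variable {n N' N : ℕ}

/-- The strict order of the generators. -/
def GenLt : Fin n × Fin N ⊕ Fin n × Fin N' → Fin n × Fin N ⊕ Fin n × Fin N' → Prop
  | .inl p, .inl q => q.1 < p.1 ∨ p.1 = q.1 ∧ p.2 < q.2
  | .inl _, .inr _ => True
  | .inr _, .inl _ => False
  | .inr p, .inr q => p.1 < q.1 ∨ p.1 = q.1 ∧ p.2 < q.2

theorem genLt_irrefl (p : Fin n × Fin N ⊕ Fin n × Fin N') : ¬ GenLt p p := by
  cases p <;> simp [GenLt]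

theorem genLt_trans {p q s : Fin n × Fin N ⊕ Fin n × Fin N'} (h : GenLt p q) (h' : GenLt q s) :
    GenLt p s := by
  rcases p with p | p <;> rcases q with q | q <;> rcases s with s | s <;>
    simp only [GenLt] at h h' ⊢ <;> omega

theorem genLt_trichotomy (p q : Fin n × Fin N ⊕ Fin n × Fin N') :
    GenLt p q ∨ p = q ∨ GenLt q p := by
  rcases p with p | p <;> rcases q with q | q <;>
    simp only [GenLt, Sum.inl.injEq, Sum.inr.injEq, Prod.ext_iff, true_or, or_true] <;> omega

theorem wellFounded_genLt : WellFounded (GenLt (n := n) (N' := N') (N := N)) :=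
  haveI : IsTrans _ (GenLt (n := n) (N' := N') (N := N)) := ⟨fun _ _ _ => genLt_trans⟩
  haveI : Std.Irrefl (GenLt (n := n) (N' := N') (N := N)) := ⟨genLt_irrefl⟩
  Finite.wellFounded_of_trans_of_irrefl _

theorem pairwise_genOrder : (genOrder n N' N).Pairwise GenLt := by
  rw [genOrder_eq, List.pairwise_append, List.pairwise_map, List.pairwise_map]
  refine ⟨pairwise_derivOrder.imp fun h => h, pairwise_coordOrder.imp fun h => h, ?_⟩
  intro a ha b hb
  obtain ⟨_, -, rfl⟩ := List.mem_map.1 ha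
  obtain ⟨_, -, rfl⟩ := List.mem_map.1 hb
  trivial

theorem mem_genOrder (q : Fin n × Fin N ⊕ Fin n × Fin N') : q ∈ genOrder n N' N := by
  rw [genOrder_eq, List.mem_append]
  cases q with
  | inl q => exact Or.inl (List.mem_map_of_mem (mem_derivOrder q))
  | inr q => exact Or.inr (List.mem_map_of_mem (mem_coordOrder q))

theorem count_powerWord {ι : Type*} [DecidableEq ι] {l : List ι} (hl : l.Nodup) (e : ι → ℕ) {q : ι}
    (hq : q ∈ l) : (powerWord l e).count q = e q := by
  induction l with
  | nil => simp at hq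
  | cons p l ih =>
    rw [powerWord, List.flatMap_cons, ← powerWord, List.count_append]
    rw [List.nodup_cons] at hl
    rcases List.mem_cons.1 hq with rfl | h
    · rw [List.count_replicate_self, List.count_eq_zero.2 fun h => hl.1 (mem_of_mem_powerWord h),
        add_zero]
    · rw [ih hl.2 h, List.count_replicate, if_neg, zero_add]
      simpa using fun h' : p = q => hl.1 (h' ▸ h)

theorem pairwise_powerWord {ι : Type*} {R : ι → ι → Prop} (l : List ι) (e : ι → ℕ)
    (hl : l.Pairwise R) (hrefl : ∀ p, R p p) : (powerWord l e).Pairwise R := by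
  induction l with
  | nil => simp [powerWord]
  | cons p l ih =>
    rw [List.pairwise_cons] at hl
    rw [powerWord, List.flatMap_cons, List.pairwise_append]
    refine ⟨List.pairwise_replicate.2 (Or.inr (hrefl p)), ih hl.2, fun x hx y hy => ?_⟩
    rw [List.eq_of_mem_replicate hx]
    exact hl.1 y (mem_of_mem_powerWord hy)

theorem eq_powerWord_count {ι : Type*} [DecidableEq ι] {R : ι → ι → Prop} {l w : List ι}
    (hl : l.Nodup) (hmem : ∀ q, q ∈ l) (hlR : l.Pairwise R) (hrefl : ∀ p, R p p)
    (hanti : ∀ p q, R p q → R q p → p = q) (hw : w.Pairwise R) :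
    w = powerWord l fun q => w.count q :=
  List.Perm.eq_of_pairwise (fun a b _ _ => hanti a b) hw (pairwise_powerWord _ _ hlR hrefl)
    (List.perm_iff_count.2 fun q => (count_powerWord hl (fun q => w.count q) (hmem q)).symm)

theorem exists_powerWord_of_sorted {w : List (Fin n × Fin N ⊕ Fin n × Fin N')}
    (hw : w.Pairwise fun p q => ¬ GenLt q p) : ∃ e, w = powerWord (genOrder n N' N) e := by
  classical
  have hnd : (genOrder n N' N).Nodup := pairwise_genOrder.imp fun {a b} h (e : a = b) =>
    genLt_irrefl _ (e ▸ h)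
  exact ⟨_, eq_powerWord_count hnd
    mem_genOrder (pairwise_genOrder.imp fun h h' => genLt_irrefl _ (genLt_trans h h')) genLt_irrefl
    (fun p q h h' => ((genLt_trichotomy p q).resolve_left h').resolve_right h) hw⟩

variable {K : Type*} [Field K] (σ : Fin n → Fin N' → Fin N → Ubar K n)

/-- The generators other than the elements of `Ū(n)`. -/
def gen : Fin n × Fin N ⊕ Fin n × Fin N' → PairingRing σ :=
  Sum.elim (fun p => dgen σ p.1 p.2) (fun p => xgen σ p.1 p.2)

theorem gen_coeff (p : Fin n × Fin N ⊕ Fin n × Fin N') :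
    ∃ m, ∀ a, gen σ p * coeff σ a = coeff σ (ubarShift m a) * gen σ p := by
  cases p with
  | inl p => exact ⟨wt p.1, fun a => (isModel σ).d_coeff a p.1 p.2⟩
  | inr p => exact ⟨-wt p.1, fun a => (isModel σ).x_coeff a p.1 p.2⟩

theorem word_coeff (w : List (Fin n × Fin N ⊕ Fin n × Fin N')) :
    ∃ m, ∀ a, (w.map (gen σ)).prod * coeff σ a = coeff σ (ubarShift m a) * (w.map (gen σ)).prod := by
  induction w with
  | nil => exact ⟨0, fun a => by simp [ubarShift_zero]⟩
  | cons p w ih =>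
    obtain ⟨m, hm⟩ := ih
    obtain ⟨m', hm'⟩ := gen_coeff σ p
    refine ⟨m' + m, fun a => ?_⟩
    rw [List.map_cons, List.prod_cons, mul_assoc, hm, ← mul_assoc, hm', mul_assoc,
      ← ubarShift_comp, AlgHom.comp_apply]

/-- The combinations of the words that are smaller than words of length two starting with `p`. -/
def lowerSpan (p : Fin n × Fin N ⊕ Fin n × Fin N') : Submodule (Ubar K n) (PairingRing σ) :=
  Submodule.span _ ({1} ∪ {y | ∃ q q', GenLt q p ∧ y = gen σ q * gen σ q'})

variable {σ}

theorem gen_mul_gen_mem_lowerSpan {p q q' : Fin n × Fin N ⊕ Fin n × Fin N'} (h : GenLt q p) :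
    gen σ q * gen σ q' ∈ lowerSpan σ p :=
  Submodule.subset_span (Or.inr ⟨q, q', h, rfl⟩)

theorem coeff_mul_mem {S : Submodule (Ubar K n) (PairingRing σ)} {y : PairingRing σ} (a : Ubar K n)
    (h : y ∈ S) : coeff σ a * y ∈ S := S.smul_mem a h

theorem inverse_hdiff_comm {i j : Fin n} (hij : i ≠ j) :
    Ring.inverse (hdiff K i j) = -Ring.inverse (hdiff K j i) := by
  have h := Ring.mul_inverse_cancel _ (isUnit_hdiff K hij)
  have h' := Ring.mul_inverse_cancel _ (isUnit_hdiff K hij.symm)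
  rw [hdiff_comm i j] at h ⊢
  linear_combination -Ring.inverse (-hdiff K j i) * h' - Ring.inverse (hdiff K j i) * h

theorem Rflip_of_lt' {i j : Fin n} (hij : i < j) :
    Rflip K i j = 1 - Ring.inverse (hdiff K j i) * Ring.inverse (hdiff K j i) := by
  have h := Ring.mul_inverse_cancel _ (isUnit_hdiff K hij.ne')
  rw [Rflip_of_lt K hij, ← Ring.inverse_pow, inverse_hdiff_comm hij.ne, hdiff_comm i j]
  linear_combination (hdiff K j i * Ring.inverse (hdiff K j i) + 1) * h

/-- The defining relation still contains a wrongly ordered product with the copies exchanged. A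
second use of it eliminates that product at the price of the factor `1 - hⱼᵢ⁻²`, which is the unit
`Rflip K i j`. -/
theorem xgen_mul_xgen_of_gt {i j : Fin n} (hij : i < j) (α β : Fin N') :
    coeff σ (Rflip K i j) * (xgen σ j β * xgen σ i α) = xgen σ i α * xgen σ j β +
      coeff σ (Ring.inverse (hdiff K j i)) * (xgen σ i β * xgen σ j α) := by
  have h := (isModel σ).x_x j i β α
  have h' := (isModel σ).x_x j i α β
  rw [Rflip_of_le K hij.le, if_neg hij.ne', map_one, one_mul, mul_assoc] at h h'
  rw [Rflip_of_lt' hij, map_sub, map_one, map_mul, sub_mul, one_mul, mul_assoc]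
  nth_rw 1 [h]
  rw [h', mul_add, ← add_assoc, add_sub_cancel_right]

theorem dgen_mul_dgen_of_lt {i j : Fin n} (hij : i < j) (α β : Fin N) :
    dgen σ i α * dgen σ j β = dgen σ j β * dgen σ i α +
      dgen σ j α * dgen σ i β * coeff σ (Ring.inverse (hdiff K j i)) := by
  have h := (isModel σ).d_d i j α β
  have h' := (isModel σ).d_d i j β α
  rw [if_neg hij.ne'] at h h'
  have hu : IsUnit (coeff σ (Rflip K i j)) := (isUnit_Rflip i j).map (coeff σ)
  rw [← hu.mul_left_inj, add_mul, mul_assoc (dgen σ j α * dgen σ i β), ← map_mul,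
    mul_comm _ (Rflip K i j), map_mul, ← mul_assoc _ (coeff σ (Rflip K i j))]
  have e : dgen σ i α * dgen σ j β * coeff σ (Rflip K i j) = dgen σ i α * dgen σ j β -
      dgen σ i α * dgen σ j β * coeff σ (Ring.inverse (hdiff K j i)) *
        coeff σ (Ring.inverse (hdiff K j i)) := by
    rw [Rflip_of_lt' hij, map_sub, map_one, map_mul, mul_sub, mul_one, ← mul_assoc]
  rw [e, ← sub_eq_iff_eq_add'.2 h', sub_mul, ← sub_eq_iff_eq_add.2 h]
  abel

theorem gen_mul_gen_mem (p q : Fin n × Fin N ⊕ Fin n × Fin N') (h : GenLt q p) :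
    gen σ p * gen σ q ∈ lowerSpan σ p := by
  have hg : ∀ i β, dgen σ i β = gen σ (Sum.inl (i, β)) := fun _ _ => rfl
  have hg' : ∀ i α, xgen σ i α = gen σ (Sum.inr (i, α)) := fun _ _ => rfl
  rcases p with ⟨i, α⟩ | ⟨i, α⟩ <;> rcases q with ⟨j, β⟩ | ⟨j, β⟩
  · rcases h with h | ⟨rfl, h⟩
    · obtain ⟨m, hm⟩ := word_coeff σ [Sum.inl (j, α), Sum.inl (i, β)]
      simp only [List.map_cons, List.map_nil, List.prod_cons, List.prod_nil, mul_one] at hm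
      rw [← hg, ← hg, dgen_mul_dgen_of_lt h, hg, hg, hg, hg, hm]
      exact add_mem (gen_mul_gen_mem_lowerSpan (Or.inl h))
        (coeff_mul_mem _ (gen_mul_gen_mem_lowerSpan (Or.inl h)))
    · have e := (isModel σ).d_d j j α β
      rw [Rflip_of_le K le_rfl, if_pos rfl, map_one, mul_one, add_zero] at e
      rw [← hg, ← hg, e]
      exact gen_mul_gen_mem_lowerSpan (p := Sum.inl (j, α)) (q := Sum.inl (j, β))
        (q' := Sum.inl (j, α)) (Or.inr ⟨rfl, h⟩)
  · exact h.elim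
  · rw [← hg, ← hg']
    by_cases hij : i = j
    · subst hij
      rw [(isModel σ).x_d_self]
      refine sub_mem (sum_mem fun k _ => ?_) ?_
      · rw [(isModel σ).d_coeff, mul_assoc]
        exact coeff_mul_mem _ (gen_mul_gen_mem_lowerSpan (p := Sum.inr (i, α))
          (q := Sum.inl (k, β)) (q' := Sum.inr (k, α)) trivial)
      · rw [← mul_one (coeff σ _)]
        exact coeff_mul_mem _ (Submodule.subset_span (Or.inl rfl))
    · rw [(isModel σ).x_d _ _ _ _ hij, (isModel σ).d_coeff, mul_assoc]
      exact coeff_mul_mem _ (gen_mul_gen_mem_lowerSpan (p := Sum.inr (i, α))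
        (q := Sum.inl (j, β)) (q' := Sum.inr (i, α)) trivial)
  · rcases h with h | ⟨rfl, h⟩
    · obtain ⟨b, hb⟩ := (isUnit_Rflip (K := K) j i).exists_left_inv
      have e := congrArg (coeff σ b * ·) (xgen_mul_xgen_of_gt (σ := σ) h β α)
      simp only at e
      rw [← mul_assoc, ← map_mul, hb, map_one, one_mul] at e
      rw [← hg', ← hg', e]
      exact coeff_mul_mem _ (add_mem
        (gen_mul_gen_mem_lowerSpan (p := Sum.inr (i, α)) (q := Sum.inr (j, β))
          (q' := Sum.inr (i, α)) (Or.inl h))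
        (coeff_mul_mem _ (gen_mul_gen_mem_lowerSpan (p := Sum.inr (i, α)) (q := Sum.inr (j, α))
          (q' := Sum.inr (i, β)) (Or.inl h))))
    · have e := (isModel σ).x_x j j α β
      rw [Rflip_of_le K le_rfl, if_pos rfl, map_one, one_mul, add_zero] at e
      rw [← hg', ← hg', e]
      exact gen_mul_gen_mem_lowerSpan (p := Sum.inr (j, α)) (q := Sum.inr (j, β))
        (q' := Sum.inr (j, α)) (Or.inr ⟨rfl, h⟩)

theorem pbwMonomial_eq_word (e : Fin n × Fin N ⊕ Fin n × Fin N' → ℕ) :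
    pbwMonomial σ e = ((powerWord (genOrder n N' N) e).map (gen σ)).prod :=
  (prod_map_powerWord _ _ _).symm

/-- Replacing a descent by an element of `lowerSpan` either shortens the word or lowers the letter
at that place, so the shortlex order decreases. Coefficients are carried to the left through the
prefix. -/
theorem word_mem_span (w : List (Fin n × Fin N ⊕ Fin n × Fin N')) :
    (w.map (gen σ)).prod ∈ Submodule.span (Ubar K n) (Set.range (pbwMonomial σ)) := by
  induction w using (List.Shortlex.wf wellFounded_genLt).induction with
  | _ w ih =>
  by_cases hw : w.IsChain fun p q => ¬ GenLt q p
  · have : IsTrans (Fin n × Fin N ⊕ Fin n × Fin N') (fun p q => ¬ GenLt q p) := ⟨by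
      intro a b c h h' h''
      rcases genLt_trichotomy a b with h₁ | rfl | h₁
      · exact h' (genLt_trans h'' h₁)
      · exact h' h''
      · exact h h₁⟩
    obtain ⟨e, rfl⟩ := exists_powerWord_of_sorted (List.isChain_iff_pairwise.1 hw)
    rw [← pbwMonomial_eq_word]
    exact Submodule.subset_span ⟨e, rfl⟩
  · rw [List.isChain_iff_forall_rel_of_append_cons_cons] at hw
    push Not at hw
    obtain ⟨a, b, l, l', rfl, hab⟩ := hw
    obtain ⟨m, hm⟩ := word_coeff σ l
    have key : ∀ y ∈ lowerSpan σ a, (l.map (gen σ)).prod * y * (l'.map (gen σ)).prod ∈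
        Submodule.span (Ubar K n) (Set.range (pbwMonomial σ)) := by
      intro y hy
      induction hy using Submodule.span_induction with
      | mem y hy =>
        rcases hy with rfl | ⟨c, d, hc, rfl⟩
        · have := ih (l ++ l') (List.Shortlex.of_length_lt (by simp))
          simpa using this
        · have := ih (l ++ c :: d :: l') (List.Shortlex.append_left
            (List.Shortlex.of_lex (by simp) (List.Lex.rel hc)) l)
          simpa [mul_assoc] using this
      | zero => simp
      | add y z _ _ hy hz => rw [mul_add, add_mul]; exact add_mem hy hz
      | smul c y _ hy =>
        rw [smul_eq_coeff_mul, ← mul_assoc, hm, mul_assoc, mul_assoc, ← mul_assoc (List.prod _)]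
        exact coeff_mul_mem _ hy
    have := key _ (gen_mul_gen_mem a b hab)
    simpa [mul_assoc] using this

theorem span_pbwMonomial (σ : Fin n → Fin N' → Fin N → Ubar K n) :
    Submodule.span (Ubar K n) (Set.range (pbwMonomial σ)) = ⊤ := by
  set W : Submodule (Ubar K n) (PairingRing σ) :=
    Submodule.span _ (Set.range fun w : List (Fin n × Fin N ⊕ Fin n × Fin N') =>
      (w.map (gen σ)).prod) with hW
  have hWle : W ≤ Submodule.span (Ubar K n) (Set.range (pbwMonomial σ)) :=
    Submodule.span_le.2 (by rintro _ ⟨w, rfl⟩; exact word_mem_span w)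
  have hgen : ∀ p, ∀ z ∈ W, gen σ p * z ∈ W := by
    intro p z hz
    induction hz using Submodule.span_induction with
    | mem z hz =>
      obtain ⟨w, rfl⟩ := hz
      exact Submodule.subset_span ⟨p :: w, by simp⟩
    | zero => simp
    | add y z _ _ hy hz => rw [mul_add]; exact add_mem hy hz
    | smul c z _ hz =>
      obtain ⟨m, hm⟩ := gen_coeff σ p
      rw [smul_eq_coeff_mul, ← mul_assoc, hm, mul_assoc]
      exact coeff_mul_mem _ hz
  -- `W` is a left ideal, and it contains `1` as the empty word.
  have hall : ∀ f, ∀ z ∈ W, HDeformed.mk σ f * z ∈ W := by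
    intro f
    induction f using FreeAlgebra.induction with
    | grade0 r =>
      intro z hz
      rw [AlgHom.commutes, ← AlgHom.commutes (coeff σ)]
      exact coeff_mul_mem _ hz
    | grade1 g =>
      intro z hz
      cases g with
      | coeff a => exact coeff_mul_mem a hz
      | x i α => exact hgen (Sum.inr (i, α)) z hz
      | d j β => exact hgen (Sum.inl (j, β)) z hz
    | mul a b ha hb => intro z hz; rw [map_mul, mul_assoc]; exact ha _ (hb z hz)
    | add a b ha hb => intro z hz; rw [map_add, add_mul]; exact add_mem (ha z hz) (hb z hz)
  refine eq_top_iff.2 fun y _ => hWle ?_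
  obtain ⟨f, rfl⟩ := RingQuot.mkAlgHom_surjective K (Rel σ) y
  have := hall f 1 (Submodule.subset_span ⟨[], rfl⟩)
  rwa [mul_one] at this

theorem pairingPBW_of_constant [CharZero K] {c : Fin N' → Fin N → K}
    (hc : ∀ i α β, σ i α β = algebraMap K _ (c α β)) : PairingPBW σ :=
  ⟨linearIndependent_pbwMonomial hc, span_pbwMonomial σ⟩

end Spanning
end
end HDeformed


namespace HDeformed

noncomputable section

open Finset

/-! ### Shift-invariant elements of `Ū(n)`. -/

section Invariants

variable {K : Type*} [Field K] {n : ℕ}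

theorem ubarShift_eq_of_wt {f : Ubar K n} (hf : ∀ i, ubarShift (wt i) f = f) (m : Fin n → ℤ) :
    ubarShift m f = f := by
  let S : AddSubgroup (Fin n → ℤ) :=
    { carrier := {m | ubarShift m f = f}
      zero_mem' := by simp [ubarShift_zero]
      add_mem' := fun {a b} ha hb => by
        have ha : ubarShift a f = f := ha
        have hb : ubarShift b f = f := hb
        change ubarShift (a + b) f = f
        rw [← ubarShift_comp, AlgHom.comp_apply, hb, ha]
      neg_mem' := fun {a} ha => by
        have ha : ubarShift a f = f := ha
        change ubarShift (-a) f = f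
        nth_rw 1 [← ha]
        exact ubarShift_neg_apply a f }
  change m ∈ S
  rw [← Finset.univ_sum_single m]
  refine sum_mem fun i _ => ?_
  have e : Pi.single i (m i) = m i • wt i := by
    ext j
    simp [Pi.single_apply]
  rw [e]
  exact zsmul_mem (show wt i ∈ S from hf i) _

theorem eval_shiftPoly (m : Fin n → ℤ) (x : Fin n → K) (p : MvPolynomial (Fin n) K) :
    MvPolynomial.eval x (shiftPoly m p) = MvPolynomial.eval (fun i => x i + m i) p := by
  induction p using MvPolynomial.induction_on with
  | C c => rw [← MvPolynomial.algebraMap_eq, AlgHom.commutes, MvPolynomial.algebraMap_eq]; simp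
  | add p q hp hq => simp only [map_add, hp, hq]
  | mul_X p i hp => simp only [map_mul, hp, shiftPoly_X, map_add, MvPolynomial.eval_X,
      MvPolynomial.eval_C]

variable [CharZero K]

/-- For `f = p / q` and a point `x` with `q(x) ≠ 0`, invariance gives `p(x) q(x + m) = p(x + m)
q(x)` for all integer vectors `m`. In characteristic zero these points are Zariski dense, so `p` is
a scalar multiple of `q`. -/
theorem exists_const_of_wt_invariant {f : Ubar K n} (hf : ∀ i, ubarShift (wt i) f = f) :
    ∃ c : K, f = algebraMap K _ c := by
  obtain ⟨⟨p, q⟩, hpq⟩ := IsLocalization.surj (denominators K n) f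
  simp only at hpq
  have hq0 : (q : MvPolynomial (Fin n) K) ≠ 0 := nonZeroDivisors.ne_zero (denominators_le q.2)
  obtain ⟨x, hx⟩ : ∃ x, MvPolynomial.eval x (q : MvPolynomial (Fin n) K) ≠ 0 := by
    by_contra! h
    exact hq0 (MvPolynomial.funext fun x => by rw [h x, map_zero])
  have hm : ∀ m : Fin n → ℤ, MvPolynomial.eval x p * MvPolynomial.eval (fun i => x i + m i) q.1 =
      MvPolynomial.eval (fun i => x i + m i) p * MvPolynomial.eval x q.1 := by
    intro m
    have h := congrArg (ubarShift m) hpq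
    rw [map_mul, ubarShift_eq_of_wt hf, ubarShift_algebraMap, ubarShift_algebraMap] at h
    have h' : p * shiftPoly m q.1 = shiftPoly m p * q.1 := by
      apply algebraMap_Ubar_injective
      rw [map_mul, map_mul, ← hpq, ← h]
      ring
    have := congrArg (MvPolynomial.eval x) h'
    rwa [map_mul, map_mul, eval_shiftPoly, eval_shiftPoly] at this
  have hp : MvPolynomial.C (MvPolynomial.eval x p) * q.1 =
      p * MvPolynomial.C (MvPolynomial.eval x q.1) := by
    -- Shifts by natural numbers already form a product of infinite sets.
    refine MvPolynomial.funext_set (fun i => Set.range fun m : ℕ => x i + m) (fun i => ?_) ?_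
    · exact Set.infinite_range_of_injective fun a b h => by simpa using h
    · intro y hy
      choose m hm' using fun i => hy i (Set.mem_univ i)
      obtain rfl : (fun i => x i + ((m i : ℤ) : K)) = y := funext fun i => by simpa using hm' i
      simpa using hm fun i => m i
  refine ⟨MvPolynomial.eval x p / MvPolynomial.eval x q.1, ?_⟩
  have hu := IsLocalization.map_units (Ubar K n) q
  rw [← hu.mul_left_inj, hpq, IsScalarTower.algebraMap_apply K (MvPolynomial (Fin n) K) (Ubar K n),
    ← map_mul]
  congr 1
  rw [MvPolynomial.algebraMap_eq, div_eq_mul_inv, mul_comm (MvPolynomial.eval x p), map_mul, mul_assoc,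
    hp, mul_left_comm, ← map_mul, inv_mul_cancel₀ hx, map_one, mul_one]

end Invariants

/-! ### Ordered forms of cubic words modulo cubic ordered monomials. -/

section Cubic

variable {K : Type*} [Field K] {n N' N : ℕ} {σ : Fin n → Fin N' → Fin N → Ubar K n}

variable (σ) in
/-- The combinations of the ordered monomials of degree three. -/
def cubicSpan : Submodule (Ubar K n) (PairingRing σ) :=
  Submodule.span _ (pbwMonomial σ '' {e | (powerWord (genOrder n N' N) e).length = 3})

theorem word_mem_cubicSpan {p q s : Fin n × Fin N ⊕ Fin n × Fin N'} (h : ¬ GenLt q p)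
    (h' : ¬ GenLt s q) (h'' : ¬ GenLt s p) : gen σ p * gen σ q * gen σ s ∈ cubicSpan σ := by
  obtain ⟨e, he⟩ := exists_powerWord_of_sorted (w := [p, q, s]) (by simp [h, h', h''])
  have : gen σ p * gen σ q * gen σ s = pbwMonomial σ e := by
    rw [pbwMonomial_eq_word, ← he]
    simp [mul_assoc]
  rw [this]
  exact Submodule.subset_span ⟨e, by rw [Set.mem_ofPred_eq, ← he]; rfl, rfl⟩

theorem cubicSpan_mul_coeff {y : PairingRing σ} (hy : y ∈ cubicSpan σ) (a : Ubar K n) :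
    y * coeff σ a ∈ cubicSpan σ := by
  induction hy using Submodule.span_induction with
  | mem y hy =>
    obtain ⟨e, he, rfl⟩ := hy
    obtain ⟨m, hm⟩ := word_coeff σ (powerWord (genOrder n N' N) e)
    rw [← pbwMonomial_eq_word] at hm
    rw [hm]
    exact coeff_mul_mem _ (Submodule.subset_span ⟨e, he, rfl⟩)
  | zero => simp
  | add y z _ _ hy hz => rw [add_mul]; exact add_mem hy hz
  | smul c y _ hy => rw [smul_eq_coeff_mul, mul_assoc]; exact coeff_mul_mem _ hy

/-- This is why the cubic parts of the overlaps need not be computed: independence separates degree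
one from degree three. -/
theorem eq_zero_of_add_mem_cubicSpan (h : LinearIndependent (Ubar K n) (pbwMonomial σ))
    {p q : Fin n × Fin N ⊕ Fin n × Fin N'} (hpq : p ≠ q) {a b : Ubar K n}
    (hab : coeff σ a * gen σ p + coeff σ b * gen σ q ∈ cubicSpan σ) : a = 0 ∧ b = 0 := by
  obtain ⟨e, he⟩ := exists_powerWord_of_sorted (w := [p]) (by simp)
  obtain ⟨e', he'⟩ := exists_powerWord_of_sorted (w := [q]) (by simp)
  have hp : gen σ p = pbwMonomial σ e := by rw [pbwMonomial_eq_word, ← he]; simp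
  have hq : gen σ q = pbwMonomial σ e' := by rw [pbwMonomial_eq_word, ← he']; simp
  have hee : e ≠ e' := fun h => hpq (by rw [← h] at he'; simpa using he.trans he'.symm)
  have hdisj : Disjoint {e | (powerWord (genOrder n N' N) e).length = 3} {e, e'} := by
    rw [Set.disjoint_left]
    rintro f hf (rfl | rfl)
    · rw [Set.mem_ofPred_eq, ← he] at hf; simp at hf
    · rw [Set.mem_ofPred_eq, ← he'] at hf; simp at hf
  have h0 : a • pbwMonomial σ e + b • pbwMonomial σ e' = 0 := by
    refine Submodule.disjoint_def.1 (h.disjoint_span_image hdisj) _ ?_ ?_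
    · rw [← hp, ← hq]; exact hab
    · exact add_mem (Submodule.smul_mem _ _ (Submodule.subset_span ⟨e, by simp, rfl⟩))
        (Submodule.smul_mem _ _ (Submodule.subset_span ⟨e', by simp, rfl⟩))
  classical
  have key := linearIndependent_iff'.1 h {e, e'} (fun f => if f = e then a else b) (by
    rw [sum_pair hee, if_pos rfl, if_neg hee.symm, h0])
  refine ⟨by simpa using key e (by simp), ?_⟩
  have := key e' (by simp)
  rwa [if_neg hee.symm] at this

/-- Exchanging two coordinates creates no term of lower degree; such terms only appear when a
coordinate passes a derivative. -/
theorem dgen_xgen_xgen_mem (p : Fin n × Fin N) (q s : Fin n × Fin N') :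
    dgen σ p.1 p.2 * (xgen σ q.1 q.2 * xgen σ s.1 s.2) ∈ cubicSpan σ := by
  by_cases h : GenLt (N := N) (Sum.inr s) (Sum.inr q)
  · obtain ⟨j, β⟩ := q
    obtain ⟨i, α⟩ := s
    rcases h with h | ⟨rfl, h⟩
    · obtain ⟨b, hb⟩ := (isUnit_Rflip (K := K) i j).exists_left_inv
      have e := congrArg (coeff σ b * ·) (xgen_mul_xgen_of_gt (σ := σ) h α β)
      simp only at e h
      rw [← mul_assoc, ← map_mul, hb, map_one, one_mul] at e
      have e' : ∀ a y, dgen σ p.1 p.2 * (coeff σ a * y) =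
          coeff σ (ubarShift (wt p.1) a) * (dgen σ p.1 p.2 * y) := fun a y => by
        rw [← mul_assoc, (isModel σ).d_coeff, mul_assoc]
      rw [e, e', mul_add, e']
      refine coeff_mul_mem _ (add_mem ?_ (coeff_mul_mem _ ?_)) <;> rw [← mul_assoc]
      · exact word_mem_cubicSpan (p := Sum.inl p) (q := Sum.inr (i, α)) (s := Sum.inr (j, β))
          id (by simp only [GenLt]; omega) id
      · exact word_mem_cubicSpan (p := Sum.inl p) (q := Sum.inr (i, β)) (s := Sum.inr (j, α))
          id (by simp only [GenLt]; omega) id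
    · simp only at h
      have e := (isModel σ).x_x i i β α
      rw [Rflip_of_le K le_rfl, if_pos rfl, map_one, one_mul, add_zero] at e
      simp only
      rw [e, ← mul_assoc]
      exact word_mem_cubicSpan (p := Sum.inl p) (q := Sum.inr (i, α)) (s := Sum.inr (i, β))
          id (by simp only [GenLt]; omega) id
  · rw [← mul_assoc]
    exact word_mem_cubicSpan (p := Sum.inl p) (q := Sum.inr q) (s := Sum.inr s) id h id

theorem dgen_dgen_xgen_mem (p q : Fin n × Fin N) (s : Fin n × Fin N') :
    dgen σ p.1 p.2 * dgen σ q.1 q.2 * xgen σ s.1 s.2 ∈ cubicSpan σ := by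
  by_cases h : GenLt (N' := N') (Sum.inl q) (Sum.inl p)
  · obtain ⟨i, α⟩ := p
    obtain ⟨j, β⟩ := q
    rcases h with h | ⟨rfl, h⟩
    · simp only at h ⊢
      rw [dgen_mul_dgen_of_lt h, add_mul, mul_assoc _ (coeff σ _), (isModel σ).coeff_x, ← mul_assoc]
      refine add_mem ?_ (cubicSpan_mul_coeff ?_ _)
      · exact word_mem_cubicSpan (p := Sum.inl (j, β)) (q := Sum.inl (i, α)) (s := Sum.inr s)
          (by simp only [GenLt]; omega) id id
      · exact word_mem_cubicSpan (p := Sum.inl (j, α)) (q := Sum.inl (i, β)) (s := Sum.inr s)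
          (by simp only [GenLt]; omega) id id
    · simp only at h
      have e := (isModel σ).d_d j j α β
      rw [Rflip_of_le K le_rfl, if_pos rfl, map_one, mul_one, add_zero] at e
      simp only
      rw [e]
      exact word_mem_cubicSpan (p := Sum.inl (j, β)) (q := Sum.inl (j, α)) (s := Sum.inr s)
          (by simp only [GenLt]; omega) id id
  · exact word_mem_cubicSpan (p := Sum.inl p) (q := Sum.inl q) (s := Sum.inr s) h id id

theorem dxx_mem (i j k : Fin n) (β : Fin N) (α γ : Fin N') (a b : Ubar K n) :
    dgen σ i β * coeff σ a * xgen σ j α * coeff σ b * xgen σ k γ ∈ cubicSpan σ := by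
  rw [(isModel σ).d_coeff, mul_assoc _ (coeff σ b), (isModel σ).coeff_x, ← mul_assoc]
  refine cubicSpan_mul_coeff ?_ _
  rw [mul_assoc, mul_assoc, ← mul_assoc (dgen σ i β)]
  exact coeff_mul_mem _ (by
    rw [mul_assoc]; exact dgen_xgen_xgen_mem (i, β) (j, α) (k, γ))

theorem ddx_mem (i j k : Fin n) (β γ : Fin N) (α : Fin N') (a b : Ubar K n) :
    dgen σ i β * coeff σ a * dgen σ j γ * coeff σ b * xgen σ k α ∈ cubicSpan σ := by
  rw [(isModel σ).d_coeff, mul_assoc _ (coeff σ b), (isModel σ).coeff_x, ← mul_assoc]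
  refine cubicSpan_mul_coeff ?_ _
  rw [mul_assoc, mul_assoc, ← mul_assoc (dgen σ i β)]
  exact coeff_mul_mem _ (dgen_dgen_xgen_mem (i, β) (j, γ) (k, α))

/-- The added summand cancels the linear remainder left by the zero-order term when the first
coordinate passes the derivative. -/
theorem xgen_mul_dx (a k l : Fin n) (α γ : Fin N') (β : Fin N) (c : Ubar K n) :
    xgen σ a α * (dgen σ k β * coeff σ c * xgen σ l γ) +
      (if k = a then coeff σ (σ a α β * c) * xgen σ l γ else 0) ∈ cubicSpan σ := by
  rw [← mul_assoc, ← mul_assoc]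
  by_cases h : k = a
  · subst h
    rw [(isModel σ).x_d_self, if_pos rfl, sub_mul, sub_mul, map_mul, sub_add_cancel, sum_mul, sum_mul]
    exact sum_mem fun m _ => dxx_mem _ _ _ _ _ _ _ _
  · rw [(isModel σ).x_d _ _ _ _ fun h' => h h'.symm, if_neg h, add_zero]
    exact dxx_mem _ _ _ _ _ _ _ _

theorem dx_mul_dgen (b k l : Fin n) (α : Fin N') (β γ : Fin N) (c : Ubar K n) :
    dgen σ k β * coeff σ c * xgen σ l α * dgen σ b γ +
      (if l = b then dgen σ k β * coeff σ (c * σ b α γ) else 0) ∈ cubicSpan σ := by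
  rw [mul_assoc]
  by_cases h : l = b
  · subst h
    rw [(isModel σ).x_d_self, if_pos rfl, mul_sub, map_mul, ← mul_assoc, sub_add_cancel, mul_sum]
    exact sum_mem fun m _ => by
      simp only [← mul_assoc]
      exact ddx_mem _ _ _ _ _ _ _ _
  · rw [(isModel σ).x_d _ _ _ _ h, if_neg h, add_zero, ← mul_assoc, ← mul_assoc]
    exact ddx_mem _ _ _ _ _ _ _ _

theorem xxd_of_ne {i j : Fin n} (hij : j ≠ i) (α γ : Fin N') (β : Fin N) :
    xgen σ i α * xgen σ j γ * dgen σ i β + coeff σ (σ i α β * Rflip K i j) * xgen σ j γ ∈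
      cubicSpan σ := by
  have h := xgen_mul_dx (σ := σ) i i j α γ β (Rflip K i j)
  rwa [if_pos rfl, ← (isModel σ).x_d _ _ _ _ hij, ← mul_assoc] at h

theorem xxd_self (a i : Fin n) (α γ : Fin N') (β : Fin N) :
    xgen σ a α * xgen σ i γ * dgen σ i β +
      (coeff σ (σ a α β * if a = i then 1 else Ring.inverse (hdiff K a i)) * xgen σ a γ +
        coeff σ (ubarShift (-wt a) (σ i γ β)) * xgen σ a α) ∈ cubicSpan σ := by
  have h : ∑ k, (xgen σ a α * (dgen σ k β *
      coeff σ (if k = i then 1 else Ring.inverse (hdiff K k i)) * xgen σ k γ) +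
      (if k = a then coeff σ (σ a α β * if k = i then 1 else Ring.inverse (hdiff K k i)) *
        xgen σ k γ else 0)) ∈ cubicSpan σ := sum_mem fun k _ => xgen_mul_dx a k k α γ β _
  rw [sum_add_distrib, sum_ite_eq' univ a, if_pos (mem_univ _), ← mul_sum] at h
  convert h using 1
  rw [mul_assoc, (isModel σ).x_d_self, mul_sub, (isModel σ).x_coeff]
  abel

theorem xdd_of_ne {i j : Fin n} (hij : i ≠ j) (α : Fin N') (β γ : Fin N) :
    xgen σ i α * (dgen σ j β * dgen σ i γ) + dgen σ j β * coeff σ (Rflip K j i * σ i α γ) ∈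
      cubicSpan σ := by
  have h := dx_mul_dgen (σ := σ) i j i α β γ (Rflip K j i)
  rwa [if_pos rfl, ← (isModel σ).x_d _ _ _ _ hij, mul_assoc] at h

theorem xdd_self (b i : Fin n) (α : Fin N') (β γ : Fin N) :
    xgen σ i α * (dgen σ i β * dgen σ b γ) +
      (dgen σ b β * coeff σ ((if b = i then 1 else Ring.inverse (hdiff K b i)) * σ b α γ) +
        coeff σ (σ i α β) * dgen σ b γ) ∈ cubicSpan σ := by
  have h : ∑ k, (dgen σ k β *
      coeff σ (if k = i then 1 else Ring.inverse (hdiff K k i)) * xgen σ k α * dgen σ b γ +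
      (if k = b then dgen σ k β *
        coeff σ ((if k = i then 1 else Ring.inverse (hdiff K k i)) * σ b α γ) else 0)) ∈
      cubicSpan σ := sum_mem fun k _ => dx_mul_dgen b k k α β γ _
  rw [sum_add_distrib, sum_ite_eq' univ b, if_pos (mem_univ _), ← sum_mul] at h
  convert h using 1
  rw [← mul_assoc, (isModel σ).x_d_self, sub_mul]
  abel

end Cubic
end
end HDeformed


namespace HDeformed

noncomputable section

open Finset

/-! ### The PBW property forces constant zero-order terms. -/

section Necessity

variable {K : Type*} [Field K] {n N' N : ℕ} {σ : Fin n → Fin N' → Fin N → Ubar K n}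

theorem isUnit_inverse_hdiff {i j : Fin n} (hij : i ≠ j) :
    IsUnit (Ring.inverse (hdiff K i j)) := (isUnit_hdiff K hij).ringInverse

/-- The overlap is `x^{iα} x^{iγ} ∂_{iβ}`, whose two coordinates commute; the coefficients of
`x^{iγ}` are compared. -/
theorem shift_self_of_x (h : LinearIndependent (Ubar K n) (pbwMonomial σ)) (i : Fin n)
    {α γ : Fin N'} (hαγ : α ≠ γ) (β : Fin N) : ubarShift (-wt i) (σ i α β) = σ i α β := by
  have h₁ := xxd_self (σ := σ) i i α γ β
  have h₂ := xxd_self (σ := σ) i i γ α β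
  have e := (isModel σ).x_x i i α γ
  rw [Rflip_of_le K le_rfl, if_pos rfl, map_one, one_mul, add_zero] at e
  rw [if_pos rfl, mul_one] at h₁ h₂
  rw [e] at h₁
  have h₃ : coeff σ (σ i α β - ubarShift (-wt i) (σ i α β)) * gen σ (Sum.inr (i, γ)) +
      coeff σ (ubarShift (-wt i) (σ i γ β) - σ i γ β) * gen σ (Sum.inr (i, α)) ∈ cubicSpan σ := by
    convert sub_mem h₁ h₂ using 1
    simp only [gen, Sum.elim_inr, map_sub, sub_mul]
    abel
  have := (eq_zero_of_add_mem_cubicSpan h (by simpa using hαγ.symm) h₃).1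
  exact (sub_eq_zero.1 this).symm

/-- The overlap is `x^{iα} x^{jγ} ∂_{iβ}`, reduced directly and after exchanging the coordinates.
The coefficients of `x^{jγ}` and of `x^{jα}` give the two equations, after division by units. -/
theorem shift_ne_of_x (h : LinearIndependent (Ubar K n) (pbwMonomial σ)) {i j : Fin n}
    (hij : i ≠ j) {α γ : Fin N'} (hαγ : α ≠ γ) (β : Fin N) :
    ubarShift (-wt j) (σ i α β) = σ i α β ∧ σ j γ β = σ i γ β := by
  have h₁ := xxd_of_ne (σ := σ) hij.symm α γ β
  have h₂ := xxd_self (σ := σ) j i γ α β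
  have h₃ := xxd_of_ne (σ := σ) hij.symm γ α β
  have e := (isModel σ).x_x i j α γ
  rw [if_neg hij, mul_assoc, mul_assoc] at e
  rw [if_neg hij.symm] at h₂
  rw [e, add_mul, mul_assoc, mul_assoc] at h₁
  have h₄ : coeff σ (Rflip K i j * (σ i α β - ubarShift (-wt j) (σ i α β))) *
      gen σ (Sum.inr (j, γ)) +
      coeff σ (Ring.inverse (hdiff K j i) * (Rflip K i j * (σ i γ β - σ j γ β))) *
        gen σ (Sum.inr (j, α)) ∈ cubicSpan σ := by
    convert sub_mem (sub_mem h₁ (coeff_mul_mem (Rflip K i j) h₂))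
      (coeff_mul_mem (Ring.inverse (hdiff K i j)) h₃) using 1
    rw [inverse_hdiff_comm hij]
    simp only [gen, Sum.elim_inr, map_sub, map_mul, map_neg, sub_mul, mul_sub, mul_add, neg_mul,
      ← mul_assoc]
    simp only [← map_mul, mul_assoc, mul_comm, mul_left_comm]
    abel
  obtain ⟨h₅, h₆⟩ := eq_zero_of_add_mem_cubicSpan h (by simpa using hαγ.symm) h₄
  rw [(isUnit_Rflip i j).mul_right_eq_zero] at h₅
  rw [(isUnit_inverse_hdiff hij.symm).mul_right_eq_zero, (isUnit_Rflip i j).mul_right_eq_zero] at h₆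
  exact ⟨(sub_eq_zero.1 h₅).symm, (sub_eq_zero.1 h₆).symm⟩

theorem shift_self_of_d (h : LinearIndependent (Ubar K n) (pbwMonomial σ)) (i : Fin n)
    (α : Fin N') {β γ : Fin N} (hβγ : β ≠ γ) : ubarShift (wt i) (σ i α β) = σ i α β := by
  have h₁ := xdd_self (σ := σ) i i α β γ
  have h₂ := xdd_self (σ := σ) i i α γ β
  have e := (isModel σ).d_d i i β γ
  rw [Rflip_of_le K le_rfl, if_pos rfl, map_one, mul_one, add_zero] at e
  rw [if_pos rfl, one_mul, (isModel σ).d_coeff] at h₁ h₂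
  rw [e] at h₁
  have h₃ : coeff σ (σ i α β - ubarShift (wt i) (σ i α β)) * gen σ (Sum.inl (i, γ)) +
      coeff σ (ubarShift (wt i) (σ i α γ) - σ i α γ) * gen σ (Sum.inl (i, β)) ∈ cubicSpan σ := by
    convert sub_mem h₁ h₂ using 1
    simp only [gen, Sum.elim_inl, map_sub, sub_mul]
    abel
  have := (eq_zero_of_add_mem_cubicSpan h (by simpa using hβγ.symm) h₃).1
  exact (sub_eq_zero.1 this).symm

theorem Rflip_mul_Rflip {i j : Fin n} (hij : i ≠ j) : Rflip K i j * Rflip K j i =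
    1 - Ring.inverse (hdiff K j i) * Ring.inverse (hdiff K j i) := by
  rcases lt_or_gt_of_ne hij with h | h
  · rw [Rflip_of_lt' h, Rflip_of_le K h.le, mul_one]
  · rw [Rflip_of_lt' h, Rflip_of_le K h.le, one_mul, inverse_hdiff_comm hij]
    ring

/-- The overlap is `x^{iα} ∂_{iβ} ∂_{jγ}`; the coefficients of `∂_{jβ}` and of `∂_{jγ}` are
compared. -/
theorem shift_relations_of_d (h : LinearIndependent (Ubar K n) (pbwMonomial σ)) {i j : Fin n}
    (hij : i ≠ j) (α : Fin N') {β γ : Fin N} (hβγ : β ≠ γ) :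
    σ j α γ = ubarShift (-wt j) (σ i α γ) ∧ ubarShift (-wt j) (σ i α β) =
      Rflip K i j * Rflip K j i * σ i α β +
        Ring.inverse (hdiff K j i) * Ring.inverse (hdiff K j i) * σ j α β := by
  have h₁ := xdd_self (σ := σ) j i α β γ
  have h₂ := xdd_of_ne (σ := σ) hij α γ β
  have h₃ := xdd_self (σ := σ) j i α γ β
  have e := (isModel σ).d_d i j β γ
  rw [if_neg hij.symm] at e h₁ h₃
  rw [e] at h₁
  generalize hw : Ring.inverse (hdiff K j i) = w at *
  have h₄ : dgen σ j β * coeff σ (w * (σ j α γ - ubarShift (-wt j) (σ i α γ))) +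
      dgen σ j γ * coeff σ (ubarShift (-wt j) (σ i α β) -
        (Rflip K i j * Rflip K j i * σ i α β + w * w * σ j α β)) ∈ cubicSpan σ := by
    convert sub_mem (sub_mem h₁ (cubicSpan_mul_coeff h₂ (Rflip K i j))) (cubicSpan_mul_coeff h₃ w)
      using 1
    simp only [(isModel σ).coeff_d, map_sub, map_add, mul_sub, mul_add, add_mul, mul_assoc]
    simp only [← map_mul, mul_comm, mul_left_comm]
    abel
  rw [(isModel σ).d_coeff, (isModel σ).d_coeff] at h₄
  obtain ⟨h₅, h₆⟩ := eq_zero_of_add_mem_cubicSpan h (p := Sum.inl (j, β)) (q := Sum.inl (j, γ))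
    (by simpa using hβγ) h₄
  have hu : IsUnit w := hw ▸ isUnit_inverse_hdiff hij.symm
  rw [map_eq_zero_iff _ (ubarShift_injective _)] at h₅ h₆
  rw [hu.mul_right_eq_zero] at h₅
  exact ⟨sub_eq_zero.1 h₅, sub_eq_zero.1 h₆⟩

/-- The first relation, with the copies exchanged, identifies `σ j α β` with the shift of `σ i α β`.
In the second one the factors are then `1 - w²` and `w²`, and since `1 - w²` is a unit the shift
acts trivially. -/
theorem shift_ne_of_d (h : LinearIndependent (Ubar K n) (pbwMonomial σ)) {i j : Fin n}
    (hij : i ≠ j) (α : Fin N') {β γ : Fin N} (hβγ : β ≠ γ) :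
    ubarShift (-wt j) (σ i α β) = σ i α β ∧ σ j α β = σ i α β := by
  have h₁ := (shift_relations_of_d h hij α hβγ.symm).1
  have h₂ := (shift_relations_of_d h hij α hβγ).2
  have hu := (isUnit_Rflip (K := K) i j).mul (isUnit_Rflip j i)
  have h₃ : ubarShift (-wt j) (σ i α β) = σ i α β := by
    rw [h₁] at h₂
    rw [← hu.mul_right_inj]
    rw [Rflip_mul_Rflip hij] at h₂ ⊢
    linear_combination h₂
  exact ⟨h₃, h₁.trans h₃⟩

theorem exists_const_of_shift [CharZero K]
    (h₁ : ∀ i j α β, ubarShift (-wt j) (σ i α β) = σ i α β)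
    (h₂ : ∀ i j α β, σ j α β = σ i α β) :
    ∃ c : Fin N' → Fin N → K, ∀ i α β, σ i α β = algebraMap K _ (c α β) := by
  rcases isEmpty_or_nonempty (Fin n) with hn | ⟨⟨i₀⟩⟩
  · exact ⟨0, fun i => hn.elim i⟩
  · choose c hc using fun α β => exists_const_of_wt_invariant (f := σ i₀ α β) fun j => by
      nth_rw 1 [← h₁ i₀ j α β]
      exact ubarShift_apply_neg _ _
    exact ⟨c, fun i α β => (h₂ i₀ i α β).trans (hc α β)⟩

theorem exists_ne_of_one_lt {M : ℕ} (hM : 1 < M) (a : Fin M) : ∃ b, a ≠ b :=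
  haveI : Nontrivial (Fin M) := Fin.nontrivial_iff_two_le.2 hM
  (exists_ne a).imp fun _ h => h.symm

/-- A second copy `γ` makes the two linear monomials of an overlap distinct, so that their
coefficients can be compared separately. It may be a copy of the derivatives or of the coordinates.
-/
theorem pairingPBW_iff_constant [CharZero K] (hN : 1 < N ∨ 1 < N') :
    PairingPBW σ ↔ ∃ c : Fin N' → Fin N → K, ∀ i α β, σ i α β = algebraMap K _ (c α β) := by
  refine ⟨fun ⟨h, _⟩ => ?_, fun ⟨c, hc⟩ => pairingPBW_of_constant hc⟩
  have h : LinearIndependent (Ubar K n) (pbwMonomial σ) := h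
  rcases hN with hN | hN
  · refine exists_const_of_shift (fun i j α β => ?_) fun i j α β => ?_ <;>
      obtain ⟨γ, hγ⟩ := exists_ne_of_one_lt hN β <;> by_cases hij : i = j
    · subst hij
      nth_rw 1 [← shift_self_of_d h i α hγ]
      exact ubarShift_neg_apply _ _
    · exact (shift_ne_of_d h hij α hγ).1
    · rw [hij]
    · exact (shift_ne_of_d h hij α hγ).2
  · refine exists_const_of_shift (fun i j α β => ?_) fun i j α β => ?_ <;>
      obtain ⟨γ, hγ⟩ := exists_ne_of_one_lt hN α <;> by_cases hij : i = j
    · subst hij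
      exact shift_self_of_x h i hγ β
    · exact (shift_ne_of_x h hij hγ β).1
    · rw [hij]
    · exact (shift_ne_of_x h hij hγ.symm β).2

end Necessity
end
end HDeformed


namespace HDeformed

noncomputable section

open Finset Module

/-! ### Rank normal form of a matrix. -/

section NormalForm

variable {K : Type*} [Field K]

theorem exists_basis_of_isCompl {V : Type*} [AddCommGroup V] [Module K V] {r m : ℕ}
    (b₀ : Basis (Fin m) K V) {p q : Submodule K V} (h : IsCompl p q) (bp : Basis (Fin r) K p) :
    r ≤ m ∧ ∃ b : Basis (Fin m) K V, (∀ (i : Fin m) (hi : (i : ℕ) < r), b i = bp ⟨i, hi⟩) ∧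
      ∀ i : Fin m, r ≤ (i : ℕ) → b i ∈ q := by
  have := b₀.finiteDimensional_of_finite
  let bq := finBasis K q
  let b := ((bp.prod bq).map (Submodule.prodEquivOfIsCompl p q h)).reindex finSumFinEquiv
  have hm : r + finrank K q = m := by
    simpa using (Fintype.card_congr (b.indexEquiv b₀))
  subst hm
  refine ⟨by omega, b, fun i hi => ?_, fun i hi => ?_⟩
  · obtain ⟨j, rfl⟩ : ∃ j, Fin.castAdd _ j = i := ⟨⟨i, hi⟩, rfl⟩
    simp [b]
  · obtain ⟨j, rfl⟩ : ∃ j, Fin.natAdd r j = i := ⟨⟨i - r, by omega⟩, by ext; simp; omega⟩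
    simp [b]

/-- The `m' × m` matrix `diag(1, …, 1, 0, …, 0)` with `r` ones. -/
def diagMatrix (K : Type*) [Field K] (m' m r : ℕ) : Matrix (Fin m') (Fin m) K :=
  fun α β => if (α : ℕ) = β ∧ (α : ℕ) < r then 1 else 0

/-- `c` maps a complement of its kernel isomorphically onto its range; a basis of the complement and
its image are completed by the kernel and by a complement of the range. The transpose is the one in
the rule `A τ Bᵀ`. -/
theorem exists_diagMatrix {m' m : ℕ} (c : Matrix (Fin m') (Fin m) K) :
    ∃ r, r ≤ m' ∧ r ≤ m ∧ ∃ (A : GL (Fin m') K) (B : GL (Fin m) K),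
      c = A.val * diagMatrix K m' m r * B.val.transpose := by
  obtain ⟨W, hW⟩ := (LinearMap.ker c.mulVecLin).exists_isCompl
  obtain ⟨W', hW'⟩ := (LinearMap.range c.mulVecLin).exists_isCompl
  let bW := finBasis K W
  let bR := bW.map (LinearMap.kerComplementEquivRange c.mulVecLin hW.symm)
  obtain ⟨hr, b, hb, hb'⟩ := exists_basis_of_isCompl (Pi.basisFun K (Fin m)) hW.symm bW
  obtain ⟨hr', b', hbR, -⟩ := exists_basis_of_isCompl (Pi.basisFun K (Fin m')) hW' bR
  let Q : GL (Fin m') K := ⟨(Pi.basisFun K _).toMatrix b', b'.toMatrix (Pi.basisFun K _),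
    Basis.toMatrix_mul_toMatrix_flip _ _, Basis.toMatrix_mul_toMatrix_flip _ _⟩
  let P : GL (Fin m) K := ⟨b.toMatrix (Pi.basisFun K _), (Pi.basisFun K _).toMatrix b,
    Basis.toMatrix_mul_toMatrix_flip _ _, Basis.toMatrix_mul_toMatrix_flip _ _⟩
  let B : GL (Fin m) K := ⟨P.val.transpose, P.inv.transpose, by
    rw [← Matrix.transpose_mul, P.inv_val, Matrix.transpose_one], by
    rw [← Matrix.transpose_mul, P.val_inv, Matrix.transpose_one]⟩
  refine ⟨_, hr', hr, Q, B, ?_⟩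
  have key : c * P.inv = Q.val * diagMatrix K m' m (finrank K W) := by
    ext α β
    have h₁ : (c * P.inv) α β = c.mulVecLin (b β) α := by
      simp [P, Matrix.mul_apply, Matrix.mulVec, dotProduct, Basis.toMatrix_apply]
    have h₂ : (Q.val * diagMatrix K m' m (finrank K W)) α β =
        ∑ γ : Fin m', if (γ : ℕ) = β ∧ (γ : ℕ) < finrank K W then b' γ α else 0 := by
      simp [Q, diagMatrix, Matrix.mul_apply, Basis.toMatrix_apply]
    rw [h₁, h₂]
    by_cases hβ : (β : ℕ) < finrank K W
    · rw [sum_eq_single (⟨β, by omega⟩ : Fin m')]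
      · rw [if_pos ⟨rfl, hβ⟩, hbR _ hβ, hb _ hβ]
        simp [bR]
      · intro γ _ hγ
        rw [if_neg fun h => hγ (Fin.ext h.1)]
      · simp
    · have := LinearMap.mem_ker.1 (hb' β (by omega))
      rw [this]
      exact (sum_eq_zero fun γ _ => if_neg (by omega)).symm
  have hB : B.val.transpose = P.val := Matrix.transpose_transpose _
  rw [hB, ← key, Matrix.mul_assoc, P.inv_val, Matrix.mul_one]

end NormalForm

/-! ### Isomorphisms given by invertible redefinitions. -/

section Redefinition

variable {K : Type*} [Field K] {n N' N : ℕ} {σ τ : Fin n → Fin N' → Fin N → Ubar K n}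

theorem sum_smul_constant {M' M : ℕ} {τ : Fin n → Fin M' → Fin M → Ubar K n}
    {c : Matrix (Fin M') (Fin M) K} (hτ : ∀ i α β, τ i α β = algebraMap K _ (c α β))
    (A : Matrix (Fin N') (Fin M') K) (B : Matrix (Fin N) (Fin M) K) (i : Fin n) (α : Fin N')
    (β : Fin N) : ∑ α', ∑ β', (A α α' * B β β') • τ i α' β' =
      algebraMap K _ ((A * c * B.transpose) α β) := by
  simp only [hτ, Matrix.mul_apply, Matrix.transpose_apply, sum_mul, map_sum, Algebra.smul_def,
    ← map_mul]
  rw [sum_comm]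
  exact sum_congr rfl fun _ _ => sum_congr rfl fun _ _ => by ring_nf

theorem exists_linearRedefinition {c c' : Matrix (Fin N') (Fin N) K}
    (hσ : ∀ i α β, σ i α β = algebraMap K _ (c α β))
    (hτ : ∀ i α β, τ i α β = algebraMap K _ (c' α β)) (A : GL (Fin N') K) (B : GL (Fin N) K)
    (h : c = A.val * c' * B.val.transpose) :
    ∃ Φ : PairingRing σ ≃ₐ[K] PairingRing τ, IsLinearRedefinition Φ A B := by
  -- Hence the inverse matrices define a homomorphism in the opposite direction.
  have h' : c' = A.inv * c * B.inv.transpose := by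
    rw [h, Matrix.mul_assoc, Matrix.mul_assoc _ _ B.inv.transpose, ← Matrix.transpose_mul, B.inv_val,
      Matrix.transpose_one, Matrix.mul_one, ← Matrix.mul_assoc, A.inv_val, Matrix.one_mul]
  have HF := (isModel τ).linearCombination (σ := σ) A.val B.val fun i α β => by
    rw [sum_smul_constant hτ, ← h, hσ]
  have HG := (isModel σ).linearCombination (σ := τ) A.inv B.inv fun i α β => by
    rw [sum_smul_constant hσ, ← h', hτ]
  have comb : ∀ {ι V : Type _} [Fintype ι] [DecidableEq ι] [AddCommGroup V] [Module K V]
      (P Q : Matrix ι ι K) (_ : P * Q = 1) (y : ι → V) (i : ι),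
      ∑ j, P i j • ∑ k, Q j k • y k = y i := by
    intro ι V _ _ _ _ P Q hPQ y i
    simp only [smul_sum, smul_smul]
    rw [sum_comm]
    simp only [← sum_smul, ← Matrix.mul_apply, hPQ, Matrix.one_apply, ite_smul, one_smul, zero_smul]
    simp
  refine ⟨AlgEquiv.ofAlgHom HF.lift HG.lift (algHom_ext (fun a => ?_) (fun i α => ?_) fun i β => ?_)
    (algHom_ext (fun a => ?_) (fun i α => ?_) fun i β => ?_), fun a => HF.lift_coeff a,
    fun i α => HF.lift_xgen i α, fun i β => HF.lift_dgen i β⟩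
  · exact (congrArg HF.lift (HG.lift_coeff a)).trans (HF.lift_coeff a)
  · simp only [AlgHom.comp_apply, HG.lift_xgen, map_sum, map_smul, HF.lift_xgen, AlgHom.id_apply]
    exact comb _ _ A.inv_val _ _
  · simp only [AlgHom.comp_apply, HG.lift_dgen, map_sum, map_smul, HF.lift_dgen, AlgHom.id_apply]
    exact comb _ _ B.inv_val _ _
  · exact (congrArg HG.lift (HF.lift_coeff a)).trans (HG.lift_coeff a)
  · simp only [AlgHom.comp_apply, HF.lift_xgen, map_sum, map_smul, HG.lift_xgen, AlgHom.id_apply]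
    exact comb _ _ A.val_inv _ _
  · simp only [AlgHom.comp_apply, HF.lift_dgen, map_sum, map_smul, HG.lift_dgen, AlgHom.id_apply]
    exact comb _ _ B.val_inv _ _

end Redefinition

/-! ### Embeddings of rings with fewer copies. -/

section Embedding

variable {K : Type*} [Field K] {n N' N M' M : ℕ} {σ : Fin n → Fin M' → Fin M → Ubar K n}
  {τ : Fin n → Fin N' → Fin N → Ubar K n} {a : Fin M' → Fin N'} {b : Fin M → Fin N}

theorem powerWord_injective {ι : Type*} {l : List ι} (hl : l.Nodup) (hmem : ∀ q, q ∈ l) :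
    Function.Injective (powerWord l) := by
  classical
  intro e e' h
  funext q
  rw [← count_powerWord hl e (hmem q), h, count_powerWord hl e' (hmem q)]

theorem nodup_genOrder : (genOrder n N' N).Nodup :=
  pairwise_genOrder.imp fun {a b} h (e : a = b) => genLt_irrefl _ (e ▸ h)

/-- Strict monotonicity preserves the order of the generators, so ordered monomials go to distinct
ordered monomials. Spanning in the source and independence in the target suffice for injectivity. -/
theorem embedsAlong (hτ : LinearIndependent (Ubar K n) (pbwMonomial τ)) (ha : StrictMono a)
    (hb : StrictMono b) (h : ∀ i α β, σ i α β = τ i (a α) (b β)) : EmbedsAlong σ τ a b := by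
  have H : IsModel σ (coeff τ) (fun i α => xgen τ i (a α)) (fun i β => dgen τ i (b β)) := by
    have := (isModel τ).linearCombination (σ := σ) (fun α => Pi.single (a α) 1)
      (fun β => Pi.single (b β) 1) fun i α β => by
        simp [h, Pi.single_apply]
    simpa [Pi.single_apply, ite_smul] using this
  let ι : Fin n × Fin M ⊕ Fin n × Fin M' → Fin n × Fin N ⊕ Fin n × Fin N' :=
    Sum.map (Prod.map id b) (Prod.map id a)
  have hι : ∀ p q, GenLt p q ↔ GenLt (ι p) (ι q) := by
    rintro (p | p) (q | q) <;> simp [ι, GenLt, ha.lt_iff_lt, hb.lt_iff_lt]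
  have hιinj : Function.Injective ι :=
    (Function.injective_id.prodMap hb.injective).sumMap (Function.injective_id.prodMap ha.injective)
  have hgen : ∀ p, H.lift (gen σ p) = gen τ (ι p) := by
    rintro (p | p)
    · exact H.lift_dgen _ _
    · exact H.lift_xgen _ _
  have hE : ∀ e, ∃ e', (powerWord (genOrder n M' M) e).map ι = powerWord (genOrder n N' N) e' := by
    intro e
    refine exists_powerWord_of_sorted ?_
    rw [List.pairwise_map]
    simp only [← hι]
    exact pairwise_powerWord _ _
      (pairwise_genOrder.imp fun h h' => genLt_irrefl _ (genLt_trans h h')) genLt_irrefl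
  choose E hE using hE
  have hEinj : Function.Injective E := by
    intro e e' hee
    refine powerWord_injective nodup_genOrder mem_genOrder (List.map_injective_iff.2 hιinj ?_)
    rw [hE, hE, hee]
  have hmon : ∀ e, H.lift (pbwMonomial σ e) = pbwMonomial τ (E e) := by
    intro e
    rw [pbwMonomial_eq_word, pbwMonomial_eq_word, ← hE, map_list_prod, List.map_map, List.map_map]
    congr 1
    exact List.map_congr_left fun p _ => hgen p
  refine ⟨H.lift, (injective_iff_map_eq_zero _).2 fun y hy => ?_, H.lift_coeff, H.lift_xgen,
    H.lift_dgen⟩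
  have hspan : y ∈ Submodule.span (Ubar K n) (Set.range (pbwMonomial σ)) := by
    rw [span_pbwMonomial]; trivial
  obtain ⟨g, rfl⟩ := Finsupp.mem_span_range_iff_exists_finsupp.1 hspan
  have h0 : g.sum (fun e c => c • pbwMonomial τ (E e)) = 0 := by
    rw [← hy, Finsupp.sum, Finsupp.sum, map_sum]
    refine sum_congr rfl fun e _ => ?_
    rw [smul_eq_coeff_mul, smul_eq_coeff_mul, map_mul, H.lift_coeff, hmon]
  have hg := linearIndependent_iff'.1 (hτ.comp E hEinj) g.support g h0
  exact sum_eq_zero fun e he => by simp [hg e he]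

end Embedding
end
end HDeformed


namespace HDeformed

noncomputable section

/-! ### Diagonal form and the non-degenerate case. -/

section Consequences

variable {K : Type*} [Field K] {n N' N : ℕ}

theorem diagSigma_eq (r : ℕ) (i : Fin n) (α : Fin N') (β : Fin N) :
    diagSigma K n N' N r i α β = algebraMap K _ (diagMatrix K N' N r α β) := by
  rw [diagSigma, diagMatrix]
  split_ifs <;> simp

theorem linearIndependent_diagSigma [CharZero K] (r : ℕ) :
    LinearIndependent (Ubar K n) (pbwMonomial (diagSigma K n N' N r)) :=
  linearIndependent_pbwMonomial (diagSigma_eq r)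

theorem exists_diag_redefinition {σ : Fin n → Fin N' → Fin N → Ubar K n}
    {c : Fin N' → Fin N → K} (hc : ∀ i α β, σ i α β = algebraMap K _ (c α β)) :
    ∃ r : ℕ, r ≤ N' ∧ r ≤ N ∧ ∃ (A : GL (Fin N') K) (B : GL (Fin N) K)
      (Φ : PairingRing σ ≃ₐ[K] PairingRing (diagSigma K n N' N r)), IsLinearRedefinition Φ A B := by
  obtain ⟨r, hr', hr, A, B, h⟩ := exists_diagMatrix (Matrix.of c)
  exact ⟨r, hr', hr, A, B, exists_linearRedefinition hc (diagSigma_eq r) A B h⟩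

theorem exists_diff_redefinition {M : ℕ} {τ : Fin n → Fin M → Fin M → Ubar K n}
    {c : Fin M → Fin M → K} (hc : ∀ i α β, τ i α β = algebraMap K _ (c α β))
    (hdet : ∀ i, (Matrix.of (τ i)).det ≠ 0) :
    ∃ (A : GL (Fin M) K) (B : GL (Fin M) K)
      (Φ : PairingRing τ ≃ₐ[K] PairingRing (diffSigma K n M)), IsLinearRedefinition Φ A B := by
  have hdiff : ∀ (i : Fin n) α β, diffSigma K n M i α β =
      algebraMap K _ ((1 : Matrix (Fin M) (Fin M) K) α β) := by
    intro i α β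
    rw [diffSigma, Matrix.one_apply]
    split_ifs <;> simp
  rcases isEmpty_or_nonempty (Fin n) with hn | ⟨⟨i₀⟩⟩
  -- For `n = 0` the determinant condition is vacuous and `c` may be singular; there are no
  -- generators, and the identity matrix can replace `c`.
  · exact ⟨1, 1, exists_linearRedefinition (c := 1) (fun i => hn.elim i) hdiff 1 1 (by simp)⟩
  · have h0 : (Matrix.of c).det ≠ 0 := fun h => by
      refine hdet i₀ ?_
      have : Matrix.of (τ i₀) = (algebraMap K (Ubar K n)).mapMatrix (Matrix.of c) := by
        ext α β
        simp [hc]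
      rw [this, ← RingHom.map_det, h, map_zero]
    refine ⟨Matrix.GeneralLinearGroup.mkOfDetNeZero _ h0, 1,
      exists_linearRedefinition (c := Matrix.of c) hc hdiff _ 1 ?_⟩
    simp [Matrix.GeneralLinearGroup.mkOfDetNeZero]

end Consequences
end
end HDeformed

theorem mainTheorem10 {K : Type*} [Field K] [CharZero K] (n N' N : ℕ) (hN : 1 < N ∨ 1 < N')
    (σ : Fin n → Fin N' → Fin N → HDeformed.Ubar K n) :
    -- the PBW property holds exactly for constant zero-order terms
    (HDeformed.PairingPBW σ ↔
      ∃ c : Fin N' → Fin N → K, ∀ i α β, σ i α β = algebraMap K (HDeformed.Ubar K n) (c α β)) ∧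
    -- then, after a linear redefinition of the generators, the ring is formed by `r` copies of
    -- `Diff_h(n)`, `N' - r` copies of `V(n)` and `N - r` copies of `V*(n)`
    (HDeformed.PairingPBW σ →
      ∃ r : ℕ, r ≤ N' ∧ r ≤ N ∧
        (∃ (A : GL (Fin N') K) (B : GL (Fin N) K)
          (Φ : HDeformed.PairingRing σ ≃ₐ[K]
            HDeformed.PairingRing (HDeformed.diagSigma K n N' N r)),
          HDeformed.IsLinearRedefinition Φ A B) ∧
        (∀ (α : Fin N') (β : Fin N), (α : ℕ) = β → (α : ℕ) < r →
          HDeformed.EmbedsAlong (HDeformed.diffSigma K n 1) (HDeformed.diagSigma K n N' N r)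
            (fun _ => α) (fun _ => β)) ∧
        (∀ α : Fin N', r ≤ (α : ℕ) →
          HDeformed.EmbedsAlong (HDeformed.vSigma K n) (HDeformed.diagSigma K n N' N r)
            (fun _ => α) Fin.elim0) ∧
        (∀ β : Fin N, r ≤ (β : ℕ) →
          HDeformed.EmbedsAlong (HDeformed.vStarSigma K n) (HDeformed.diagSigma K n N' N r)
            Fin.elim0 (fun _ => β))) ∧
    -- in particular `Diff_h(n, M)` is the only non-degenerate possibility
    (∀ M : ℕ, 1 < M → ∀ τ : Fin n → Fin M → Fin M → HDeformed.Ubar K n,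
      HDeformed.PairingPBW τ → (∀ i, (Matrix.of (τ i)).det ≠ 0) →
        ∃ (A : GL (Fin M) K) (B : GL (Fin M) K)
          (Φ : HDeformed.PairingRing τ ≃ₐ[K]
            HDeformed.PairingRing (HDeformed.diffSigma K n M)),
          HDeformed.IsLinearRedefinition Φ A B) := by
  refine ⟨HDeformed.pairingPBW_iff_constant hN, fun hσ => ?_, fun M hM τ hτ hdet => ?_⟩
  · obtain ⟨c, hc⟩ := (HDeformed.pairingPBW_iff_constant hN).1 hσ
    obtain ⟨r, hr', hr, h⟩ := HDeformed.exists_diag_redefinition hc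
    have hind := HDeformed.linearIndependent_diagSigma (K := K) (n := n) (N' := N') (N := N) r
    refine ⟨r, hr', hr, h, fun α β hαβ hα => ?_, fun α _ => ?_, fun β _ => ?_⟩
    · exact HDeformed.embedsAlong hind (Subsingleton.strictMono _) (Subsingleton.strictMono _)
        fun i α' β' => by
          rw [HDeformed.diagSigma, if_pos ⟨hαβ, hα⟩, HDeformed.diffSigma,
            if_pos (Subsingleton.elim _ _)]
    · exact HDeformed.embedsAlong hind (Subsingleton.strictMono _) (Subsingleton.strictMono _)
        fun i α' β' => β'.elim0
    · exact HDeformed.embedsAlong hind (Subsingleton.strictMono _) (Subsingleton.strictMono _)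
        fun i α' β' => α'.elim0
  · obtain ⟨c, hc⟩ := (HDeformed.pairingPBW_iff_constant (Or.inl hM)).1 hτ
    exact HDeformed.exists_diff_redefinition hc hdet
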